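/- Let $n\ge 1$ be an integer, $0<\alpha<1$, $1\le p<\infty$, $1<q<\infty$, $p\wedge q=\min\{p,q\}$, and $\mathbb R^{1+n}_+=(0,\infty)\times\mathbb R^n$. For $t>0$ and $x\in\mathbb R^n$ let $$K_t(x)=(2\pi)^{-n}\int_{\mathbb R^n}e^{ix\cdot y-t|y|^{2\alpha}}\,dy ,$$ the kernel of $e^{-t(-\Delta)^\alpha}$, and for measurable $F\ge 0$ on $\mathbb R^{1+n}_+$ let $$S_\alpha F(t,x)=\int_0^t\!\int_{\mathbb R^n}K_{t-s}(x-y)F(s,y)\,dy\,ds\in[0,\infty],\qquad \|F\|_{p,q}=\Big(\int_0^\infty\Big(\int_{\mathbb R^n}F(t,x)^p\,dx\Big)^{q/p}dt\Big)^{1/q}.$$ For compact $K\subset\mathbb R^{1+n}_+$ put $C(K)=\inf\{\|F\|_{p,q}^{p\wedge q}: F\ge 0\text{ measurable},\ S_\alpha F\ge 1\text{ on }K\}$; for open $U\subseteq\mathbb R^{1+n}_+$ put $C(U)=\sup\{C(K):K\subseteq U\text{ compact}\}$, and for arbitrary $E\subseteq\mathbb R^{1+n}_+$ put $C(E)=\inf\{C(U):U\supseteq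 E\text{ open in }\mathbb R^{1+n}_+\}$. (The last definition agrees with the first one on compact sets.) For $(t_0,x_0)\in\mathbb R^{1+n}_+$ and $r>0$ let $B_r(t_0,x_0)=\{(t,x)\in\mathbb R^{1+n}_+:|t-t_0|<r^{2\alpha},\ |x-x_0|<r\}$. For an increasing gauge $\phi:[0,\infty)\to[0,\infty]$ with $\phi(0)=0$ and for $\varepsilon>0$, let $H^\phi_\varepsilon(E)$ be the infimum of $\sum_{j\ge1}\phi(r_j)$ over all countable covers of $E$ by sets $B_{r_j}(t_j,x_j)$ with $(t_j,x_j)\in\mathbb R^{1+n}_+$ and $0<r_j<\varepsilon$. Let $H^\phi(E)=\lim_{\varepsilon\to0}H^\phi_\varepsilon(E)$; write $H^d_\varepsilon$, $H^d$ when $\phi(r)=r^d$, $d>0$; and let $\dim(E)=\inf\{d>0:H^d(E)=0\}$. Let $\ln_+s=\max\{0,\ln s\}$, with $0^{-\gamma}=\infty$ for $\gamma>0$, and $$\beta=(p\wedge q)\Big(\frac np+\frac{2\alpha}q-2\alpha\Big).$$ (i) Suppose $\beta>0$, $p<\tilde p<\infty$, $q<\tilde q<\infty$ and $\big(\frac1q-\frac1{\tilde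 q}\big)+\frac n{2\alpha}\big(\frac1p-\frac1{\tilde p}\big)=1$. There is a constant $c<\infty$, depending only on $n,\alpha,p,q,\tilde p,\tilde q$, such that $$\mathscr L^1(A)^{(p\wedge q)/\tilde q}\,\mathscr L^n(B)^{(p\wedge q)/\tilde p}\le c\,C(A\times B)$$ for all bounded Borel sets $A\subset(0,\infty)$ and $B\subset\mathbb R^n$, and such that for every $\tau>0$ there is $\delta\in(0,1)$, depending only on $\tau$ and these parameters, with $$C(A\times B)\le c\,H^{\beta}_\delta(A\times B)$$ for all bounded Borel sets $A\subset[\tau,\infty)$ and $B\subset\mathbb R^n$. (ii) Suppose $\beta>0$. There is a constant $c<\infty$, depending only on $n,\alpha,p,q$, such that for every $\tau>0$ there is $\delta\in(0,1)$ with $C(K)\le c\,H^\beta_\delta(K)$ for all compact $K\subset[\tau,\infty)\times\mathbb R^n$. (Every compact $K\subset\mathbb R^{1+n}_+$ lies in such a set.) Moreover, if $n-2\alpha(p\wedge q-1)>0$, then for every measurable $F\ge0$ with $\|F\|_{p,q}<\infty$, $$\dim\{(t,x)\in\mathbb R^{1+n}_+:S_\alpha F(t,x)=\infty\}\le n-2\alpha(p\wedge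 q-1).$$ (iii) Suppose $\frac np+\frac{2\alpha}q-2\alpha=0$, and let $\phi(r)=(\ln_+\frac1r)^{-(p\wedge q)(1-1/q)}$ for $r>0$. There is a constant $c<\infty$, depending only on $n,\alpha,p,q$, such that for every $\tau>0$ there is $\delta\in(0,1)$ with $C(K)\le c\,H^{\phi}_\delta(K)$ for all compact $K\subset[\tau,\infty)\times\mathbb R^n$. Moreover, if $n-2\alpha(p\wedge q-1)=0$, then for every $\epsilon>0$, with $\phi_\epsilon(r)=(\ln_+\frac1r)^{-(p\wedge q)-\epsilon}$ for $r>0$, and every measurable $F\ge0$ with $\|F\|_{p,q}<\infty$, $$H^{\phi_\epsilon}\big(\{(t,x)\in\mathbb R^{1+n}_+:S_\alpha F(t,x)=\infty\}\big)=0 .$$ -/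

import Mathlib

open MeasureTheory
open scoped ENNReal NNReal

namespace FracDiss

noncomputable section

/-- Euclidean `n`-space. -/
abbrev Space (n : ℕ) : Type := EuclideanSpace ℝ (Fin n)

/-- The open upper half space `(0,∞) × ℝⁿ`, as a subset of `ℝ × ℝⁿ`. -/
def halfSpace (n : ℕ) : Set (ℝ × Space n) := {z | 0 < z.1}

/-- The kernel of `e^{-t(-Δ)^α}`, that is
`K_t(x) = (2π)^{-n} ∫ e^{i x·y - t |y|^{2α}} dy`. The imaginary part of the integrand is odd in `y`,
so only the cosine is kept. -/
def kernel {n : ℕ} (α t : ℝ) (x : Space n) : ℝ :=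
  ((2 * Real.pi) ^ n)⁻¹ *
    ∫ y : Space n, Real.cos (inner ℝ x y) * Real.exp (-(t * ‖y‖ ^ (2 * α)))

/-- The potential `S_α F(t,x) = ∫_0^t ∫ K_{t-s}(x-y) F(s,y) dy ds` of a nonnegative `F`, with
values in `[0,∞]`. Only the values of `F` on the upper half space matter. (The kernel is positive
for `t > 0` and `0 < α ≤ 1`, so `ENNReal.ofReal` does not change it.) -/
def potential {n : ℕ} (α : ℝ) (F : ℝ × Space n → ℝ≥0∞) (z : ℝ × Space n) : ℝ≥0∞ :=
  ∫⁻ s in Set.Ioo 0 z.1, ∫⁻ y : Space n, ENNReal.ofReal (kernel α (z.1 - s) (z.2 - y)) * F (s, y)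

/-- The mixed norm `(∫_0^∞ (∫ F(t,x)^p dx)^{q/p} dt)^{1/q}` of a nonnegative `F`. -/
def mixedNorm {n : ℕ} (p q : ℝ) (F : ℝ × Space n → ℝ≥0∞) : ℝ≥0∞ :=
  (∫⁻ t in Set.Ioi (0 : ℝ), (∫⁻ x : Space n, F (t, x) ^ p) ^ (q / p)) ^ (1 / q)

/-- The `(α,p,q)`-capacity of a compact set `K`: the infimum of `‖F‖^{min(p,q)}` over the
measurable `F ≥ 0` with `S_α F ≥ 1` at every point of `K` (so it is `∞` if no such `F` has finite
norm). -/
def compactCapacity {n : ℕ} (α p q : ℝ) (K : Set (ℝ × Space n)) : ℝ≥0∞ :=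
  ⨅ (F : ℝ × Space n → ℝ≥0∞) (_ : Measurable F) (_ : ∀ z ∈ K, 1 ≤ potential α F z),
    mixedNorm p q F ^ min p q

/-- The capacity of an open set: supremum over its compact subsets. -/
def openCapacity {n : ℕ} (α p q : ℝ) (U : Set (ℝ × Space n)) : ℝ≥0∞ :=
  ⨆ (K : Set (ℝ × Space n)) (_ : IsCompact K) (_ : K ⊆ U), compactCapacity α p q K

/-- The capacity of an arbitrary subset of the upper half space: infimum over the open subsets of
the upper half space that contain it. On compact sets this agrees with `compactCapacity`, because
`S_α F` is lower semicontinuous. -/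
def capacity {n : ℕ} (α p q : ℝ) (E : Set (ℝ × Space n)) : ℝ≥0∞ :=
  ⨅ (U : Set (ℝ × Space n)) (_ : IsOpen U) (_ : U ⊆ halfSpace n) (_ : E ⊆ U), openCapacity α p q U

/-- The blow-up set `{(t,x) : t > 0, S_α F(t,x) = ∞}`. -/
def blowUp {n : ℕ} (α : ℝ) (F : ℝ × Space n → ℝ≥0∞) : Set (ℝ × Space n) :=
  {z | 0 < z.1 ∧ potential α F z = ∞}

/-- The parabolic ball `{(t,x) : t > 0, |t - t₀| < r^{2α}, |x - x₀| < r}`. -/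
def parabolicBall {n : ℕ} (α : ℝ) (z₀ : ℝ × Space n) (r : ℝ) : Set (ℝ × Space n) :=
  {z | 0 < z.1 ∧ |z.1 - z₀.1| < r ^ (2 * α) ∧ ‖z.2 - z₀.2‖ < r}

/-- The `(φ,ε)`-Hausdorff capacity: infimum of `∑ φ(r_j)` over the countable covers by parabolic
balls with centres in the upper half space and radii in `(0,ε)`. -/
def hausdorffCapacity {n : ℕ} (α : ℝ) (φ : ℝ → ℝ≥0∞) (ε : ℝ) (E : Set (ℝ × Space n)) : ℝ≥0∞ :=
  ⨅ (z : ℕ → ℝ × Space n) (r : ℕ → ℝ) (_ : ∀ j, 0 < (z j).1) (_ : ∀ j, 0 < r j ∧ r j < ε)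
    (_ : E ⊆ ⋃ j, parabolicBall α (z j) (r j)), ∑' j, φ (r j)

/-- The `φ`-Hausdorff measure: the limit as `ε → 0` of the `(φ,ε)`-Hausdorff capacities, which is
their supremum because they increase as `ε` decreases. -/
def hausdorffMeasure {n : ℕ} (α : ℝ) (φ : ℝ → ℝ≥0∞) (E : Set (ℝ × Space n)) : ℝ≥0∞ :=
  ⨆ (ε : ℝ) (_ : 0 < ε), hausdorffCapacity α φ ε E

/-- The gauge `r ↦ r^d`. -/
def powGauge (d : ℝ) (r : ℝ) : ℝ≥0∞ := ENNReal.ofReal r ^ d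

/-- The gauge `r ↦ (ln₊ (1/r))^{-γ}` for `r > 0`, where `ln₊ s = max 0 (ln s)`; for `γ > 0` it is
`∞` for `r ≥ 1`. It is `0` at `r = 0`. -/
def logGauge (γ : ℝ) (r : ℝ) : ℝ≥0∞ :=
  if r ≤ 0 then 0 else ENNReal.ofReal (max 0 (Real.log (1 / r))) ^ (-γ)

/-- The parabolic Hausdorff dimension `inf {d > 0 : H^d(E) = 0}`, in `[0,∞]`. -/
def parabolicDim {n : ℕ} (α : ℝ) (E : Set (ℝ × Space n)) : ℝ≥0∞ :=
  ⨅ (d : ℝ) (_ : 0 < d) (_ : hausdorffMeasure α (powGauge d) E = 0), ENNReal.ofReal d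

/-- The exponent `β = min(p,q) (n/p + 2α/q - 2α)`. -/
def betaExp (n : ℕ) (α p q : ℝ) : ℝ := min p q * (n / p + 2 * α / q - 2 * α)

end

end FracDiss

/-! The proof needs few facts about the kernel: it is nonnegative, radially decreasing, self-similar
under `x ↦ t^{-1/(2α)} x`, has mass at most one, and at time one is continuous and positive at the
origin. Sign and monotonicity come from subordination. Since `s^α` is a positive multiple of `∫
u^{-1-α} (1 - e^{-us}) du`, the symbol `e^{-t|y|^{2α}}` is a limit of positive multiples of
exponentials of Gaussian mixtures (`gaussPositive_exp_rpow`). Expanding these exponentials gives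
positive sums of Gaussian mixtures, and the transform of a Gaussian is a Gaussian. Monotonicity, the
mass bound and scaling then give `K_t(x) ≤ C r^{-n}` off the parabolic ball of radius `r`.

Capacity from above. The power `p ∧ q` makes the capacity countably subadditive
(`mixedNorm_iSup_rpow_le`), so it suffices to bound the capacity of one ball of radius `r` by the
gauge. The test function is `A u⁻¹` on the backward parabolic cone below the centre, at time depths
`a < u < b` with `a` comparable to `r^{2α}`. Its potential on the ball is at least a multiple of `A
log(b/a)`, and its norm is an integral of a power of `u`. For `β > 0` the single layer `b = 2a`
gives `r^β`. In the critical case that power is `u⁻¹`, and a cone of fixed depth `b = τ/2` gives the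
logarithmic gauge.

Capacity from below. Integrating `S_α F ≥ 1` over `B`, with Hölder's inequality and the bounds on
the kernel, leaves a one-dimensional fractional integral of the slice norms of `F`. Integrating that
over `A` needs only a restricted weak-type Hardy-Littlewood-Sobolev bound, obtained by cutting at `u
= |A|` (`exists_fractional_integral_le`).

Blow-up sets. Write `m = p ∧ q`. The function `F^m` is locally integrable, and over dyadic parabolic
shells the potential at `z` is controlled by `∑ r^{2α-(n+2α)/m} (∫_{B_r(z)} F^m)^{1/m}`. If the
corresponding sum with `φ(r)` in place of the local mass converges, then at a blow-up point the mass
of arbitrarily small balls exceeds every multiple of `φ(r)`. A Vitali covering argument then makes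
the `φ`-measure vanish (`hausdorffMeasure_blowUp_eq_zero`). The series is geometric for `φ(r) = r^d`
with `d > n - 2α(m-1)`, and a convergent `∑ k^{-s}` for the logarithmic gauge when `n - 2α(m-1) =
0`. -/

namespace FracDiss

open Set Filter Topology

/-! ### Positivity of the symbol by Gaussian subordination -/

/-- The cosine transform of `e^{-a|y|²} h(y)`. -/
noncomputable def gaussCos {n : ℕ} (a : ℝ) (h : Space n → ℝ) (x : Space n) : ℝ :=
  ∫ y : Space n, Real.cos (inner ℝ x y) * (Real.exp (-(a * ‖y‖ ^ 2)) * h y)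

/-- A bounded measurable function all of whose products with Gaussians have a nonnegative and
radially decreasing cosine transform. -/
structure GaussPositive {n : ℕ} (h : Space n → ℝ) : Prop where
  meas : Measurable h
  bdd : ∃ C : ℝ, ∀ y, |h y| ≤ C
  nonneg : ∀ a : ℝ, 0 < a → ∀ x, 0 ≤ gaussCos a h x
  anti : ∀ a : ℝ, 0 < a → ∀ x x' : Space n, ‖x'‖ ≤ ‖x‖ → gaussCos a h x ≤ gaussCos a h x'

theorem integrable_gauss {n : ℕ} {a : ℝ} (ha : 0 < a) :
    Integrable (fun y : Space n => Real.exp (-(a * ‖y‖ ^ 2))) := by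
  have h := (GaussianFourier.integrable_cexp_neg_mul_sq_norm_add (V := Space n) (b := (a : ℂ))
    (by simpa using ha) 0 0).re
  refine h.congr (Eventually.of_forall fun y => ?_)
  have : (-(a : ℂ) * (‖y‖ : ℂ) ^ 2 + 0 * ((inner ℝ (0 : Space n) y : ℝ) : ℂ))
      = ((-(a * ‖y‖ ^ 2) : ℝ) : ℂ) := by push_cast; ring
  simp only [this]
  exact Complex.exp_ofReal_re _

theorem integrable_gauss_mul {n : ℕ} {a : ℝ} (ha : 0 < a) {h : Space n → ℝ} (hm : Measurable h)
    {C : ℝ} (hC : ∀ y, |h y| ≤ C) (x : Space n) :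
    Integrable (fun y : Space n =>
      Real.cos (inner ℝ x y) * (Real.exp (-(a * ‖y‖ ^ 2)) * h y)) := by
  have hC0 : 0 ≤ C := (abs_nonneg _).trans (hC 0)
  refine ((integrable_gauss (n := n) ha).const_mul C).mono' ?_ (Eventually.of_forall fun y => ?_)
  · exact (by fun_prop : Measurable _).aestronglyMeasurable
  · rw [Real.norm_eq_abs, abs_mul, abs_mul, abs_of_pos (Real.exp_pos _)]
    calc _ ≤ 1 * (Real.exp (-(a * ‖y‖ ^ 2)) * C) := by
          gcongr
          · exact Real.abs_cos_le_one _
          · exact hC y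
      _ = _ := by ring

theorem gaussCos_one {n : ℕ} {a : ℝ} (ha : 0 < a) (x : Space n) :
    gaussCos a (fun _ => 1) x
      = (Real.pi / a) ^ ((n : ℝ) / 2) * Real.exp (-(‖x‖ ^ 2 / (4 * a))) := by
  have h := GaussianFourier.integral_cexp_neg_mul_sq_norm_add (V := Space n) (b := (a : ℂ))
    (by simpa using ha) Complex.I x
  have h2 := (GaussianFourier.integrable_cexp_neg_mul_sq_norm_add (V := Space n) (b := (a : ℂ))
    (by simpa using ha) Complex.I x)
  have h3 := congrArg Complex.re h
  have h4 : ∀ f : Space n → ℂ, Integrable f → (∫ y, f y).re = ∫ y, (f y).re := fun f hf =>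
    (integral_re hf).symm
  rw [h4 _ h2] at h3
  unfold gaussCos
  have e1 : ∀ y : Space n, (Complex.exp (-(a : ℂ) * (‖y‖ : ℂ) ^ 2
      + Complex.I * ((inner ℝ x y : ℝ) : ℂ))).re
      = Real.cos (inner ℝ x y) * (Real.exp (-(a * ‖y‖ ^ 2)) * 1) := by
    intro y
    rw [Complex.exp_re]
    have : (-(a : ℂ) * (‖y‖ : ℂ) ^ 2 + Complex.I * ((inner ℝ x y : ℝ) : ℂ))
      = ((-(a * ‖y‖ ^ 2) : ℝ) : ℂ) + ((inner ℝ x y : ℝ) : ℂ) * Complex.I := by push_cast; ring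
    rw [this, Complex.add_re, Complex.add_im]
    simp [Complex.mul_re, Complex.mul_im, -Complex.ofReal_neg, -Complex.ofReal_mul,
      Complex.ofReal_re, Complex.ofReal_im, mul_comm]
  simp only [e1] at h3
  rw [h3]
  have e2 : ((Real.pi : ℂ) / a) ^ ((Module.finrank ℝ (Space n) : ℂ) / 2)
      * Complex.exp (Complex.I ^ 2 * (‖x‖ : ℂ) ^ 2 / (4 * a))
      = (((Real.pi / a) ^ ((n : ℝ) / 2) * Real.exp (-(‖x‖ ^ 2 / (4 * a))) : ℝ) : ℂ) := by
    have : 0 ≤ Real.pi / a := by positivity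
    push_cast [Complex.ofReal_cpow this]
    simp
    left
    rw [neg_div]
  rw [e2, Complex.ofReal_re]

theorem GaussPositive.one {n : ℕ} : GaussPositive (fun _ : Space n => (1 : ℝ)) where
  meas := measurable_const
  bdd := ⟨1, fun _ => by simp⟩
  nonneg a ha x := by rw [gaussCos_one ha]; positivity
  anti a ha x x' hx := by
    rw [gaussCos_one ha, gaussCos_one ha]
    gcongr

theorem GaussPositive.add {n : ℕ} {h g : Space n → ℝ} (hh : GaussPositive h)
    (hg : GaussPositive g) : GaussPositive (fun y => h y + g y) := by
  obtain ⟨C, hC⟩ := hh.bdd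
  obtain ⟨D, hD⟩ := hg.bdd
  have key : ∀ a, 0 < a → ∀ x, gaussCos a (fun y => h y + g y) x
      = gaussCos a h x + gaussCos a g x := by
    intro a ha x
    unfold gaussCos
    rw [← integral_add (integrable_gauss_mul ha hh.meas hC x)
      (integrable_gauss_mul ha hg.meas hD x)]
    simp only [mul_add]
  refine ⟨hh.meas.add hg.meas, ⟨C + D, fun y => (abs_add_le _ _).trans
    (add_le_add (hC y) (hD y))⟩, fun a ha x => ?_, fun a ha x x' hx => ?_⟩
  · rw [key a ha]; exact add_nonneg (hh.nonneg a ha x) (hg.nonneg a ha x)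
  · rw [key a ha, key a ha]; exact add_le_add (hh.anti a ha x x' hx) (hg.anti a ha x x' hx)

theorem GaussPositive.const_mul {n : ℕ} {h : Space n → ℝ} (hh : GaussPositive h) {c : ℝ}
    (hc : 0 ≤ c) : GaussPositive (fun y => c * h y) := by
  obtain ⟨C, hC⟩ := hh.bdd
  have key : ∀ a x, gaussCos a (fun y => c * h y) x = c * gaussCos a h x := by
    intro a x
    unfold gaussCos
    rw [← integral_const_mul]
    congr 1; ext y; ring
  refine ⟨hh.meas.const_mul c, ⟨c * C, fun y => ?_⟩, fun a ha x => ?_, fun a ha x x' hx => ?_⟩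
  · rw [abs_mul, abs_of_nonneg hc]; gcongr; exact hC y
  · rw [key]; exact mul_nonneg hc (hh.nonneg a ha x)
  · rw [key, key]; exact mul_le_mul_of_nonneg_left (hh.anti a ha x x' hx) hc

/-- The Gaussian factor built into `gaussCos` makes bounded functions integrable, so dominated
convergence applies to uniformly bounded pointwise limits without any decay of `h` itself. -/
theorem GaussPositive.of_tendsto {n : ℕ} {H : ℕ → Space n → ℝ} {h : Space n → ℝ}
    (hH : ∀ k, GaussPositive (H k)) {C : ℝ} (hC : ∀ k y, |H k y| ≤ C)
    (hlim : ∀ y, Tendsto (fun k => H k y) atTop (𝓝 (h y))) : GaussPositive h := by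
  have hm : Measurable h := measurable_of_tendsto_metrizable (fun k => (hH k).meas)
    (tendsto_pi_nhds.2 hlim)
  have hb : ∀ y, |h y| ≤ C := fun y => le_of_tendsto (hlim y).abs
    (Eventually.of_forall fun k => hC k y)
  have hC0 : 0 ≤ C := (abs_nonneg _).trans (hb 0)
  have key : ∀ a, 0 < a → ∀ x, Tendsto (fun k => gaussCos a (H k) x) atTop
      (𝓝 (gaussCos a h x)) := by
    intro a ha x
    refine tendsto_integral_of_dominated_convergence
      (fun y => C * Real.exp (-(a * ‖y‖ ^ 2))) (fun k =>
        (integrable_gauss_mul ha (hH k).meas (hC k) x).aestronglyMeasurable)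
      ((integrable_gauss ha).const_mul C) (fun k => Eventually.of_forall fun y => ?_)
      (Eventually.of_forall fun y => ((hlim y).const_mul _).const_mul _)
    rw [Real.norm_eq_abs, abs_mul, abs_mul, abs_of_pos (Real.exp_pos _)]
    calc _ ≤ 1 * (Real.exp (-(a * ‖y‖ ^ 2)) * C) := by
          gcongr
          · exact Real.abs_cos_le_one _
          · exact hC k y
      _ = _ := by ring
  exact ⟨hm, ⟨C, hb⟩, fun a ha x => ge_of_tendsto' (key a ha x) fun k => (hH k).nonneg a ha x,
    fun a ha x x' hx => le_of_tendsto_of_tendsto' (key a ha x) (key a ha x')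
      fun k => (hH k).anti a ha x x' hx⟩

/-- Multiplying by `e^{-u|y|²}` only shifts the damping parameter from `a` to `a + u`. By Fubini the
new transform is the average of the transforms `gaussCos (a + u) h` with nonnegative weights `w u`.
This is why the defining property is required for all `a > 0`. -/
theorem GaussPositive.mul_mixture {n : ℕ} {h : Space n → ℝ} (hh : GaussPositive h)
    {μ : Measure ℝ} [SFinite μ] {w : ℝ → ℝ} (hw : Integrable w μ) (hwm : Measurable w)
    (hpos : ∀ᵐ u ∂μ, 0 ≤ u ∧ 0 ≤ w u) :
    GaussPositive (fun y => h y * ∫ u, w u * Real.exp (-(u * ‖y‖ ^ 2)) ∂μ) := by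
  obtain ⟨C, hC⟩ := hh.bdd
  have hC0 : 0 ≤ C := (abs_nonneg _).trans (hC 0)
  have hgm : Measurable (fun y : Space n => ∫ u, w u * Real.exp (-(u * ‖y‖ ^ 2)) ∂μ) := by
    have : Measurable (fun z : Space n × ℝ => w z.2 * Real.exp (-(z.2 * ‖z.1‖ ^ 2))) := by fun_prop
    exact this.stronglyMeasurable.integral_prod_right.measurable
  have key : ∀ a, 0 < a → ∀ x,
      gaussCos a (fun y => h y * ∫ u, w u * Real.exp (-(u * ‖y‖ ^ 2)) ∂μ) x
      = ∫ u, w u * gaussCos (a + u) h x ∂μ := by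
    intro a ha x
    unfold gaussCos
    have e1 : ∀ y : Space n, Real.cos (inner ℝ x y) * (Real.exp (-(a * ‖y‖ ^ 2)) *
        (h y * ∫ u, w u * Real.exp (-(u * ‖y‖ ^ 2)) ∂μ))
        = ∫ u, w u * (Real.cos (inner ℝ x y) * (Real.exp (-((a + u) * ‖y‖ ^ 2)) * h y)) ∂μ := by
      intro y
      rw [← mul_assoc, ← mul_assoc, ← integral_const_mul]
      congr 1; ext u
      rw [show -((a + u) * ‖y‖ ^ 2) = -(a * ‖y‖ ^ 2) + -(u * ‖y‖ ^ 2) by ring, Real.exp_add]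
      ring
    simp only [e1]
    rw [integral_integral_swap]
    · congr 1; ext u; rw [integral_const_mul]
    · have hi := ((integrable_gauss (n := n) ha).const_mul C).mul_prod hw
      refine hi.mono' ?_ ?_
      · have := hh.meas
        exact (by fun_prop : Measurable _).aestronglyMeasurable
      · have : ∀ᵐ z : Space n × ℝ ∂(volume.prod μ), 0 ≤ z.2 ∧ 0 ≤ w z.2 :=
          Measure.quasiMeasurePreserving_snd.ae hpos
        filter_upwards [this] with z hz
        simp only [Function.uncurry]
        rw [Real.norm_eq_abs, abs_mul, abs_mul, abs_mul, abs_of_pos (Real.exp_pos _),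
          abs_of_nonneg hz.2]
        calc _ ≤ w z.2 * (1 * (Real.exp (-(a * ‖z.1‖ ^ 2)) * C)) := by
              have := hz.2
              gcongr
              · exact Real.abs_cos_le_one _
              · linarith [hz.1]
              · exact hC _
          _ = _ := by ring
  refine ⟨hh.meas.mul hgm, ⟨C * ∫ u, w u ∂μ, fun y => ?_⟩, fun a ha x => ?_,
    fun a ha x x' hx => ?_⟩
  · rw [abs_mul]
    have : |∫ u, w u * Real.exp (-(u * ‖y‖ ^ 2)) ∂μ| ≤ ∫ u, w u ∂μ := by
      rw [← Real.norm_eq_abs]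
      refine norm_integral_le_of_norm_le hw ?_
      filter_upwards [hpos] with u hu
      rw [Real.norm_eq_abs, abs_mul, abs_of_nonneg hu.2, abs_of_pos (Real.exp_pos _)]
      refine mul_le_of_le_one_right hu.2 (Real.exp_le_one_iff.2 ?_)
      have := hu.1
      simp only [Left.neg_nonpos_iff]; positivity
    gcongr
    exact hC y
  · rw [key a ha]
    refine integral_nonneg_of_ae ?_
    filter_upwards [hpos] with u hu
    exact mul_nonneg hu.2 (hh.nonneg _ (by linarith [hu.1]) x)
  · rw [key a ha, key a ha]
    have hint : ∀ x, Integrable (fun u => w u * gaussCos (a + u) h x) μ := by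
      intro x
      have hb : ∀ᵐ u ∂μ, ‖gaussCos (a + u) h x‖ ≤ ∫ y : Space n, C * Real.exp (-(a * ‖y‖ ^ 2)) := by
        filter_upwards [hpos] with u hu
        refine norm_integral_le_of_norm_le ((integrable_gauss ha).const_mul C)
          (Eventually.of_forall fun y => ?_)
        rw [Real.norm_eq_abs, abs_mul, abs_mul, abs_of_pos (Real.exp_pos _)]
        calc _ ≤ 1 * (Real.exp (-(a * ‖y‖ ^ 2)) * C) := by
              gcongr
              · exact Real.abs_cos_le_one _
              · linarith [hu.1]
              · exact hC y
          _ = _ := by ring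
      have hmm : Measurable (fun u => gaussCos (a + u) h x) := by
        have := hh.meas
        have : Measurable (fun z : ℝ × Space n =>
          Real.cos (inner ℝ x z.2) * (Real.exp (-((a + z.1) * ‖z.2‖ ^ 2)) * h z.2)) := by fun_prop
        exact this.stronglyMeasurable.integral_prod_right.measurable
      exact hw.mul_bdd hmm.aestronglyMeasurable hb
    refine integral_mono_ae (hint x) (hint x') ?_
    filter_upwards [hpos] with u hu
    exact mul_le_mul_of_nonneg_left (hh.anti _ (by linarith [hu.1]) x x' hx) hu.2

/-- Powers of the mixture are handled by repeated multiplication, partial sums of the exponential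
series by positive combinations, and the exponential itself by a limit. The partial sums are
uniformly bounded because the mixture is nonnegative and bounded. -/
theorem GaussPositive.exp_mixture {n : ℕ}
    {μ : Measure ℝ} [SFinite μ] {w : ℝ → ℝ} (hw : Integrable w μ) (hwm : Measurable w)
    (hpos : ∀ᵐ u ∂μ, 0 ≤ u ∧ 0 ≤ w u) :
    GaussPositive (fun y : Space n =>
      Real.exp (∫ u, w u * Real.exp (-(u * ‖y‖ ^ 2)) ∂μ)) := by
  set g : Space n → ℝ := fun y => ∫ u, w u * Real.exp (-(u * ‖y‖ ^ 2)) ∂μ with hg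
  have hpow : ∀ j : ℕ, GaussPositive (fun y => g y ^ j) := by
    intro j
    induction j with
    | zero => simpa using GaussPositive.one
    | succ j ih =>
      simp only [pow_succ]
      exact ih.mul_mixture hw hwm hpos
  have hsum : ∀ J : ℕ, GaussPositive (fun y => ∑ j ∈ Finset.range J, g y ^ j / j.factorial) := by
    intro J
    induction J with
    | zero =>
      simpa using GaussPositive.one.const_mul (n := n) (le_refl 0)
    | succ J ih =>
      simp only [Finset.sum_range_succ]
      refine ih.add ?_
      simp only [div_eq_inv_mul]
      exact (hpow J).const_mul (by positivity)
  have hg0 : ∀ y, 0 ≤ g y := by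
    intro y
    refine integral_nonneg_of_ae ?_
    filter_upwards [hpos] with u hu
    exact mul_nonneg hu.2 (Real.exp_pos _).le
  obtain ⟨C, hC⟩ := (hpow 1).bdd
  refine GaussPositive.of_tendsto hsum (C := Real.exp C) (fun J y => ?_) (fun y => ?_)
  · rw [abs_of_nonneg (Finset.sum_nonneg fun j _ => by have := hg0 y; positivity)]
    refine (Real.sum_le_exp_of_nonneg (hg0 y) J).trans (Real.exp_le_exp.2 ?_)
    have := hC y
    rw [pow_one] at this
    exact (le_abs_self _).trans this
  · have := (NormedSpace.expSeries_div_hasSum_exp (𝔸 := ℝ) (g y)).tendsto_sum_nat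
    rw [← Real.exp_eq_exp_ℝ] at this
    exact this

theorem integrableOn_one_sub_exp {α : ℝ} (hα0 : 0 < α) (hα1 : α < 1) {s : ℝ} (hs : 0 ≤ s) :
    IntegrableOn (fun u : ℝ => u ^ (-1 - α) * (1 - Real.exp (-(u * s)))) (Ioi 0) := by
  have hm : Measurable (fun u : ℝ => u ^ (-1 - α) * (1 - Real.exp (-(u * s)))) := by fun_prop
  rw [← Ioc_union_Ioi_eq_Ioi (zero_le_one' ℝ), integrableOn_union]
  constructor
  · have h1 : IntegrableOn (fun u : ℝ => s * u ^ (-α)) (Ioc 0 1) := by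
      have := (intervalIntegral.intervalIntegrable_rpow' (a := 0) (b := 1) (r := -α)
        (by linarith)).1
      exact this.const_mul s
    refine h1.mono' hm.aestronglyMeasurable ?_
    refine (ae_restrict_mem measurableSet_Ioc).mono fun u hu => ?_
    have hu0 : 0 < u := hu.1
    have h2 : 0 ≤ 1 - Real.exp (-(u * s)) := by
      have : Real.exp (-(u * s)) ≤ 1 := Real.exp_le_one_iff.2 (by
        have := mul_nonneg hu0.le hs; linarith)
      linarith
    have h3 : 1 - Real.exp (-(u * s)) ≤ u * s := by
      have := Real.add_one_le_exp (-(u * s)); linarith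
    rw [Real.norm_eq_abs, abs_of_nonneg (mul_nonneg (Real.rpow_nonneg hu0.le _) h2)]
    calc _ ≤ u ^ (-1 - α) * (u * s) := by gcongr
      _ = s * (u ^ (-1 - α) * u ^ (1 : ℝ)) := by rw [Real.rpow_one]; ring
      _ = s * u ^ (-α) := by rw [← Real.rpow_add hu0]; congr 2; ring
  · have h1 : IntegrableOn (fun u : ℝ => u ^ (-1 - α)) (Ioi 1) :=
      integrableOn_Ioi_rpow_of_lt (by linarith) one_pos
    refine h1.mono' hm.aestronglyMeasurable ?_
    refine (ae_restrict_mem measurableSet_Ioi).mono fun u hu => ?_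
    have hu0 : 0 < u := one_pos.trans hu
    have h2 : 0 ≤ 1 - Real.exp (-(u * s)) := by
      have : Real.exp (-(u * s)) ≤ 1 := Real.exp_le_one_iff.2 (by
        have := mul_nonneg hu0.le hs; linarith)
      linarith
    have h3 : 1 - Real.exp (-(u * s)) ≤ 1 := by linarith [Real.exp_pos (-(u * s))]
    rw [Real.norm_eq_abs, abs_of_nonneg (mul_nonneg (Real.rpow_nonneg hu0.le _) h2)]
    exact mul_le_of_le_one_right (Real.rpow_nonneg hu0.le _) h3

theorem integral_one_sub_exp_pos {α : ℝ} (hα0 : 0 < α) (hα1 : α < 1) :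
    0 < ∫ u in Ioi (0 : ℝ), u ^ (-1 - α) * (1 - Real.exp (-(u * 1))) := by
  have hpos : ∀ u ∈ Ioi (0 : ℝ), 0 < u ^ (-1 - α) * (1 - Real.exp (-(u * 1))) := by
    intro u hu
    have hu0 : (0 : ℝ) < u := hu
    refine mul_pos (Real.rpow_pos_of_pos hu0 _) ?_
    have : Real.exp (-(u * 1)) < 1 := by rw [Real.exp_lt_one_iff]; linarith
    linarith
  rw [setIntegral_pos_iff_support_of_nonneg_ae]
  · have : Ioi (0 : ℝ) ⊆ Function.support (fun u : ℝ => u ^ (-1 - α) * (1 - Real.exp (-(u * 1)))) :=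
      fun u hu => (hpos u hu).ne'
    rw [inter_eq_self_of_subset_right this]
    simp
  · exact (ae_restrict_mem measurableSet_Ioi).mono fun u hu => (hpos u hu).le
  · exact integrableOn_one_sub_exp hα0 hα1 zero_le_one

/-- The substitution `v = s u` extracts the homogeneity. With `s = |y|²` this writes `|y|^{2α}` as a
superposition of the functions `1 - e^{-u|y|²}`. -/
theorem integral_one_sub_exp {α : ℝ} (hα0 : 0 < α) {s : ℝ} (hs : 0 ≤ s) :
    ∫ u in Ioi (0 : ℝ), u ^ (-1 - α) * (1 - Real.exp (-(u * s)))
      = s ^ α * ∫ u in Ioi (0 : ℝ), u ^ (-1 - α) * (1 - Real.exp (-(u * 1))) := by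
  rcases hs.eq_or_lt with rfl | hs
  · simp [Real.zero_rpow hα0.ne']
  have h := integral_comp_mul_left_Ioi
    (fun v : ℝ => v ^ (-1 - α) * (1 - Real.exp (-(v * 1)))) 0 hs
  rw [mul_zero, smul_eq_mul] at h
  have e : ∫ u in Ioi (0 : ℝ), (s * u) ^ (-1 - α) * (1 - Real.exp (-(s * u * 1)))
      = s ^ (-1 - α) * ∫ u in Ioi (0 : ℝ), u ^ (-1 - α) * (1 - Real.exp (-(u * s))) := by
    rw [← integral_const_mul]
    refine setIntegral_congr_fun measurableSet_Ioi fun u hu => ?_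
    have hu0 : (0 : ℝ) < u := hu
    rw [Real.mul_rpow hs.le hu0.le, mul_one, mul_comm s u, mul_assoc]
  rw [e] at h
  have h2 : s ^ (1 + α) * s ^ (-1 - α) = 1 := by
    rw [← Real.rpow_add hs]; simp
  have h3 : s ^ (1 + α) * s⁻¹ = s ^ α := by
    rw [← Real.rpow_neg_one, ← Real.rpow_add hs]; congr 1; ring
  calc _ = s ^ (1 + α) * (s ^ (-1 - α)
          * ∫ u in Ioi (0 : ℝ), u ^ (-1 - α) * (1 - Real.exp (-(u * s)))) := by
        rw [← mul_assoc, h2, one_mul]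
    _ = _ := by rw [h, ← mul_assoc, h3]

theorem gaussPositive_exp_rpow (n : ℕ) {α : ℝ} (hα0 : 0 < α) (hα1 : α < 1) {t : ℝ} (ht : 0 ≤ t) :
    GaussPositive (fun y : Space n => Real.exp (-(t * ‖y‖ ^ (2 * α)))) := by
  set S := ∫ u in Ioi (0 : ℝ), u ^ (-1 - α) * (1 - Real.exp (-(u * 1))) with hS
  have hS0 : 0 < S := integral_one_sub_exp_pos hα0 hα1
  set w : ℝ → ℝ := fun u => t / S * u ^ (-1 - α) with hw
  have hwm : Measurable w := by fun_prop
  -- The weight `u^{-1-α}` is not integrable at zero, so only its truncation to `u > e k` is a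
  -- finite mixture to which the exponential lemma applies.
  set e : ℕ → ℝ := fun k => 1 / ((k : ℝ) + 1) with he
  have he0 : ∀ k, 0 < e k := fun k => by positivity
  have hpos : ∀ k, ∀ᵐ u ∂(volume.restrict (Ioi (e k))), 0 ≤ u ∧ 0 ≤ w u := fun k =>
    (ae_restrict_mem measurableSet_Ioi).mono fun u hu => by
      have : 0 < u := (he0 k).trans hu
      exact ⟨this.le, by simp only [hw]; positivity⟩
  have hwi : ∀ k, Integrable w (volume.restrict (Ioi (e k))) := fun k =>
    (integrableOn_Ioi_rpow_of_lt (by linarith) (he0 k)).const_mul _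
  have hint : ∀ y : Space n, IntegrableOn
      (fun u : ℝ => w u * (1 - Real.exp (-(u * ‖y‖ ^ 2)))) (Ioi 0) := fun y => by
    have := (integrableOn_one_sub_exp hα0 hα1 (s := ‖y‖ ^ 2) (by positivity)).const_mul (t / S)
    simpa only [hw, mul_assoc, IntegrableOn] using this
  -- The constant prefactor recombines the two exponents into `-∫ w (1 - e^{-u|y|²})`. This bounds
  -- `H k` by one and lets the truncation be removed by monotone exhaustion of `(0,∞)`.
  set H : ℕ → Space n → ℝ := fun k y =>
    Real.exp (-∫ u in Ioi (e k), w u) *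
      Real.exp (∫ u in Ioi (e k), w u * Real.exp (-(u * ‖y‖ ^ 2))) with hH
  have hHe : ∀ k y, H k y
      = Real.exp (-∫ u in Ioi (e k), w u * (1 - Real.exp (-(u * ‖y‖ ^ 2)))) := by
    intro k y
    simp only [hH]
    rw [← Real.exp_add]
    congr 1
    have hI : Integrable (fun u => w u * Real.exp (-(u * ‖y‖ ^ 2)))
        (volume.restrict (Ioi (e k))) := by
      refine (hwi k).mono' (by fun_prop : Measurable _).aestronglyMeasurable ?_
      filter_upwards [hpos k] with u hu
      rw [Real.norm_eq_abs, abs_mul, abs_of_nonneg hu.2, abs_of_pos (Real.exp_pos _)]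
      refine mul_le_of_le_one_right hu.2 (Real.exp_le_one_iff.2 ?_)
      have := hu.1
      simp only [Left.neg_nonpos_iff]; positivity
    simp only [mul_sub, mul_one]
    rw [integral_sub (hwi k) hI]
    ring
  refine GaussPositive.of_tendsto (H := H) (C := 1) (fun k =>
    (GaussPositive.exp_mixture (hwi k) hwm (hpos k)).const_mul (Real.exp_pos _).le)
    (fun k y => ?_) (fun y => ?_)
  · rw [hHe, abs_of_pos (Real.exp_pos _), Real.exp_le_one_iff, neg_nonpos]
    refine integral_nonneg_of_ae ?_
    filter_upwards [hpos k] with u hu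
    refine mul_nonneg hu.2 ?_
    have : Real.exp (-(u * ‖y‖ ^ 2)) ≤ 1 := Real.exp_le_one_iff.2 (by
      have := mul_nonneg hu.1 (sq_nonneg ‖y‖); linarith)
    linarith
  · simp only [hHe]
    refine (Real.continuous_exp.tendsto _).comp ?_
    have hU : ⋃ k, Ioi (e k) = Ioi 0 := by
      ext u
      simp only [mem_iUnion, mem_Ioi]
      constructor
      · rintro ⟨k, hk⟩; exact (he0 k).trans hk
      · intro hu; exact exists_nat_one_div_lt hu
    have hanti : Antitone e := fun i j hij => Nat.one_div_le_one_div hij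
    have := tendsto_setIntegral_of_monotone (μ := volume)
      (f := fun u : ℝ => w u * (1 - Real.exp (-(u * ‖y‖ ^ 2)))) (s := fun k => Ioi (e k))
      (fun k => measurableSet_Ioi) (fun i j hij => Ioi_subset_Ioi (hanti hij)) (by
        rw [hU]; exact hint y)
    rw [hU] at this
    have e2 : ∫ u in Ioi (0 : ℝ), w u * (1 - Real.exp (-(u * ‖y‖ ^ 2))) = t * ‖y‖ ^ (2 * α) := by
      simp only [hw, mul_assoc]
      rw [integral_const_mul, integral_one_sub_exp hα0 (by positivity), ← hS,
        Real.rpow_mul (norm_nonneg _), Real.rpow_two]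
      field_simp
    rw [e2] at this
    exact this.neg

/-! ### Properties of the fractional heat kernel -/

theorem integrable_exp_rpow {n : ℕ} (hn : 1 ≤ n) {α : ℝ} (hα0 : 0 < α) {t : ℝ} (ht : 0 < t) :
    Integrable (fun y : Space n => Real.exp (-(t * ‖y‖ ^ (2 * α)))) := by
  have : Nonempty (Fin n) := ⟨⟨0, hn⟩⟩
  have : Nontrivial (Space n) := inferInstance
  rw [integrable_fun_norm_addHaar (μ := (volume : Measure (Space n)))
    (f := fun r : ℝ => Real.exp (-(t * r ^ (2 * α))))]
  have h := integrableOn_rpow_mul_exp_neg_mul_rpow (p := 2 * α) (s := (n : ℝ) - 1) (b := t)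
    (by have : (1 : ℝ) ≤ n := by exact_mod_cast hn
        linarith) (by linarith) ht
  refine h.congr_fun (fun r hr => ?_) measurableSet_Ioi
  have hr0 : (0 : ℝ) < r := hr
  simp only [smul_eq_mul, finrank_euclideanSpace, Fintype.card_fin]
  rw [← Real.rpow_natCast, Nat.cast_sub hn]
  simp

/-- Removes the Gaussian damping, since the symbol is itself integrable. Sign and radial
monotonicity then pass from the damped transforms to the kernel. -/
theorem tendsto_gaussCos {n : ℕ} (hn : 1 ≤ n) {α : ℝ} (hα0 : 0 < α) {t : ℝ}
    (ht : 0 < t) (x : Space n) :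
    Tendsto (fun k : ℕ => ((2 * Real.pi) ^ n)⁻¹ * gaussCos (1 / ((k : ℝ) + 1))
      (fun y : Space n => Real.exp (-(t * ‖y‖ ^ (2 * α)))) x) atTop (𝓝 (kernel α t x)) := by
  refine Tendsto.const_mul _ ?_
  refine tendsto_integral_of_dominated_convergence
    (fun y : Space n => Real.exp (-(t * ‖y‖ ^ (2 * α)))) (fun k => ?_)
    (integrable_exp_rpow hn hα0 ht) (fun k => Eventually.of_forall fun y => ?_)
    (Eventually.of_forall fun y => ?_)
  · exact (by fun_prop : Measurable _).aestronglyMeasurable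
  · rw [Real.norm_eq_abs, abs_mul, abs_mul, abs_of_pos (Real.exp_pos _),
      abs_of_pos (Real.exp_pos (-(t * _)))]
    calc _ ≤ 1 * (1 * Real.exp (-(t * ‖y‖ ^ (2 * α)))) := by
          gcongr
          · exact Real.abs_cos_le_one _
          · rw [Real.exp_le_one_iff, neg_nonpos]; positivity
      _ = _ := by ring
  · refine Tendsto.const_mul _ ?_
    have h : Tendsto (fun k : ℕ => Real.exp (-(1 / ((k : ℝ) + 1) * ‖y‖ ^ 2))) atTop (𝓝 1) := by
      have h1 := (tendsto_one_div_add_atTop_nhds_zero_nat (𝕜 := ℝ)).mul_const (‖y‖ ^ 2)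
      have h2 := (Real.continuous_exp.tendsto _).comp h1.neg
      simpa [Function.comp_def] using h2
    simpa using h.mul_const (Real.exp (-(t * ‖y‖ ^ (2 * α))))

theorem kernel_nonneg {n : ℕ} (hn : 1 ≤ n) {α : ℝ} (hα0 : 0 < α) (hα1 : α < 1) {t : ℝ}
    (ht : 0 < t) (x : Space n) : 0 ≤ kernel α t x :=
  ge_of_tendsto' (tendsto_gaussCos hn hα0 ht x) fun k => mul_nonneg (by positivity)
    ((gaussPositive_exp_rpow n hα0 hα1 ht.le).nonneg _ (by positivity) x)

/-- The kernel is radially decreasing. -/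
theorem kernel_anti {n : ℕ} (hn : 1 ≤ n) {α : ℝ} (hα0 : 0 < α) (hα1 : α < 1) {t : ℝ}
    (ht : 0 < t) {x x' : Space n} (hx : ‖x'‖ ≤ ‖x‖) : kernel α t x ≤ kernel α t x' :=
  le_of_tendsto_of_tendsto' (tendsto_gaussCos hn hα0 ht x) (tendsto_gaussCos hn hα0 ht x')
    fun k => mul_le_mul_of_nonneg_left
      ((gaussPositive_exp_rpow n hα0 hα1 ht.le).anti _ (by positivity) x x' hx) (by positivity)

theorem measurable_kernel_right {n : ℕ} (α t : ℝ) :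
    Measurable (fun x : Space n => kernel α t x) := by
  unfold kernel
  have : Measurable (fun z : Space n × Space n =>
    Real.cos (inner ℝ z.1 z.2) * Real.exp (-(t * ‖z.2‖ ^ (2 * α)))) := by fun_prop
  exact (this.stronglyMeasurable.integral_prod_right.measurable).const_mul _

theorem continuous_kernel {n : ℕ} (hn : 1 ≤ n) {α : ℝ} (hα0 : 0 < α) {t : ℝ} (ht : 0 < t) :
    Continuous (fun x : Space n => kernel α t x) := by
  unfold kernel
  refine Continuous.mul continuous_const ?_
  refine continuous_of_dominated (bound := fun y : Space n => Real.exp (-(t * ‖y‖ ^ (2 * α))))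
    (fun x => ?_) (fun x => Eventually.of_forall fun y => ?_)
    (integrable_exp_rpow hn hα0 ht) (Eventually.of_forall fun y => by fun_prop)
  · exact (by fun_prop : Measurable _).aestronglyMeasurable
  · rw [Real.norm_eq_abs, abs_mul, abs_of_pos (Real.exp_pos _)]
    exact mul_le_of_le_one_left (Real.exp_pos _).le (Real.abs_cos_le_one _)

theorem kernel_zero_pos {n : ℕ} (hn : 1 ≤ n) {α : ℝ} (hα0 : 0 < α) {t : ℝ} (ht : 0 < t) :
    0 < kernel α t (0 : Space n) := by
  unfold kernel
  refine mul_pos (by positivity) ?_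
  simp only [inner_zero_left, Real.cos_zero, one_mul]
  exact integral_exp_pos (integrable_exp_rpow hn hα0 ht)

theorem kernel_scaling {n : ℕ} {α : ℝ} (hα0 : 0 < α) {t : ℝ} (ht : 0 < t)
    (x : Space n) :
    kernel α t x = t ^ (-(n : ℝ) / (2 * α)) * kernel α 1 (t ^ (-1 / (2 * α)) • x) := by
  unfold kernel
  set b := t ^ (-1 / (2 * α)) with hb
  have hb0 : 0 < b := Real.rpow_pos_of_pos ht _
  have h := Measure.integral_comp_smul (volume : Measure (Space n))
    (fun y : Space n => Real.cos (inner ℝ x y) * Real.exp (-(t * ‖y‖ ^ (2 * α)))) b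
  have e : ∀ y : Space n, Real.cos (inner ℝ x (b • y)) * Real.exp (-(t * ‖b • y‖ ^ (2 * α)))
      = Real.cos (inner ℝ (b • x) y) * Real.exp (-(1 * ‖y‖ ^ (2 * α))) := by
    intro y
    rw [inner_smul_right, inner_smul_left, norm_smul, Real.norm_of_nonneg hb0.le,
      Real.mul_rpow hb0.le (norm_nonneg _), ← mul_assoc, hb, ← Real.rpow_mul ht.le]
    have : -1 / (2 * α) * (2 * α) = -1 := by field_simp
    rw [this, Real.rpow_neg_one, mul_inv_cancel₀ ht.ne']
    simp
  simp only [e] at h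
  rw [h, smul_eq_mul, finrank_euclideanSpace, Fintype.card_fin, abs_of_pos (by positivity)]
  have h2 : t ^ (-(n : ℝ) / (2 * α)) = b ^ n := by
    rw [hb, ← Real.rpow_natCast, ← Real.rpow_mul ht.le]; congr 1; ring
  rw [h2]
  field_simp

theorem integral_gaussCos_one {n : ℕ} {a : ℝ} (ha : 0 < a) :
    Integrable (fun y : Space n => gaussCos a (fun _ => 1) y) ∧
      ∫ y : Space n, gaussCos a (fun _ => 1) y = (2 * Real.pi) ^ n := by
  have hg : ∀ y : Space n, gaussCos a (fun _ => 1) y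
      = (Real.pi / a) ^ ((n : ℝ) / 2) * Real.exp (-(1 / (4 * a)) * ‖y‖ ^ 2) := fun y => by
    rw [gaussCos_one ha]; congr 2; ring
  simp only [hg]
  constructor
  · refine Integrable.const_mul ?_ _
    have := integrable_gauss (n := n) (a := 1 / (4 * a)) (by positivity)
    simpa only [neg_mul] using this
  · rw [integral_const_mul, GaussianFourier.integral_rexp_neg_mul_sq_norm (by positivity),
      finrank_euclideanSpace, Fintype.card_fin, ← Real.mul_rpow (by positivity) (by positivity)]
    have : Real.pi / a * (Real.pi / (1 / (4 * a))) = (2 * Real.pi) ^ (2 : ℝ) := by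
      rw [Real.rpow_two]; field_simp; ring
    rw [this, ← Real.rpow_mul (by positivity), ← Real.rpow_natCast]
    congr 1; ring

/-- The multiplication formula for the Fourier transform, by Fubini. The Gaussian weight is needed
because integrability of the kernel is not yet known. -/
theorem integral_kernel_mul_gauss {n : ℕ} (hn : 1 ≤ n) {α : ℝ} (hα0 : 0 < α) {t : ℝ}
    (ht : 0 < t) {a : ℝ} (ha : 0 < a) :
    ∫ x : Space n, kernel α t x * Real.exp (-(a * ‖x‖ ^ 2))
      = ((2 * Real.pi) ^ n)⁻¹ *
        ∫ y : Space n, Real.exp (-(t * ‖y‖ ^ (2 * α))) * gaussCos a (fun _ => 1) y := by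
  have hhi := integrable_exp_rpow (n := n) hn hα0 ht
  have : ∀ x : Space n, kernel α t x * Real.exp (-(a * ‖x‖ ^ 2))
      = ((2 * Real.pi) ^ n)⁻¹ * ∫ y : Space n, Real.exp (-(t * ‖y‖ ^ (2 * α))) *
        (Real.cos (inner ℝ y x) * (Real.exp (-(a * ‖x‖ ^ 2)) * 1)) := by
    intro x
    unfold kernel
    rw [mul_assoc, ← integral_mul_const]
    congr 2; ext y
    rw [real_inner_comm]; ring
  simp only [this]
  rw [integral_const_mul, integral_integral_swap]
  · simp only [integral_const_mul]; rfl
  · have := (integrable_gauss (n := n) ha).mul_prod hhi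
    refine this.mono' ?_ (Eventually.of_forall fun z => ?_)
    · exact (by fun_prop : Measurable _).aestronglyMeasurable
    · simp only [Function.uncurry]
      rw [Real.norm_eq_abs, abs_mul, abs_mul, mul_one, abs_of_pos (Real.exp_pos _),
        abs_of_pos (Real.exp_pos (-(a * _)))]
      calc _ ≤ Real.exp (-(t * ‖z.2‖ ^ (2 * α))) * (1 * Real.exp (-(a * ‖z.1‖ ^ 2))) :=
            mul_le_mul_of_nonneg_left (mul_le_mul_of_nonneg_right (Real.abs_cos_le_one _)
              (Real.exp_pos _).le) (Real.exp_pos _).le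
        _ = _ := by ring

theorem lintegral_kernel_mul_gauss_le_one {n : ℕ} (hn : 1 ≤ n) {α : ℝ} (hα0 : 0 < α) (hα1 : α < 1)
    {t : ℝ} (ht : 0 < t) {a : ℝ} (ha : 0 < a) :
    ∫⁻ x : Space n, ENNReal.ofReal (kernel α t x * Real.exp (-(a * ‖x‖ ^ 2))) ≤ 1 := by
  have hK := kernel_nonneg hn hα0 hα1 ht
  have hKm := measurable_kernel_right (n := n) α t
  have hb : ∀ x : Space n, ‖kernel α t x‖ ≤ kernel α t (0 : Space n) := fun x => by
    rw [Real.norm_of_nonneg (hK x)]; exact kernel_anti hn hα0 hα1 ht (by simp)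
  have hint : Integrable (fun x : Space n => kernel α t x * Real.exp (-(a * ‖x‖ ^ 2))) :=
    (integrable_gauss ha).bdd_mul hKm.aestronglyMeasurable (Eventually.of_forall hb)
  rw [← ofReal_integral_eq_lintegral_ofReal hint
    (Eventually.of_forall fun x => mul_nonneg (hK x) (Real.exp_pos _).le),
    ENNReal.ofReal_le_one, integral_kernel_mul_gauss hn hα0 ht ha]
  obtain ⟨hgi, he⟩ := integral_gaussCos_one (n := n) ha
  have e2 : ∫ y : Space n, Real.exp (-(t * ‖y‖ ^ (2 * α))) * gaussCos a (fun _ => 1) y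
      ≤ ∫ y : Space n, gaussCos a (fun _ => 1) y := by
    refine integral_mono_of_nonneg (Eventually.of_forall fun y => ?_) hgi
      (Eventually.of_forall fun y => ?_)
    · exact mul_nonneg (Real.exp_pos _).le (GaussPositive.one.nonneg a ha y)
    · refine mul_le_of_le_one_left (GaussPositive.one.nonneg a ha y) ?_
      rw [Real.exp_le_one_iff, neg_nonpos]; positivity
  rw [he] at e2
  calc _ ≤ ((2 * Real.pi) ^ n)⁻¹ * (2 * Real.pi) ^ n :=
        mul_le_mul_of_nonneg_left e2 (by positivity)
    _ = 1 := inv_mul_cancel₀ (by positivity)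

/-- With a Gaussian weight the mass is at most one, because the symbol is at most one and the
Gaussian transform is nonnegative with integral `(2π)^n`. Fatou's lemma removes the weight. The
inequality suffices below, so the exact mass is not computed. -/
theorem lintegral_kernel_le_one {n : ℕ} (hn : 1 ≤ n) {α : ℝ} (hα0 : 0 < α) (hα1 : α < 1) {t : ℝ}
    (ht : 0 < t) : ∫⁻ x : Space n, ENNReal.ofReal (kernel α t x) ≤ 1 := by
  have hKm := measurable_kernel_right (n := n) α t
  have hlim : ∀ x : Space n, Tendsto (fun k : ℕ => ENNReal.ofReal (kernel α t x *
      Real.exp (-(1 / ((k : ℝ) + 1) * ‖x‖ ^ 2)))) atTop (𝓝 (ENNReal.ofReal (kernel α t x))) := by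
    intro x
    refine ENNReal.tendsto_ofReal ?_
    have h1 := (tendsto_one_div_add_atTop_nhds_zero_nat (𝕜 := ℝ)).mul_const (‖x‖ ^ 2)
    have h2 := ((Real.continuous_exp.tendsto _).comp h1.neg).const_mul (kernel α t x)
    simpa [Function.comp_def] using h2
  calc ∫⁻ x : Space n, ENNReal.ofReal (kernel α t x)
      = ∫⁻ x : Space n, liminf (fun k : ℕ => ENNReal.ofReal (kernel α t x *
          Real.exp (-(1 / ((k : ℝ) + 1) * ‖x‖ ^ 2)))) atTop := by
        congr 1; ext x; exact (hlim x).liminf_eq.symm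
    _ ≤ liminf (fun k : ℕ => ∫⁻ x : Space n, ENNReal.ofReal (kernel α t x *
          Real.exp (-(1 / ((k : ℝ) + 1) * ‖x‖ ^ 2)))) atTop :=
        lintegral_liminf_le fun k => by fun_prop
    _ ≤ liminf (fun _ : ℕ => (1 : ℝ≥0∞)) atTop :=
        liminf_le_liminf (Eventually.of_forall fun k => 
          lintegral_kernel_mul_gauss_le_one hn hα0 hα1 ht (by positivity))
    _ = 1 := by simp

theorem measurable_kernel_comp {n : ℕ} (α : ℝ) {X : Type*} [MeasurableSpace X] {f : X → ℝ}
    {g : X → Space n} (hf : Measurable f) (hg : Measurable g) :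
    Measurable (fun z => kernel α (f z) (g z)) := by
  unfold kernel
  have : Measurable (fun z : X × Space n =>
    Real.cos (inner ℝ (g z.1) z.2) * Real.exp (-(f z.1 * ‖z.2‖ ^ (2 * α)))) := by fun_prop
  exact (this.stronglyMeasurable.integral_prod_right.measurable).const_mul _

theorem kernel_le_rpow {n : ℕ} (hn : 1 ≤ n) {α : ℝ} (hα0 : 0 < α) (hα1 : α < 1) {t : ℝ}
    (ht : 0 < t) (x : Space n) :
    kernel α t x ≤ kernel α 1 (0 : Space n) * t ^ (-(n : ℝ) / (2 * α)) := by
  rw [kernel_scaling hα0 ht, mul_comm]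
  exact mul_le_mul_of_nonneg_right (kernel_anti hn hα0 hα1 one_pos (by simp)) (by positivity)

/-- The kernel is at most `C r^{-n}` outside the parabolic ball of radius `r`. -/
theorem exists_kernel_le {n : ℕ} (hn : 1 ≤ n) {α : ℝ} (hα0 : 0 < α) (hα1 : α < 1) :
    ∃ C : ℝ, 0 < C ∧ ∀ r t : ℝ, 0 < r → 0 < t → ∀ x : Space n,
      (r ^ (2 * α) ≤ t ∨ r ≤ ‖x‖) → kernel α t x ≤ C * r ^ (-(n : ℝ)) := by
  have : Nonempty (Fin n) := ⟨⟨0, hn⟩⟩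
  set ω : ℝ := √Real.pi ^ n / Real.Gamma ((n : ℝ) / 2 + 1) with hω
  have hω0 : 0 < ω := div_pos (by positivity) (Real.Gamma_pos_of_pos (by positivity))
  have hk0 := kernel_zero_pos hn hα0 one_pos
  refine ⟨max (kernel α 1 (0 : Space n)) ω⁻¹, lt_max_of_lt_left hk0, fun r t hr ht x h => ?_⟩
  rcases h with h | h
  · refine (kernel_le_rpow hn hα0 hα1 ht x).trans ?_
    have h1 : t ^ (-(n : ℝ) / (2 * α)) ≤ r ^ (-(n : ℝ)) := by
      calc t ^ (-(n : ℝ) / (2 * α)) ≤ (r ^ (2 * α)) ^ (-(n : ℝ) / (2 * α)) :=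
            Real.rpow_le_rpow_of_nonpos (by positivity) h
              (div_nonpos_of_nonpos_of_nonneg (by simp) (by positivity))
        _ = r ^ (-(n : ℝ)) := by rw [← Real.rpow_mul hr.le]; congr 1; field_simp
    exact mul_le_mul (le_max_left _ _) h1 (by positivity) (hk0.le.trans (le_max_left _ _))
  -- A radially decreasing function is at most its average over the ball of radius `r ≤ ‖x‖`, and
  -- the total mass is at most one. No tail asymptotics of the kernel are needed.
  · have h1 : ENNReal.ofReal (kernel α t x) * volume (Metric.ball (0 : Space n) r) ≤ 1 := by
      calc _ = ∫⁻ y in Metric.ball (0 : Space n) r, ENNReal.ofReal (kernel α t x) := by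
            rw [setLIntegral_const]
        _ ≤ ∫⁻ y in Metric.ball (0 : Space n) r, ENNReal.ofReal (kernel α t y) := by
            refine setLIntegral_mono' Metric.isOpen_ball.measurableSet fun y hy => ?_
            refine ENNReal.ofReal_le_ofReal (kernel_anti hn hα0 hα1 ht ?_)
            rw [mem_ball_zero_iff] at hy
            exact hy.le.trans h
        _ ≤ ∫⁻ y : Space n, ENNReal.ofReal (kernel α t y) := setLIntegral_le_lintegral _ _
        _ ≤ 1 := lintegral_kernel_le_one hn hα0 hα1 ht
    rw [EuclideanSpace.volume_ball, Fintype.card_fin, ← hω, ← ENNReal.ofReal_pow hr.le,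
      ← ENNReal.ofReal_mul (by positivity), ← ENNReal.ofReal_mul (kernel_nonneg hn hα0 hα1 ht x),
      ENNReal.ofReal_le_one] at h1
    rw [Real.rpow_neg hr.le, Real.rpow_natCast]
    calc kernel α t x = kernel α t x * (r ^ n * ω) * (ω⁻¹ * (r ^ n)⁻¹) := by field_simp
      _ ≤ 1 * (ω⁻¹ * (r ^ n)⁻¹) := by gcongr
      _ = ω⁻¹ * (r ^ n)⁻¹ := one_mul _
      _ ≤ _ := by gcongr; exact le_max_right _ _

/-- By scaling only the profile at time one matters, and it is continuous and positive at the
origin. -/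
theorem exists_le_kernel {n : ℕ} (hn : 1 ≤ n) {α : ℝ} (hα0 : 0 < α) :
    ∃ ρ c : ℝ, 0 < ρ ∧ 0 < c ∧ ∀ t : ℝ, 0 < t → ∀ x : Space n,
      ‖x‖ ≤ ρ * t ^ (1 / (2 * α)) → c * t ^ (-(n : ℝ) / (2 * α)) ≤ kernel α t x := by
  have hk0 := kernel_zero_pos hn hα0 one_pos
  have hc := (continuous_kernel (n := n) hn hα0 one_pos).continuousAt (x := 0)
  have he := hc.eventually (lt_mem_nhds (half_lt_self hk0))
  obtain ⟨ρ, hρ, hball⟩ := Metric.eventually_nhds_iff.1 he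
  refine ⟨ρ / 2, kernel α 1 (0 : Space n) / 2, by positivity, by positivity,
    fun t ht x hx => ?_⟩
  rw [kernel_scaling hα0 ht, mul_comm]
  refine mul_le_mul_of_nonneg_left (hball ?_).le (by positivity)
  rw [dist_zero_right, norm_smul, Real.norm_of_nonneg (by positivity)]
  have h1 : t ^ (-1 / (2 * α)) * t ^ (1 / (2 * α)) = 1 := by
    rw [← Real.rpow_add ht]; ring_nf; simp
  calc _ ≤ t ^ (-1 / (2 * α)) * (ρ / 2 * t ^ (1 / (2 * α))) := by gcongr
    _ = ρ / 2 * (t ^ (-1 / (2 * α)) * t ^ (1 / (2 * α))) := by ring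
    _ < ρ := by rw [h1]; linarith

/-! ### Countable subadditivity of capacity and comparison with Hausdorff capacity -/

theorem rpow_tsum_le {s : ℝ} (hs0 : 0 < s) (hs1 : s ≤ 1) (a : ℕ → ℝ≥0∞) :
    (∑' j, a j) ^ s ≤ ∑' j, a j ^ s := by
  have hfin : ∀ N, (∑ j ∈ Finset.range N, a j) ^ s ≤ ∑ j ∈ Finset.range N, a j ^ s := by
    intro N
    induction N with
    | zero => simp [ENNReal.zero_rpow_of_pos hs0]
    | succ N ih =>
      rw [Finset.sum_range_succ, Finset.sum_range_succ]
      exact (ENNReal.rpow_add_le_add_rpow _ _ hs0.le hs1).trans (add_le_add_left ih _)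
  have h1 : Tendsto (fun N => (∑ j ∈ Finset.range N, a j) ^ s) atTop (𝓝 ((∑' j, a j) ^ s)) :=
    ((ENNReal.continuous_rpow_const (y := s)).tendsto _).comp (ENNReal.tendsto_nat_tsum a)
  exact le_of_tendsto' h1 fun N => (hfin N).trans (ENNReal.sum_le_tsum _)

theorem lintegral_Lp_tsum_le {X : Type*} [MeasurableSpace X] {μ : Measure X} {r : ℝ} (hr : 1 ≤ r)
    {G : ℕ → X → ℝ≥0∞} (hG : ∀ j, Measurable (G j)) :
    (∫⁻ x, (∑' j, G j x) ^ r ∂μ) ^ (1 / r) ≤ ∑' j, (∫⁻ x, G j x ^ r ∂μ) ^ (1 / r) := by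
  have hr0 : 0 < r := one_pos.trans_le hr
  have hSm : ∀ N, Measurable (fun x => ∑ j ∈ Finset.range N, G j x) := fun N =>
    Finset.measurable_fun_sum _ fun j _ => hG j
  have hfin : ∀ N, (∫⁻ x, (∑ j ∈ Finset.range N, G j x) ^ r ∂μ) ^ (1 / r)
      ≤ ∑ j ∈ Finset.range N, (∫⁻ x, G j x ^ r ∂μ) ^ (1 / r) := by
    intro N
    induction N with
    | zero => simp [ENNReal.zero_rpow_of_pos hr0, hr0]
    | succ N ih =>
      simp only [Finset.sum_range_succ]
      refine (ENNReal.lintegral_Lp_add_le (hSm N).aemeasurable (hG N).aemeasurable hr).trans ?_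
      exact add_le_add_left ih _
  have hlim : Tendsto (fun N => ∫⁻ x, (∑ j ∈ Finset.range N, G j x) ^ r ∂μ) atTop
      (𝓝 (∫⁻ x, (∑' j, G j x) ^ r ∂μ)) := by
    refine lintegral_tendsto_of_tendsto_of_monotone (fun N => ((hSm N).pow_const r).aemeasurable)
      (Eventually.of_forall fun x N M hNM => ?_) (Eventually.of_forall fun x => ?_)
    · exact ENNReal.rpow_le_rpow (Finset.sum_le_sum_of_subset
        (Finset.range_subset_range.2 hNM)) hr0.le
    · exact ((ENNReal.continuous_rpow_const (y := r)).tendsto _).comp (ENNReal.tendsto_nat_tsum _)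
  have h1 := ((ENNReal.continuous_rpow_const (y := 1 / r)).tendsto _).comp hlim
  exact le_of_tendsto' h1 fun N => (hfin N).trans (ENNReal.sum_le_tsum _)

theorem measurable_lintegral_rpow {n : ℕ} {F : ℝ × Space n → ℝ≥0∞} (hF : Measurable F) (p : ℝ) :
    Measurable (fun t => ∫⁻ x : Space n, F (t, x) ^ p) :=
  (hF.pow_const p).lintegral_prod_right'

/-- Inside each time slice, the `p`-th power of a supremum is at most the sum of the `p`-th powers.
For `p ≤ q`, Minkowski's inequality in `L^{q/p}` of time finishes with exponent `p`; for `q < p`,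
subadditivity of the power `q/p ≤ 1` finishes with exponent `q`. This is the role of `min p q`. -/
theorem mixedNorm_iSup_rpow_le {n : ℕ} {p q : ℝ} (hp : 1 ≤ p) (hq : 1 < q)
    {F : ℕ → ℝ × Space n → ℝ≥0∞} (hF : ∀ j, Measurable (F j)) :
    mixedNorm p q (fun z => ⨆ j, F j z) ^ min p q ≤ ∑' j, mixedNorm p q (F j) ^ min p q := by
  have hp0 : 0 < p := one_pos.trans_le hp
  have hq0 : 0 < q := one_pos.trans hq
  set G : ℕ → ℝ → ℝ≥0∞ := fun j t => ∫⁻ x : Space n, F j (t, x) ^ p with hG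
  have hGm : ∀ j, Measurable (G j) := fun j => measurable_lintegral_rpow (hF j) p
  have h1 : ∀ t, ∫⁻ x : Space n, (⨆ j, F j (t, x)) ^ p ≤ ∑' j, G j t := by
    intro t
    have hm : ∀ j, AEMeasurable (fun x : Space n => F j (t, x) ^ p) := fun j =>
      (((hF j).comp measurable_prodMk_left).pow_const p).aemeasurable
    simp only [hG]
    rw [← lintegral_tsum hm]
    refine lintegral_mono fun x => ?_
    have : (⨆ j, F j (t, x)) ^ p = ⨆ j, F j (t, x) ^ p :=
      (ENNReal.orderIsoRpow p hp0).map_iSup _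
    rw [this]
    exact iSup_le fun j => ENNReal.le_tsum (f := fun j => F j (t, x) ^ p) j
  unfold mixedNorm
  rcases le_or_gt p q with hpq | hpq
  · rw [min_eq_left hpq]
    have e : 1 / q * p = 1 / (q / p) := by field_simp
    simp only [← ENNReal.rpow_mul, e]
    refine le_trans ?_ (lintegral_Lp_tsum_le ((one_le_div hp0).2 hpq) hGm)
    gcongr with t
    exact h1 t
  · rw [min_eq_right hpq.le]
    have e : 1 / q * q = 1 := by field_simp
    simp only [← ENNReal.rpow_mul, e, ENNReal.rpow_one]
    calc _ ≤ ∫⁻ t in Ioi (0 : ℝ), ∑' j, G j t ^ (q / p) := by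
          refine lintegral_mono fun t => ?_
          refine (ENNReal.rpow_le_rpow (h1 t) (by positivity)).trans
            (rpow_tsum_le (by positivity) ((div_le_one hp0).2 hpq.le) _)
      _ = _ := lintegral_tsum fun j => ((hGm j).pow_const _).aemeasurable

theorem potential_mono {n : ℕ} {α : ℝ} {F G : ℝ × Space n → ℝ≥0∞} (h : F ≤ G)
    (z : ℝ × Space n) : potential α F z ≤ potential α G z :=
  lintegral_mono fun s => lintegral_mono fun y => mul_le_mul_right (h (s, y)) _

theorem compactCapacity_le {n : ℕ} {α p q : ℝ} {E : Set (ℝ × Space n)} {F : ℝ × Space n → ℝ≥0∞}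
    (hF : Measurable F) (h : ∀ z ∈ E, 1 ≤ potential α F z) :
    compactCapacity α p q E ≤ mixedNorm p q F ^ min p q :=
  iInf_le_of_le F (iInf_le_of_le hF (iInf_le _ h))

theorem compactCapacity_mono {n : ℕ} {α p q : ℝ} {E E' : Set (ℝ × Space n)} (h : E ⊆ E') :
    compactCapacity α p q E ≤ compactCapacity α p q E' :=
  le_iInf fun _ => le_iInf fun hF => le_iInf fun hF' =>
    compactCapacity_le hF fun z hz => hF' z (h hz)

theorem compactCapacity_empty {n : ℕ} {α p q : ℝ} (hp : 1 ≤ p) (hq : 1 < q) :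
    compactCapacity α p q (∅ : Set (ℝ × Space n)) = 0 := by
  have hp0 : 0 < p := one_pos.trans_le hp
  have hq0 : 0 < q := one_pos.trans hq
  refine le_antisymm ((compactCapacity_le (F := fun _ => 0) measurable_const (by simp)).trans ?_)
    (by simp)
  unfold mixedNorm
  have h1 : 0 < q / p := by positivity
  have h2 : 0 < min p q := lt_min hp0 hq0
  simp [ENNReal.zero_rpow_of_pos, hp0, hq0, h1, h2]

/-- The supremum of near-optimal competitors for the pieces is a competitor for the union. The sets
are arbitrary, so this applies directly to unions of open balls. -/
theorem compactCapacity_iUnion_le {n : ℕ} {α p q : ℝ} (hp : 1 ≤ p) (hq : 1 < q)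
    (E : ℕ → Set (ℝ × Space n)) :
    compactCapacity α p q (⋃ j, E j) ≤ ∑' j, compactCapacity α p q (E j) := by
  by_cases htop : ∑' j, compactCapacity α p q (E j) = ∞
  · rw [htop]; exact le_top
  refine ENNReal.le_of_forall_pos_le_add fun ε hε _ => ?_
  obtain ⟨ε', hε', hsum⟩ := ENNReal.exists_pos_sum_of_countable
    (ENNReal.coe_ne_zero.2 hε.ne') ℕ
  have hex : ∀ j, ∃ F : ℝ × Space n → ℝ≥0∞, Measurable F ∧ (∀ z ∈ E j, 1 ≤ potential α F z) ∧
      mixedNorm p q F ^ min p q ≤ compactCapacity α p q (E j) + ε' j := by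
    intro j
    have hlt : compactCapacity α p q (E j) < compactCapacity α p q (E j) + ε' j :=
      ENNReal.lt_add_right (ENNReal.ne_top_of_tsum_ne_top htop j)
        (ENNReal.coe_ne_zero.2 (hε' j).ne')
    conv_lhs at hlt => unfold compactCapacity
    simp only [iInf_lt_iff] at hlt
    obtain ⟨F, hF, hF', h⟩ := hlt
    exact ⟨F, hF, hF', h.le⟩
  choose F hFm hF1 hF2 using hex
  calc _ ≤ mixedNorm p q (fun z => ⨆ j, F j z) ^ min p q := by
        refine compactCapacity_le (Measurable.iSup hFm) fun z hz => ?_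
        obtain ⟨j, hj⟩ := mem_iUnion.1 hz
        exact (hF1 j z hj).trans (potential_mono (fun w => le_iSup (fun i => F i w) j) z)
    _ ≤ ∑' j, mixedNorm p q (F j) ^ min p q := mixedNorm_iSup_rpow_le hp hq hFm
    _ ≤ ∑' j, (compactCapacity α p q (E j) + ε' j) := ENNReal.tsum_le_tsum hF2
    _ = ∑' j, compactCapacity α p q (E j) + ∑' j, (ε' j : ℝ≥0∞) := ENNReal.tsum_add
    _ ≤ _ := by gcongr

theorem isOpen_parabolicBall {n : ℕ} (α : ℝ) (z : ℝ × Space n) (r : ℝ) :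
    IsOpen (parabolicBall α z r) := by
  unfold parabolicBall
  have h1 : IsOpen {w : ℝ × Space n | 0 < w.1} := isOpen_lt (by fun_prop) (by fun_prop)
  have h2 : IsOpen {w : ℝ × Space n | |w.1 - z.1| < r ^ (2 * α)} :=
    isOpen_lt (by fun_prop) (by fun_prop)
  have h3 : IsOpen {w : ℝ × Space n | ‖w.2 - z.2‖ < r} := isOpen_lt (by fun_prop) (by fun_prop)
  exact h1.inter (h2.inter h3)

/-- If the balls meeting `{t ≥ τ}` with radii less than `δ` have capacity at most `c φ(r)`, then
the capacity is at most `c` times the Hausdorff capacity on subsets of `{t ≥ τ}`. -/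
theorem capacity_le_hausdorffCapacity {n : ℕ} {α p q : ℝ} (hp : 1 ≤ p) (hq : 1 < q)
    {φ : ℝ → ℝ≥0∞} {δ τ : ℝ} {c : ℝ≥0} (hc : c ≠ 0)
    (hball : ∀ (z₀ : ℝ × Space n) (r : ℝ), 0 < z₀.1 → 0 < r → r < δ →
      (∃ z ∈ parabolicBall α z₀ r, τ ≤ z.1) →
      compactCapacity α p q (parabolicBall α z₀ r) ≤ c * φ r)
    {E : Set (ℝ × Space n)} (hE : ∀ z ∈ E, τ ≤ z.1) :
    compactCapacity α p q E ≤ c * hausdorffCapacity α φ δ E ∧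
      capacity α p q E ≤ c * hausdorffCapacity α φ δ E := by
  have hc' : (c : ℝ≥0∞) ≠ 0 := ENNReal.coe_ne_zero.2 hc
  have key : ∀ (z : ℕ → ℝ × Space n) (r : ℕ → ℝ), (∀ j, 0 < (z j).1) →
      (∀ j, 0 < r j ∧ r j < δ) → E ⊆ ⋃ j, parabolicBall α (z j) (r j) →
      ∃ U : Set (ℝ × Space n), IsOpen U ∧ U ⊆ halfSpace n ∧ E ⊆ U ∧
        compactCapacity α p q U ≤ c * ∑' j, φ (r j) := by
    intro z r hz hr hcov
    classical
    -- Balls missing `{t ≥ τ}` cover nothing of `E` and may lie too close to `t = 0` for a capacity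
    -- bound, so they are replaced by the empty set. The union stays open, which allows it as a
    -- competitor in `capacity`.
    set B : ℕ → Set (ℝ × Space n) := fun j =>
      if ∃ w ∈ parabolicBall α (z j) (r j), τ ≤ w.1 then parabolicBall α (z j) (r j) else ∅ with hB
    refine ⟨⋃ j, B j, isOpen_iUnion fun j => ?_, iUnion_subset fun j => ?_, fun w hw => ?_, ?_⟩
    · simp only [hB]; split_ifs
      · exact isOpen_parabolicBall _ _ _
      · exact isOpen_empty
    · simp only [hB]; split_ifs
      · exact fun w hw => hw.1
      · exact empty_subset _
    · obtain ⟨j, hj⟩ := mem_iUnion.1 (hcov hw)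
      refine mem_iUnion.2 ⟨j, ?_⟩
      simp only [hB]
      rw [if_pos ⟨w, hj, hE w hw⟩]
      exact hj
    · refine (compactCapacity_iUnion_le hp hq B).trans ?_
      rw [← ENNReal.tsum_mul_left]
      refine ENNReal.tsum_le_tsum fun j => ?_
      simp only [hB]; split_ifs with h
      · exact hball _ _ (hz j) (hr j).1 (hr j).2 h
      · rw [compactCapacity_empty hp hq]; exact zero_le
  have red : ∀ X : ℝ≥0∞, (∀ U : Set (ℝ × Space n), IsOpen U → U ⊆ halfSpace n → E ⊆ U →
      X ≤ compactCapacity α p q U) → X ≤ c * hausdorffCapacity α φ δ E := by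
    intro X hX
    rw [← ENNReal.div_le_iff' hc' ENNReal.coe_ne_top]
    refine le_iInf fun z => le_iInf fun r => le_iInf fun hz => le_iInf fun hr => le_iInf fun h => ?_
    rw [ENNReal.div_le_iff' hc' ENNReal.coe_ne_top]
    obtain ⟨U, hU1, hU2, hU3, hU4⟩ := key z r hz hr h
    exact (hX U hU1 hU2 hU3).trans hU4
  refine ⟨red _ fun U _ _ hEU => compactCapacity_mono hEU, red _ fun U hU1 hU2 hEU => ?_⟩
  have h1 : capacity α p q E ≤ openCapacity α p q U :=
    iInf_le_of_le U (iInf_le_of_le hU1 (iInf_le_of_le hU2 (iInf_le _ hEU)))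
  refine h1.trans ?_
  exact iSup_le fun K => iSup_le fun _ => iSup_le fun hK => compactCapacity_mono hK

/-! ### Cone test functions and the capacity of a parabolic ball -/

theorem exists_volume_ball {n : ℕ} (hn : 1 ≤ n) :
    ∃ ω : ℝ, 0 < ω ∧ ∀ (x : Space n) (r : ℝ), 0 ≤ r →
      volume (Metric.ball x r) = ENNReal.ofReal (ω * r ^ n) := by
  have : Nonempty (Fin n) := ⟨⟨0, hn⟩⟩
  refine ⟨√Real.pi ^ n / Real.Gamma ((n : ℝ) / 2 + 1),
    div_pos (by positivity) (Real.Gamma_pos_of_pos (by positivity)), fun x r hr => ?_⟩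
  rw [EuclideanSpace.volume_ball, Fintype.card_fin, ← ENNReal.ofReal_pow hr,
    ← ENNReal.ofReal_mul (by positivity), mul_comm]

/-- The function `A u⁻¹` on the region `a < u < b`, `|y - x₀| < ρ u^{1/(2α)}`, where `u = t₀ - s`. -/
noncomputable def coneTest {n : ℕ} (α ρ A a b : ℝ) (z₀ : ℝ × Space n) (w : ℝ × Space n) : ℝ≥0∞ :=
  {w : ℝ × Space n | a < z₀.1 - w.1 ∧ z₀.1 - w.1 < b ∧
    ‖w.2 - z₀.2‖ < ρ * (z₀.1 - w.1) ^ (1 / (2 * α))}.indicator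
      (fun w => ENNReal.ofReal (A * (z₀.1 - w.1)⁻¹)) w

theorem measurable_coneTest {n : ℕ} (α ρ A a b : ℝ) (z₀ : ℝ × Space n) :
    Measurable (coneTest α ρ A a b z₀) := by
  unfold coneTest
  refine Measurable.indicator (by fun_prop) ?_
  have h1 : MeasurableSet {w : ℝ × Space n | a < z₀.1 - w.1} :=
    measurableSet_lt (by fun_prop) (by fun_prop)
  have h2 : MeasurableSet {w : ℝ × Space n | z₀.1 - w.1 < b} :=
    measurableSet_lt (by fun_prop) (by fun_prop)
  have h3 : MeasurableSet {w : ℝ × Space n | ‖w.2 - z₀.2‖ < ρ * (z₀.1 - w.1) ^ (1 / (2 * α))} :=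
    measurableSet_lt (by fun_prop) (by fun_prop)
  exact h1.inter (h2.inter h3)

theorem coneTest_of_mem {n : ℕ} {α ρ A a b : ℝ} {z₀ : ℝ × Space n} {s : ℝ}
    (hs : z₀.1 - s ∈ Ioo a b) (y : Space n) :
    coneTest α ρ A a b z₀ (s, y) = (Metric.ball z₀.2 (ρ * (z₀.1 - s) ^ (1 / (2 * α)))).indicator
      (fun _ => ENNReal.ofReal (A * (z₀.1 - s)⁻¹)) y := by
  unfold coneTest
  by_cases h : y ∈ Metric.ball z₀.2 (ρ * (z₀.1 - s) ^ (1 / (2 * α)))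
  · rw [indicator_of_mem h, indicator_of_mem]
    rw [mem_ball_iff_norm] at h
    exact ⟨hs.1, hs.2, h⟩
  · rw [indicator_of_notMem h, indicator_of_notMem]
    rintro ⟨_, _, h'⟩
    exact h (mem_ball_iff_norm.2 h')

theorem coneTest_of_notMem {n : ℕ} {α ρ A a b : ℝ} {z₀ : ℝ × Space n} {s : ℝ}
    (hs : z₀.1 - s ∉ Ioo a b) (y : Space n) : coneTest α ρ A a b z₀ (s, y) = 0 :=
  indicator_of_notMem (fun h => hs ⟨h.1, h.2.1⟩) _

theorem lintegral_Ioo_inv {a b : ℝ} (ha : 0 < a) (hab : a < b) :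
    ∫⁻ u in Ioo a b, ENNReal.ofReal u⁻¹ = ENNReal.ofReal (Real.log (b / a)) := by
  rw [← integral_inv_of_pos ha (ha.trans hab), intervalIntegral.integral_of_le hab.le,
    integral_Ioc_eq_integral_Ioo, ← ofReal_integral_eq_lintegral_ofReal]
  · have : IntervalIntegrable (fun u : ℝ => u⁻¹) volume a b :=
      intervalIntegral.intervalIntegrable_inv (fun x hx => by
        rw [uIcc_of_le hab.le] at hx
        exact (ha.trans_le hx.1).ne') continuousOn_id
    exact this.1.mono_set Ioo_subset_Ioc_self
  · exact (ae_restrict_mem measurableSet_Ioo).mono fun u hu => by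
      have : 0 < u := ha.trans hu.1
      exact (inv_pos.2 this).le

theorem rpow_mul_rpow_inv_pow {α u : ℝ} (hα : 0 < α) (hu : 0 < u) (n : ℕ) :
    (u ^ (1 / (2 * α))) ^ n = u ^ ((n : ℝ) / (2 * α)) := by
  rw [← Real.rpow_natCast, ← Real.rpow_mul hu.le]; congr 1; field_simp

/-- At depth `u` the kernel is at least a multiple of `u^{-n/(2α)}` on a spatial ball whose volume
is a multiple of `u^{n/(2α)}`. The slice therefore contributes a multiple of `A u⁻¹`, which
integrates to `A log(b/a)`. -/
theorem le_potential_coneTest {n : ℕ} (hn : 1 ≤ n) {α : ℝ} (hα0 : 0 < α) :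
    ∃ ρ M c : ℝ, 0 < ρ ∧ 2 ≤ M ∧ 0 < c ∧ ∀ (z₀ : ℝ × Space n) (r a b A : ℝ), 0 < r →
      M * r ^ (2 * α) ≤ a → a < b → b ≤ z₀.1 → 0 < A → ∀ z ∈ parabolicBall α z₀ r,
        ENNReal.ofReal (c * A * Real.log (b / a)) ≤ potential α (coneTest α ρ A a b z₀) z := by
  obtain ⟨ρ, c, hρ, hc, hK⟩ := exists_le_kernel (n := n) hn hα0
  obtain ⟨ω, hω, hvol⟩ := exists_volume_ball hn
  -- Chosen so that `2 ρ₁ u^{1/(2α)} = ρ (u/2)^{1/(2α)}`. The offset of `z` from the centre and the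
  -- radius of the slice together then stay where the kernel is bounded below.
  set ρ₁ := ρ / 2 * (1 / 2) ^ (1 / (2 * α)) with hρ₁
  have hρ₁0 : 0 < ρ₁ := by positivity
  set c' := c * 2 ^ (-(n : ℝ) / (2 * α)) with hc'
  have hc'0 : 0 < c' := by positivity
  -- The factor 2 gives `r^{2α} ≤ u/2`, hence `u/2 ≤ t - s ≤ 2u`; the other entry gives `r ≤ ρ₁
  -- u^{1/(2α)}`.
  refine ⟨ρ₁, max 2 ((1 / ρ₁) ^ (2 * α)), c' * ω * ρ₁ ^ n, hρ₁0, le_max_left _ _, by positivity,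
    fun z₀ r a b A hr hra hab hb hA z hz => ?_⟩
  have hr2 : 0 < r ^ (2 * α) := by positivity
  have ha1 : 2 * r ^ (2 * α) ≤ a :=
    (mul_le_mul_of_nonneg_right (le_max_left _ _) hr2.le).trans hra
  have ha2 : (1 / ρ₁) ^ (2 * α) * r ^ (2 * α) ≤ a :=
    (mul_le_mul_of_nonneg_right (le_max_right _ _) hr2.le).trans hra
  have ha0 : 0 < a := by linarith
  obtain ⟨hz0, hzt, hzx⟩ := hz
  rw [abs_lt] at hzt
  set g : ℝ → ℝ≥0∞ := (Ioo a b).indicator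
    (fun u => ENNReal.ofReal (c' * ω * ρ₁ ^ n * A * u⁻¹)) with hg
  have hgi : ∫⁻ s, g (z₀.1 - s) = ENNReal.ofReal (c' * ω * ρ₁ ^ n * A * Real.log (b / a)) := by
    rw [lintegral_sub_left_eq_self g, hg, lintegral_indicator measurableSet_Ioo]
    have : ∀ u : ℝ, ENNReal.ofReal (c' * ω * ρ₁ ^ n * A * u⁻¹)
        = ENNReal.ofReal (c' * ω * ρ₁ ^ n * A) * ENNReal.ofReal u⁻¹ := fun u =>
      ENNReal.ofReal_mul (by positivity)
    simp only [this]
    rw [lintegral_const_mul _ (by fun_prop), lintegral_Ioo_inv ha0 hab,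
      ← ENNReal.ofReal_mul (by positivity)]
  rw [← hgi]
  unfold potential
  rw [← lintegral_indicator measurableSet_Ioo]
  refine lintegral_mono fun s => ?_
  by_cases hs : z₀.1 - s ∈ Ioo a b
  swap
  · simp only [hg]; rw [indicator_of_notMem hs]; exact zero_le
  have hsI : s ∈ Ioo 0 z.1 := ⟨by linarith [hs.2], by linarith [hs.1]⟩
  simp only [hg]
  rw [indicator_of_mem hs, indicator_of_mem hsI]
  set u := z₀.1 - s with hu
  have hu0 : 0 < u := ha0.trans hs.1
  simp only [coneTest_of_mem (ρ := ρ₁) (A := A) (α := α) hs]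
  have hball : 0 ≤ ρ₁ * u ^ (1 / (2 * α)) := by positivity
  have hrρ : r ≤ ρ₁ * u ^ (1 / (2 * α)) := by
    have h1 : (1 / ρ₁ * r) ^ (2 * α) ≤ u := by
      rw [Real.mul_rpow (by positivity) hr.le]; exact ha2.trans hs.1.le
    have h2 : 1 / ρ₁ * r ≤ u ^ (1 / (2 * α)) := by
      calc 1 / ρ₁ * r = ((1 / ρ₁ * r) ^ (2 * α)) ^ (1 / (2 * α)) := by
            rw [← Real.rpow_mul (by positivity)]
            rw [mul_one_div_cancel (by positivity), Real.rpow_one]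
        _ ≤ _ := Real.rpow_le_rpow (by positivity) h1 (by positivity)
    calc r = ρ₁ * (1 / ρ₁ * r) := by field_simp
      _ ≤ _ := by gcongr
  calc ENNReal.ofReal (c' * ω * ρ₁ ^ n * A * u⁻¹)
      = ∫⁻ y in Metric.ball z₀.2 (ρ₁ * u ^ (1 / (2 * α))),
          ENNReal.ofReal (c' * u ^ (-(n : ℝ) / (2 * α))) * ENNReal.ofReal (A * u⁻¹) := by
        rw [setLIntegral_const, hvol _ _ hball, ← ENNReal.ofReal_mul (by positivity),
          ← ENNReal.ofReal_mul (by positivity), mul_pow ρ₁, rpow_mul_rpow_inv_pow hα0 hu0, neg_div,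
          Real.rpow_neg hu0.le]
        congr 1
        field_simp
    _ ≤ ∫⁻ y in Metric.ball z₀.2 (ρ₁ * u ^ (1 / (2 * α))),
          ENNReal.ofReal (kernel α (z.1 - s) (z.2 - y)) * ENNReal.ofReal (A * u⁻¹) := by
        refine setLIntegral_mono' Metric.isOpen_ball.measurableSet fun y hy => ?_
        refine mul_le_mul_left (ENNReal.ofReal_le_ofReal ?_) _
        rw [mem_ball_iff_norm] at hy
        have hts1 : u / 2 ≤ z.1 - s := by linarith [hs.1]
        have hts2 : z.1 - s ≤ 2 * u := by linarith [hs.1]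
        have hts0 : 0 < z.1 - s := by linarith
        refine le_trans ?_ (hK (z.1 - s) hts0 (z.2 - y) ?_)
        · calc c' * u ^ (-(n : ℝ) / (2 * α)) = c * (2 * u) ^ (-(n : ℝ) / (2 * α)) := by
                rw [Real.mul_rpow (by norm_num) hu0.le]; ring
            _ ≤ _ := by
                refine mul_le_mul_of_nonneg_left (Real.rpow_le_rpow_of_nonpos hts0 hts2 ?_) hc.le
                exact div_nonpos_of_nonpos_of_nonneg (by simp) (by positivity)
        · calc ‖z.2 - y‖ = ‖(z.2 - z₀.2) - (y - z₀.2)‖ := by congr 1; abel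
            _ ≤ ‖z.2 - z₀.2‖ + ‖y - z₀.2‖ := norm_sub_le _ _
            _ ≤ ρ₁ * u ^ (1 / (2 * α)) + ρ₁ * u ^ (1 / (2 * α)) := by linarith
            _ = ρ * (u / 2) ^ (1 / (2 * α)) := by
                rw [div_eq_mul_one_div u 2, Real.mul_rpow hu0.le (by norm_num)]; ring
            _ ≤ _ := by gcongr
    _ = ∫⁻ y : Space n, ENNReal.ofReal (kernel α (z.1 - s) (z.2 - y)) *
          (Metric.ball z₀.2 (ρ₁ * u ^ (1 / (2 * α)))).indicator
            (fun _ => ENNReal.ofReal (A * u⁻¹)) y := by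
        rw [← lintegral_indicator Metric.isOpen_ball.measurableSet]
        refine lintegral_congr fun y => ?_
        by_cases hy : y ∈ Metric.ball z₀.2 (ρ₁ * u ^ (1 / (2 * α)))
        · rw [indicator_of_mem hy, indicator_of_mem hy]
        · rw [indicator_of_notMem hy, indicator_of_notMem hy, mul_zero]

/-- The slice at depth `u` is the constant `A u⁻¹` on a ball of volume comparable to `u^{n/(2α)}`,
so the norm reduces to a power integral in `u`. That integral is left as the bound `J`, because the
two regimes evaluate it over different ranges. -/
theorem mixedNorm_coneTest_le {n : ℕ} (hn : 1 ≤ n) {α p q : ℝ} (hα0 : 0 < α) (hp : 1 ≤ p)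
    (hq : 1 < q) {ρ : ℝ} (hρ : 0 < ρ) :
    ∃ c : ℝ, 0 < c ∧ ∀ (z₀ : ℝ × Space n) (a b A J : ℝ), 0 < a → a < b → 0 < A → 0 ≤ J →
      ∫⁻ u in Ioo a b, ENNReal.ofReal (u ^ (-q + n * q / (2 * α * p))) ≤ ENNReal.ofReal J →
      mixedNorm p q (coneTest α ρ A a b z₀) ≤ ENNReal.ofReal (c * A * J ^ (1 / q)) := by
  have hp0 : 0 < p := one_pos.trans_le hp
  have hq0 : 0 < q := one_pos.trans hq
  obtain ⟨ω, hω, hvol⟩ := exists_volume_ball hn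
  refine ⟨(ω * ρ ^ n) ^ (1 / p), by positivity, fun z₀ a b A J ha hab hA hJ hle => ?_⟩
  set D := ω * ρ ^ n with hD
  have hD0 : 0 < D := by positivity
  set g : ℝ → ℝ≥0∞ := (Ioo a b).indicator
    (fun u => ENNReal.ofReal (A ^ q * D ^ (q / p)) *
      ENNReal.ofReal (u ^ (-q + n * q / (2 * α * p)))) with hg
  have hgi : ∫⁻ s, g (z₀.1 - s) ≤ ENNReal.ofReal (A ^ q * D ^ (q / p) * J) := by
    rw [lintegral_sub_left_eq_self g, hg, lintegral_indicator measurableSet_Ioo,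
      lintegral_const_mul _ (by fun_prop), ENNReal.ofReal_mul (q := J) (by positivity)]
    exact mul_le_mul_right hle _
  have hptw : ∀ s, (∫⁻ y : Space n, coneTest α ρ A a b z₀ (s, y) ^ p) ^ (q / p) ≤ g (z₀.1 - s) := by
    intro s
    by_cases hs : z₀.1 - s ∈ Ioo a b
    swap
    · simp only [coneTest_of_notMem hs, ENNReal.zero_rpow_of_pos hp0, lintegral_zero]
      rw [ENNReal.zero_rpow_of_pos (by positivity)]
      exact zero_le
    simp only [hg, coneTest_of_mem hs]
    rw [indicator_of_mem hs]
    set u := z₀.1 - s with hu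
    have hu0 : 0 < u := ha.trans hs.1
    have e1 : ∀ y : Space n, ((Metric.ball z₀.2 (ρ * u ^ (1 / (2 * α)))).indicator
        (fun _ => ENNReal.ofReal (A * u⁻¹)) y) ^ p
        = (Metric.ball z₀.2 (ρ * u ^ (1 / (2 * α)))).indicator
          (fun _ => ENNReal.ofReal ((A * u⁻¹) ^ p)) y := by
      intro y
      by_cases hy : y ∈ Metric.ball z₀.2 (ρ * u ^ (1 / (2 * α)))
      · rw [indicator_of_mem hy, indicator_of_mem hy,
          ENNReal.ofReal_rpow_of_nonneg (by positivity) hp0.le]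
      · rw [indicator_of_notMem hy, indicator_of_notMem hy, ENNReal.zero_rpow_of_pos hp0]
    simp only [e1]
    rw [lintegral_indicator Metric.isOpen_ball.measurableSet, setLIntegral_const,
      hvol _ _ (by positivity), ← ENNReal.ofReal_mul (by positivity),
      ENNReal.ofReal_rpow_of_nonneg (by positivity) (by positivity),
      ← ENNReal.ofReal_mul (by positivity)]
    refine ENNReal.ofReal_le_ofReal (le_of_eq ?_)
    rw [mul_pow, rpow_mul_rpow_inv_pow hα0 hu0, Real.mul_rpow hA.le (by positivity),
      Real.inv_rpow hu0.le, ← Real.rpow_neg hu0.le]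
    have e2 : A ^ p * u ^ (-p) * (ω * (ρ ^ n * u ^ ((n : ℝ) / (2 * α))))
        = A ^ p * D * u ^ (-p + (n : ℝ) / (2 * α)) := by
      rw [Real.rpow_add hu0, hD]; ring
    rw [e2, Real.mul_rpow (by positivity) (by positivity), Real.mul_rpow (by positivity) hD0.le,
      ← Real.rpow_mul hA.le, ← Real.rpow_mul hu0.le]
    congr 2
    · congr 1; field_simp
    · field_simp
  unfold mixedNorm
  calc _ ≤ (∫⁻ s, g (z₀.1 - s)) ^ (1 / q) := by
        refine ENNReal.rpow_le_rpow ?_ (by positivity)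
        exact (setLIntegral_le_lintegral _ _).trans (lintegral_mono hptw)
    _ ≤ ENNReal.ofReal (A ^ q * D ^ (q / p) * J) ^ (1 / q) := by gcongr
    _ = _ := by
        rw [ENNReal.ofReal_rpow_of_nonneg (by positivity) (by positivity),
          Real.mul_rpow (by positivity) hJ, Real.mul_rpow (by positivity) (by positivity),
          ← Real.rpow_mul hA.le, ← Real.rpow_mul hD0.le, mul_one_div_cancel hq0.ne', Real.rpow_one]
        congr 2
        rw [mul_comm]; congr 2; field_simp

theorem compactCapacity_parabolicBall_le {n : ℕ} (hn : 1 ≤ n) {α p q : ℝ} (hα0 : 0 < α)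
    (hp : 1 ≤ p) (hq : 1 < q) :
    ∃ M c : ℝ, 2 ≤ M ∧ 0 < c ∧ ∀ (z₀ : ℝ × Space n) (r a b J : ℝ), 0 < r →
      M * r ^ (2 * α) ≤ a → a < b → b ≤ z₀.1 → 0 ≤ J →
      ∫⁻ u in Ioo a b, ENNReal.ofReal (u ^ (-q + n * q / (2 * α * p))) ≤ ENNReal.ofReal J →
      compactCapacity α p q (parabolicBall α z₀ r)
        ≤ ENNReal.ofReal ((c / Real.log (b / a) * J ^ (1 / q)) ^ min p q) := by
  obtain ⟨ρ, M, c₁, hρ, hM, hc₁, hpot⟩ := le_potential_coneTest (n := n) hn hα0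
  obtain ⟨c₂, hc₂, hnorm⟩ := mixedNorm_coneTest_le (n := n) hn hα0 hp hq hρ
  refine ⟨M, c₂ / c₁, hM, by positivity, fun z₀ r a b J hr hra hab hb hJ hle => ?_⟩
  have hr2 : 0 < r ^ (2 * α) := by positivity
  have ha : 0 < a := lt_of_lt_of_le (by positivity) hra
  have hlog : 0 < Real.log (b / a) := Real.log_pos ((one_lt_div ha).2 hab)
  -- The height at which the lower bound for the potential equals one.
  set A := 1 / (c₁ * Real.log (b / a)) with hA
  have hA0 : 0 < A := by positivity
  have hm : 0 ≤ min p q := le_min (by linarith) (by linarith)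
  refine (compactCapacity_le (measurable_coneTest α ρ A a b z₀) fun z hz => ?_).trans ?_
  · refine le_trans (le_of_eq ?_) (hpot z₀ r a b A hr hra hab hb hA0 z hz)
    have : c₁ * A * Real.log (b / a) = 1 := by rw [hA]; field_simp
    rw [this, ENNReal.ofReal_one]
  · refine (ENNReal.rpow_le_rpow (hnorm z₀ a b A J ha hab hA0 hJ hle) hm).trans (le_of_eq ?_)
    rw [ENNReal.ofReal_rpow_of_nonneg (by positivity) hm]
    congr 3
    rw [hA]; field_simp

/-! ### Capacity bounds for the power and logarithmic gauges -/

theorem exists_radius_rpow_lt {γ τ : ℝ} (hγ : 0 < γ) (hτ : 0 < τ) :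
    ∃ δ : ℝ, 0 < δ ∧ δ < 1 ∧ ∀ r : ℝ, 0 < r → r < δ → r ^ γ < τ := by
  refine ⟨min (1 / 2) (τ ^ (1 / γ)), by positivity,
    (min_le_left _ _).trans_lt (by norm_num), fun r hr hlt => ?_⟩
  calc r ^ γ < (τ ^ (1 / γ)) ^ γ := Real.rpow_lt_rpow hr.le (hlt.trans_le (min_le_right _ _)) hγ
    _ = τ := by rw [← Real.rpow_mul hτ.le, one_div_mul_cancel hγ.ne', Real.rpow_one]

theorem lt_center_of_mem {n : ℕ} {α τ r : ℝ} {z₀ : ℝ × Space n}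
    (h : ∃ z ∈ parabolicBall α z₀ r, τ ≤ z.1) : τ - r ^ (2 * α) < z₀.1 := by
  obtain ⟨z, ⟨_, hz, _⟩, hτ⟩ := h
  rw [abs_lt] at hz
  linarith [hz.2]

/-- A single layer `a < u < 2a` with `a = M r^{2α}` suffices: the logarithm is the constant `log 2`,
and the norm scales as the required power of `r`. -/
theorem exists_capacity_le_powGauge {n : ℕ} (hn : 1 ≤ n) {α p q : ℝ} (hα0 : 0 < α)
    (hp : 1 ≤ p) (hq : 1 < q) (hβ : 0 < betaExp n α p q) :
    ∃ c : ℝ≥0, c ≠ 0 ∧ ∀ τ : ℝ, 0 < τ → ∃ δ : ℝ, 0 < δ ∧ δ < 1 ∧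
      ∀ E : Set (ℝ × Space n), (∀ z ∈ E, τ ≤ z.1) →
        compactCapacity α p q E
          ≤ c * hausdorffCapacity α (powGauge (betaExp n α p q)) δ E ∧
        capacity α p q E ≤ c * hausdorffCapacity α (powGauge (betaExp n α p q)) δ E := by
  have hp0 : 0 < p := one_pos.trans_le hp
  have hq0 : 0 < q := one_pos.trans hq
  have hm : 0 < min p q := lt_min hp0 hq0
  obtain ⟨M, c, hM, hc, hcap⟩ := compactCapacity_parabolicBall_le (n := n) hn hα0 hp hq
  have hM0 : 0 < M := by linarith
  set κ := -q + n * q / (2 * α * p) with hκ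
  have hβκ : betaExp n α p q = min p q * (2 * α * (κ + 1) * (1 / q)) := by
    unfold betaExp; rw [hκ]; congr 1; field_simp; ring
  set c₂ := (c / Real.log 2 * (2 ^ |κ| * M ^ (κ + 1)) ^ (1 / q)) ^ min p q with hc₂
  have hlog2 : 0 < Real.log 2 := Real.log_pos one_lt_two
  have hc₂0 : 0 < c₂ := by positivity
  refine ⟨c₂.toNNReal, (Real.toNNReal_pos.2 hc₂0).ne', fun τ hτ => ?_⟩
  -- The centre has time coordinate above `τ - r^{2α}`, so `(2M+1) r^{2α} < τ` leaves room for the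
  -- layer down to depth `2a = 2M r^{2α}`.
  obtain ⟨δ, hδ0, hδ1, hδ⟩ := exists_radius_rpow_lt (γ := 2 * α) (τ := τ / (2 * M + 1))
    (by positivity) (by positivity)
  refine ⟨δ, hδ0, hδ1, fun E hE => capacity_le_hausdorffCapacity hp hq
    (Real.toNNReal_pos.2 hc₂0).ne' (fun z₀ r hz₀ hr hrδ hmeet => ?_) hE⟩
  have hr2 : 0 < r ^ (2 * α) := by positivity
  set a := M * r ^ (2 * α) with ha
  have ha0 : 0 < a := by positivity
  have hb : 2 * a ≤ z₀.1 := by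
    have h1 := lt_center_of_mem hmeet
    have h2 := hδ r hr hrδ
    rw [lt_div_iff₀ (by positivity)] at h2
    rw [ha]; linarith
  have hint : ∫⁻ u in Ioo a (2 * a), ENNReal.ofReal (u ^ κ)
      ≤ ENNReal.ofReal (2 ^ |κ| * a ^ (κ + 1)) := by
    have h1 : ∀ u ∈ Ioo a (2 * a), ENNReal.ofReal (u ^ κ) ≤ ENNReal.ofReal (2 ^ |κ| * a ^ κ) := by
      intro u hu
      refine ENNReal.ofReal_le_ofReal ?_
      have hu0 : 0 < u := ha0.trans hu.1
      have e : u ^ κ = (u / a) ^ κ * a ^ κ := by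
        rw [← Real.mul_rpow (by positivity) ha0.le, div_mul_cancel₀ _ ha0.ne']
      rw [e]
      refine mul_le_mul_of_nonneg_right ?_ (by positivity)
      have h1 : 1 ≤ u / a := (one_le_div ha0).2 hu.1.le
      have h2 : u / a ≤ 2 := (div_le_iff₀ ha0).2 hu.2.le
      calc (u / a) ^ κ ≤ (u / a) ^ |κ| := Real.rpow_le_rpow_of_exponent_le h1 (le_abs_self _)
        _ ≤ _ := Real.rpow_le_rpow (by positivity) h2 (abs_nonneg _)
    refine (setLIntegral_mono' measurableSet_Ioo h1).trans (le_of_eq ?_)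
    rw [setLIntegral_const, Real.volume_Ioo, ← ENNReal.ofReal_mul (by positivity)]
    congr 1
    rw [Real.rpow_add ha0 κ 1, Real.rpow_one]; ring
  refine (hcap z₀ r a (2 * a) (2 ^ |κ| * a ^ (κ + 1)) hr le_rfl (by linarith) hb (by positivity)
    hint).trans (le_of_eq ?_)
  have hc2e : ((c₂.toNNReal : ℝ≥0) : ℝ≥0∞) = ENNReal.ofReal c₂ := rfl
  rw [hc2e, powGauge, ENNReal.ofReal_rpow_of_nonneg hr.le hβ.le, ← ENNReal.ofReal_mul hc₂0.le]
  congr 1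
  rw [mul_div_cancel_right₀ _ ha0.ne', hβκ, mul_comm (min p q) (2 * α * (κ + 1) * (1 / q)),
    Real.rpow_mul hr.le _ (min p q), hc₂, ← Real.mul_rpow (by positivity) (by positivity)]
  congr 1
  rw [ha, Real.mul_rpow hM0.le hr2.le, ← mul_assoc, Real.mul_rpow (by positivity) (by positivity),
    ← Real.rpow_mul hr.le, ← Real.rpow_mul hr.le]
  ring

/-- In the critical case the norm integrand is also `u⁻¹`, so with `L = log(b/a)` the bound is a
constant times `(L^{-1+1/q})^{p∧q}`, and a deep cone is better than one layer. The depth `b = τ/2`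
makes `L` at least `α log(1/r)`. -/
theorem exists_capacity_le_logGauge {n : ℕ} (hn : 1 ≤ n) {α p q : ℝ} (hα0 : 0 < α)
    (hp : 1 ≤ p) (hq : 1 < q) (hβ : n / p + 2 * α / q - 2 * α = 0) :
    ∃ c : ℝ≥0, ∀ τ : ℝ, 0 < τ → ∃ δ : ℝ, 0 < δ ∧ δ < 1 ∧
      ∀ E : Set (ℝ × Space n), (∀ z ∈ E, τ ≤ z.1) →
        compactCapacity α p q E
          ≤ c * hausdorffCapacity α (logGauge (min p q * (1 - 1 / q))) δ E := by
  have hp0 : 0 < p := one_pos.trans_le hp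
  have hq0 : 0 < q := one_pos.trans hq
  have hm : 0 < min p q := lt_min hp0 hq0
  obtain ⟨M, c, hM, hc, hcap⟩ := compactCapacity_parabolicBall_le (n := n) hn hα0 hp hq
  have hM0 : 0 < M := by linarith
  have hκ : -q + n * q / (2 * α * p) = -1 := by
    have : (n : ℝ) / p = 2 * α - 2 * α / q := by linarith
    have h2 : n * q / (2 * α * p) = (n : ℝ) / p * q / (2 * α) := by field_simp
    rw [h2, this]; field_simp; ring
  rw [hκ] at hcap
  have hγ : 0 < 1 - 1 / q := by
    rw [sub_pos, div_lt_one hq0]; exact hq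
  set γ := 1 - 1 / q with hγd
  set c₂ := (c * α ^ (-γ)) ^ min p q with hc₂
  have hc₂0 : 0 < c₂ := by positivity
  refine ⟨c₂.toNNReal, fun τ hτ => ?_⟩
  -- Smallness of `r^α`, rather than `r^{2α}`, is imposed. One factor `r^α` absorbs both `M` and
  -- `τ`, and the other yields `L ≥ α log(1/r)` with a constant independent of `τ`.
  obtain ⟨δ, hδ0, hδ1, hδ⟩ := exists_radius_rpow_lt (γ := α) (τ := τ / (2 * M))
    hα0 (by positivity)
  refine ⟨δ, hδ0, hδ1, fun E hE => (capacity_le_hausdorffCapacity hp hq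
    (Real.toNNReal_pos.2 hc₂0).ne' (fun z₀ r hz₀ hr hrδ hmeet => ?_) hE).1⟩
  have hr1 : r < 1 := hrδ.trans hδ1
  have hrα0 : 0 < r ^ α := by positivity
  have hrα1 : r ^ α < 1 := Real.rpow_lt_one hr.le hr1 hα0
  have hr2 : r ^ (2 * α) = r ^ α * r ^ α := by rw [← Real.rpow_add hr]; congr 1; ring
  have hsm : r ^ α < τ / (2 * M) := hδ r hr hrδ
  have hsm' : M * r ^ α < τ / 2 := by
    rw [lt_div_iff₀ (by positivity)] at hsm; linarith
  have hab0 : 0 < M * r ^ (2 * α) := by positivity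
  have hab : M * r ^ (2 * α) < τ / 2 := by
    rw [hr2]
    calc M * (r ^ α * r ^ α) ≤ M * (r ^ α * 1) := by gcongr
      _ < τ / 2 := by rw [mul_one]; exact hsm'
  have hb : τ / 2 ≤ z₀.1 := by
    have h1 := lt_center_of_mem hmeet
    have : r ^ (2 * α) ≤ M * r ^ (2 * α) := le_mul_of_one_le_left (by positivity) (by linarith)
    linarith
  set a := M * r ^ (2 * α) with ha
  have hint := lintegral_Ioo_inv hab0 hab
  have hint' : ∫⁻ u in Ioo a (τ / 2), ENNReal.ofReal (u ^ (-1 : ℝ))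
      ≤ ENNReal.ofReal (Real.log (τ / 2 / a)) := by
    simp only [Real.rpow_neg_one]; exact hint.le
  have hL0 : 0 < Real.log (τ / 2 / a) := Real.log_pos ((one_lt_div hab0).2 hab)
  refine (hcap z₀ r a (τ / 2) _ hr le_rfl hab hb hL0.le hint').trans ?_
  have hlr : 0 < Real.log (1 / r) := Real.log_pos ((one_lt_div hr).2 hr1)
  have hLge : α * Real.log (1 / r) ≤ Real.log (τ / 2 / a) := by
    rw [← Real.log_rpow (by positivity)]
    refine Real.log_le_log (by positivity) ?_
    rw [le_div_iff₀ hab0, one_div, Real.inv_rpow hr.le, ha, hr2]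
    calc (r ^ α)⁻¹ * (M * (r ^ α * r ^ α)) = M * r ^ α := by field_simp
      _ ≤ τ / 2 := hsm'.le
  have hc2e : ((c₂.toNNReal : ℝ≥0) : ℝ≥0∞) = ENNReal.ofReal c₂ := rfl
  rw [hc2e, logGauge, if_neg (not_le.2 hr), max_eq_right hlr.le,
    ENNReal.ofReal_rpow_of_pos hlr, ← ENNReal.ofReal_mul hc₂0.le]
  refine ENNReal.ofReal_le_ofReal ?_
  have e1 : c / Real.log (τ / 2 / a) * Real.log (τ / 2 / a) ^ (1 / q)
      = c * Real.log (τ / 2 / a) ^ (-γ) := by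
    rw [hγd, neg_sub, Real.rpow_sub hL0, Real.rpow_one]; ring
  rw [e1, show -(min p q * γ) = (-γ) * min p q by ring, Real.rpow_mul hlr.le, hc₂,
    ← Real.mul_rpow (by positivity) (by positivity)]
  refine Real.rpow_le_rpow (by positivity) ?_ hm.le
  rw [mul_assoc, ← Real.mul_rpow hα0.le hlr.le]
  refine mul_le_mul_of_nonneg_left ?_ hc.le
  exact Real.rpow_le_rpow_of_nonpos (by positivity) hLge (by linarith)

/-! ### Lower bound for the capacity of product sets -/

theorem lintegral_le_rpow_mul_measure {X : Type*} [MeasurableSpace X] (ν : Measure X) {p : ℝ}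
    (hp : 1 ≤ p) {f : X → ℝ≥0∞} (hf : AEMeasurable f ν) :
    ∫⁻ x, f x ∂ν ≤ (∫⁻ x, f x ^ p ∂ν) ^ (1 / p) * ν univ ^ (1 - 1 / p) := by
  rcases hp.eq_or_lt with rfl | hp
  · simp
  · have h := ENNReal.lintegral_mul_le_Lp_mul_Lq ν (Real.HolderConjugate.conjExponent hp) hf
      (aemeasurable_const (b := (1 : ℝ≥0∞)))
    simp only [Pi.mul_apply, mul_one, ENNReal.one_rpow, lintegral_one] at h
    have hp0 : 0 < p := one_pos.trans hp
    have e : 1 / p.conjExponent = 1 - 1 / p := by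
      unfold Real.conjExponent
      have : p - 1 ≠ 0 := by linarith
      field_simp
    rwa [e] at h

/-- The integral over `B` of the convolution with a kernel `k ≤ κ` of total mass at most one. -/
theorem setLIntegral_conv_le {n : ℕ} {k : Space n → ℝ≥0∞} (hk : Measurable k) (hk1 : ∫⁻ x, k x ≤ 1)
    {κ : ℝ≥0∞} (hκ : ∀ x, k x ≤ κ) {p θ : ℝ} (hp : 1 ≤ p) (hθ0 : 0 ≤ θ) (hθ : θ ≤ 1 / p)
    {f : Space n → ℝ≥0∞} (hf : Measurable f) (B : Set (Space n)) :
    ∫⁻ x in B, ∫⁻ y, k (x - y) * f y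
      ≤ (κ * volume B) ^ θ * volume B ^ (1 - 1 / p) * (∫⁻ y, f y ^ p) ^ (1 / p) := by
  have hp0 : 0 < p := one_pos.trans_le hp
  have hp1 : 0 ≤ 1 - 1 / p := by
    rw [sub_nonneg, div_le_one hp0]; exact hp
  -- After Fubini the integral is `∫ H f`. The weight is bounded both by `1` and by `κ |B|`, and
  -- interpolating gives `H^{1/p} ≤ (κ |B|)^θ`. Hölder's inequality is applied for the measure `H
  -- dy`, whose mass is at most `|B|`.
  set H : Space n → ℝ≥0∞ := fun y => ∫⁻ x in B, k (x - y) with hH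
  have hkm : Measurable (fun z : Space n × Space n => k (z.1 - z.2)) := by fun_prop
  have hHm : Measurable H := by
    have : Measurable (fun z : Space n × Space n => k (z.2 - z.1)) := by fun_prop
    exact this.lintegral_prod_right'
  have hH1 : ∀ y, H y ≤ 1 := fun y => by
    refine (setLIntegral_le_lintegral _ _).trans ?_
    rw [lintegral_sub_right_eq_self k y]; exact hk1
  have hHκ : ∀ y, H y ≤ κ * volume B := fun y => by
    refine (lintegral_mono fun x => hκ (x - y)).trans ?_
    rw [setLIntegral_const]
  have hHp : ∀ y, H y ^ (1 / p) ≤ (κ * volume B) ^ θ := fun y => by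
    calc H y ^ (1 / p) = H y ^ θ * H y ^ (1 / p - θ) := by
          rw [← ENNReal.rpow_add_of_nonneg _ _ hθ0 (by linarith)]; congr 1; ring
      _ ≤ (κ * volume B) ^ θ * 1 ^ (1 / p - θ) := by
          refine mul_le_mul' (ENNReal.rpow_le_rpow (hHκ y) hθ0)
            (ENNReal.rpow_le_rpow (hH1 y) (by linarith))
      _ = _ := by rw [ENNReal.one_rpow, mul_one]
  have hHint : ∫⁻ y, H y ≤ volume B := by
    simp only [hH]
    rw [lintegral_lintegral_swap (by
      have : Measurable (fun z : Space n × Space n => k (z.2 - z.1)) := by fun_prop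
      exact this.aemeasurable)]
    calc _ ≤ ∫⁻ x in B, (1 : ℝ≥0∞) := lintegral_mono fun x => by
          rw [lintegral_sub_left_eq_self k x]; exact hk1
      _ = volume B := by rw [setLIntegral_const, one_mul]
  have hswap : ∫⁻ x in B, ∫⁻ y, k (x - y) * f y = ∫⁻ y, H y * f y := by
    rw [lintegral_lintegral_swap (by
      have : Measurable (fun z : Space n × Space n => k (z.1 - z.2) * f z.2) := by fun_prop
      exact this.aemeasurable)]
    refine lintegral_congr fun y => ?_
    rw [lintegral_mul_const _ (by fun_prop)]
  have hw := lintegral_le_rpow_mul_measure ((volume : Measure (Space n)).withDensity H) hp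
    hf.aemeasurable
  rw [lintegral_withDensity_eq_lintegral_mul _ hHm hf,
    lintegral_withDensity_eq_lintegral_mul _ hHm (hf.pow_const p),
    withDensity_apply _ MeasurableSet.univ, setLIntegral_univ] at hw
  simp only [Pi.mul_apply] at hw
  rw [hswap]
  refine hw.trans ?_
  calc _ ≤ (∫⁻ y, ((κ * volume B) ^ θ) ^ p * f y ^ p) ^ (1 / p) * volume B ^ (1 - 1 / p) := by
        refine mul_le_mul' (ENNReal.rpow_le_rpow (lintegral_mono fun y => ?_) (by positivity))
          (ENNReal.rpow_le_rpow hHint hp1)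
        refine mul_le_mul_left ?_ _
        calc H y = (H y ^ (1 / p)) ^ p := by
              rw [← ENNReal.rpow_mul, one_div_mul_cancel hp0.ne', ENNReal.rpow_one]
          _ ≤ _ := ENNReal.rpow_le_rpow (hHp y) hp0.le
    _ = _ := by
        rw [lintegral_const_mul _ (hf.pow_const p), ENNReal.mul_rpow_of_nonneg _ _ (by positivity),
          ← ENNReal.rpow_mul, mul_one_div_cancel hp0.ne', ENNReal.rpow_one]
        ring

theorem lintegral_Ioc_rpow {a Δ : ℝ} (ha : 0 < a) (hΔ : 0 < Δ) :
    ∫⁻ u in Ioc 0 Δ, ENNReal.ofReal (u ^ (a - 1)) = ENNReal.ofReal (Δ ^ a / a) := by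
  have hi : IntervalIntegrable (fun u : ℝ => u ^ (a - 1)) volume 0 Δ :=
    intervalIntegral.intervalIntegrable_rpow' (by linarith)
  have h := integral_rpow (a := 0) (b := Δ) (r := a - 1) (Or.inl (by linarith))
  rw [sub_add_cancel, Real.zero_rpow ha.ne', sub_zero, intervalIntegral.integral_of_le hΔ.le] at h
  rw [← h, ofReal_integral_eq_lintegral_ofReal hi.1]
  exact (ae_restrict_mem measurableSet_Ioc).mono fun u hu => by
    have : 0 < u := hu.1
    exact Real.rpow_nonneg this.le _

theorem lintegral_Ioi_rpow {b Δ : ℝ} (hb : b < -1) (hΔ : 0 < Δ) :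
    ∫⁻ u in Ioi Δ, ENNReal.ofReal (u ^ b) = ENNReal.ofReal (Δ ^ (b + 1) / (-(b + 1))) := by
  rw [← ofReal_integral_eq_lintegral_ofReal (integrableOn_Ioi_rpow_of_lt hb hΔ),
    integral_Ioi_rpow_of_lt hb hΔ, neg_div, div_neg]
  exact (ae_restrict_mem measurableSet_Ioi).mono fun u hu => by
    have : 0 < u := hΔ.trans hu
    exact Real.rpow_nonneg this.le _

/-- Restricted weak-type form of the Hardy-Littlewood-Sobolev inequality on the line. -/
theorem exists_fractional_integral_le {a q : ℝ} (ha : 0 < a) (hq : 1 < q) (haq : a < 1 / q) :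
    ∃ c : ℝ, 0 < c ∧ ∀ (G : ℝ → ℝ≥0∞), Measurable G → ∀ A : Set ℝ, volume A ≠ 0 → volume A ≠ ∞ →
      ∫⁻ t in A, ∫⁻ u in Ioi (0 : ℝ), ENNReal.ofReal (u ^ (a - 1)) * G (t - u)
        ≤ ENNReal.ofReal c * volume A ^ (1 + a - 1 / q) * (∫⁻ s, G s ^ q) ^ (1 / q) := by
  have hq0 : 0 < q := one_pos.trans hq
  set q' := q.conjExponent with hq'
  have hconj : q.HolderConjugate q' := Real.HolderConjugate.conjExponent hq
  have hq'0 : 0 < q' := hconj.symm.pos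
  have hinv : 1 / q' = 1 - 1 / q := by
    have := hconj.inv_add_inv_eq_one
    rw [one_div, one_div]; linarith
  set b := (a - 1) * q' with hb
  -- The condition `a < 1/q` is exactly what makes `u^{a-1}` lie in `L^{q'}` at infinity.
  have hb1 : b < -1 := by
    have h1 : a - 1 < -(1 / q') := by rw [hinv]; linarith
    calc b < -(1 / q') * q' := mul_lt_mul_of_pos_right h1 hq'0
      _ = -1 := by field_simp
  set c₂ := (1 / (-(b + 1))) ^ (1 / q') with hc₂
  have hb2 : 0 < -(b + 1) := by linarith
  have hc₂0 : 0 < c₂ := by positivity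
  refine ⟨1 / a + c₂, by positivity, fun G hG A hA0 hAt => ?_⟩
  set N := (∫⁻ s, G s ^ q) ^ (1 / q) with hN
  -- The cut at `Δ = |A|` balances the two parts. For `u ≤ Δ`, Hölder's inequality in `t` over `A`
  -- gives `Δ^a |A|^{1-1/q}`. For `u > Δ`, Hölder's inequality in `u` gives `Δ^{a-1/q}` for each
  -- `t`, and integrating over `A` gives one more factor `|A|`.
  obtain ⟨Δ, hΔ⟩ : ∃ Δ : ℝ, Δ = (volume A).toReal := ⟨_, rfl⟩
  have hΔ0 : 0 < Δ := hΔ ▸ ENNReal.toReal_pos hA0 hAt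
  have hvA : volume A = ENNReal.ofReal Δ := by rw [hΔ, ENNReal.ofReal_toReal hAt]
  have hshift : ∀ t, ∫⁻ u, G (t - u) ^ q = ∫⁻ s, G s ^ q := fun t =>
    lintegral_sub_left_eq_self (fun s => G s ^ q) t
  have hshift' : ∀ u, ∫⁻ t, G (t - u) ^ q = ∫⁻ s, G s ^ q := fun u =>
    lintegral_sub_right_eq_self (fun s => G s ^ q) u
  have hnear : ∫⁻ t in A, ∫⁻ u in Ioc 0 Δ, ENNReal.ofReal (u ^ (a - 1)) * G (t - u)
      ≤ ENNReal.ofReal (1 / a) * volume A ^ (1 + a - 1 / q) * N := by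
    have hm : Measurable (fun z : ℝ × ℝ => ENNReal.ofReal (z.2 ^ (a - 1)) * G (z.1 - z.2)) := by
      fun_prop
    rw [lintegral_lintegral_swap hm.aemeasurable]
    calc _ ≤ ∫⁻ u in Ioc 0 Δ, ENNReal.ofReal (u ^ (a - 1)) * (N * volume A ^ (1 - 1 / q)) := by
          refine lintegral_mono fun u => ?_
          rw [lintegral_const_mul _ (by fun_prop)]
          refine mul_le_mul_right ?_ _
          refine (lintegral_le_rpow_mul_measure (volume.restrict A) hq.le
            (by fun_prop : Measurable fun t => G (t - u)).aemeasurable).trans ?_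
          rw [Measure.restrict_apply_univ]
          refine mul_le_mul_left (ENNReal.rpow_le_rpow ?_ (by positivity)) _
          exact (setLIntegral_le_lintegral _ _).trans (hshift' u).le
      _ = _ := by
          rw [lintegral_mul_const _ (by fun_prop), lintegral_Ioc_rpow ha hΔ0, hvA,
            ENNReal.ofReal_rpow_of_pos hΔ0, ENNReal.ofReal_rpow_of_pos hΔ0,
            mul_comm N, ← mul_assoc, ← ENNReal.ofReal_mul (by positivity),
            ← ENNReal.ofReal_mul (by positivity)]
          congr 2
          rw [show 1 + a - 1 / q = a + (1 - 1 / q) by ring, Real.rpow_add hΔ0]; ring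
  have hfar : ∫⁻ t in A, ∫⁻ u in Ioi Δ, ENNReal.ofReal (u ^ (a - 1)) * G (t - u)
      ≤ ENNReal.ofReal c₂ * volume A ^ (1 + a - 1 / q) * N := by
    have hpt : ∀ t, ∫⁻ u in Ioi Δ, ENNReal.ofReal (u ^ (a - 1)) * G (t - u)
        ≤ ENNReal.ofReal (c₂ * Δ ^ (a - 1 / q)) * N := by
      intro t
      have h := ENNReal.lintegral_mul_le_Lp_mul_Lq (volume.restrict (Ioi Δ)) hconj.symm
        (f := fun u => ENNReal.ofReal (u ^ (a - 1))) (g := fun u => G (t - u))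
        (by fun_prop : Measurable _).aemeasurable (by fun_prop : Measurable _).aemeasurable
      simp only [Pi.mul_apply] at h
      refine h.trans (mul_le_mul' (le_of_eq ?_) (ENNReal.rpow_le_rpow
        ((setLIntegral_le_lintegral _ _).trans (hshift t).le) (by positivity)))
      have e : ∫⁻ u in Ioi Δ, ENNReal.ofReal (u ^ (a - 1)) ^ q'
          = ∫⁻ u in Ioi Δ, ENNReal.ofReal (u ^ b) := by
        refine setLIntegral_congr_fun measurableSet_Ioi fun u hu => ?_
        have hu0 : 0 < u := hΔ0.trans hu
        rw [ENNReal.ofReal_rpow_of_pos (by positivity), ← Real.rpow_mul hu0.le]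
      rw [e, lintegral_Ioi_rpow hb1 hΔ0, ENNReal.ofReal_rpow_of_pos (by positivity),
        div_eq_mul_one_div, Real.mul_rpow (by positivity) (by positivity), ← hc₂,
        ← Real.rpow_mul hΔ0.le, mul_comm]
      congr 3
      rw [hb, add_mul, mul_assoc, mul_one_div_cancel hq'0.ne', hinv]; ring
    refine (lintegral_mono hpt).trans (le_of_eq ?_)
    rw [setLIntegral_const, hvA, ENNReal.ofReal_rpow_of_pos hΔ0, mul_right_comm,
      ← ENNReal.ofReal_mul (by positivity), ← ENNReal.ofReal_mul (by positivity)]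
    congr 2
    rw [show 1 + a - 1 / q = (a - 1 / q) + 1 by ring, Real.rpow_add hΔ0 _ 1, Real.rpow_one]; ring
  have hsplit : ∀ t, ∫⁻ u in Ioi (0 : ℝ), ENNReal.ofReal (u ^ (a - 1)) * G (t - u)
      = (∫⁻ u in Ioc 0 Δ, ENNReal.ofReal (u ^ (a - 1)) * G (t - u))
        + ∫⁻ u in Ioi Δ, ENNReal.ofReal (u ^ (a - 1)) * G (t - u) := fun t => by
    rw [← lintegral_union measurableSet_Ioi (Ioc_disjoint_Ioi le_rfl),
      Ioc_union_Ioi_eq_Ioi hΔ0.le]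
  simp only [hsplit]
  rw [lintegral_add_left (by
    have hm : Measurable (fun z : ℝ × ℝ => ENNReal.ofReal (z.2 ^ (a - 1)) * G (z.1 - z.2)) := by
      fun_prop
    exact hm.lintegral_prod_right'), ENNReal.ofReal_add (by positivity) hc₂0.le, add_mul, add_mul]
  exact add_le_add hnear hfar

/-- The kernel at time lag `u` is at most a multiple of `u^{-n/(2α)}`. In the convolution bound its
power `θ` is `u^{a-1}`, so space drops out and a fractional integral of order `a` of the slice norms
remains. -/
theorem setLIntegral_potential_le {n : ℕ} (hn : 1 ≤ n) {α p a θ : ℝ} (hα0 : 0 < α)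
    (hα1 : α < 1) (hp : 1 ≤ p) (hθ0 : 0 ≤ θ) (hθ : θ ≤ 1 / p) (haθ : n / (2 * α) * θ = 1 - a)
    {F : ℝ × Space n → ℝ≥0∞} (hF : Measurable F) (B : Set (Space n)) (t : ℝ) :
    ∫⁻ x in B, potential α F (t, x)
      ≤ ENNReal.ofReal (kernel α 1 (0 : Space n) ^ θ) * volume B ^ (θ + (1 - 1 / p)) *
        ∫⁻ u in Ioi (0 : ℝ), ENNReal.ofReal (u ^ (a - 1)) *
          (Ioi (0 : ℝ)).indicator (fun s => (∫⁻ y : Space n, F (s, y) ^ p) ^ (1 / p)) (t - u) := by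
  have hp1 : 0 ≤ 1 - 1 / p := by
    rw [sub_nonneg, div_le_one (by linarith)]; exact hp
  set k0 := kernel α 1 (0 : Space n) with hk0
  have hk0p : 0 < k0 := kernel_zero_pos hn hα0 one_pos
  set g : ℝ → ℝ≥0∞ := fun s => (∫⁻ y : Space n, F (s, y) ^ p) ^ (1 / p) with hg
  have hgm : Measurable g := (measurable_lintegral_rpow hF p).pow_const _
  have hΨ : Measurable (fun z : Space n × ℝ =>
      ∫⁻ y : Space n, ENNReal.ofReal (kernel α (t - z.2) (z.1 - y)) * F (z.2, y)) := by
    have h1 : Measurable (fun w : (Space n × ℝ) × Space n => kernel α (t - w.1.2) (w.1.1 - w.2)) :=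
      measurable_kernel_comp α (by fun_prop) (by fun_prop)
    have h2 : Measurable (fun w : (Space n × ℝ) × Space n =>
        ENNReal.ofReal (kernel α (t - w.1.2) (w.1.1 - w.2)) * F (w.1.2, w.2)) := by fun_prop
    exact h2.lintegral_prod_right'
  unfold potential
  simp only
  rw [lintegral_lintegral_swap hΨ.aemeasurable]
  calc _ ≤ ∫⁻ s in Ioo 0 t, ENNReal.ofReal (k0 ^ θ) * volume B ^ (θ + (1 - 1 / p)) *
        (ENNReal.ofReal ((t - s) ^ (a - 1)) * g s) := by
        refine setLIntegral_mono' measurableSet_Ioo fun s hs => ?_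
        have hts : 0 < t - s := by linarith [hs.2]
        have hkm : Measurable (fun x : Space n => ENNReal.ofReal (kernel α (t - s) x)) :=
          (measurable_kernel_right α (t - s)).ennreal_ofReal
        refine (setLIntegral_conv_le hkm (lintegral_kernel_le_one hn hα0 hα1 hts)
          (κ := ENNReal.ofReal (k0 * (t - s) ^ (-(n : ℝ) / (2 * α))))
          (fun x => ENNReal.ofReal_le_ofReal (kernel_le_rpow hn hα0 hα1 hts x)) hp hθ0 hθ
          (hF.comp measurable_prodMk_left) B).trans (le_of_eq ?_)
        have e1 : (t - s) ^ (a - 1) = ((t - s) ^ (-(n : ℝ) / (2 * α))) ^ θ := by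
          rw [← Real.rpow_mul hts.le]; congr 1; rw [neg_div, neg_mul, haθ]; ring
        rw [ENNReal.mul_rpow_of_nonneg _ _ hθ0, ENNReal.rpow_add_of_nonneg _ _ hθ0 hp1,
          ENNReal.ofReal_rpow_of_nonneg (by positivity) hθ0,
          Real.mul_rpow hk0p.le (by positivity), ← e1, ENNReal.ofReal_mul (by positivity)]
        simp only [hg, Function.comp_apply]
        ring
    _ = ENNReal.ofReal (k0 ^ θ) * volume B ^ (θ + (1 - 1 / p)) *
        ∫⁻ s in Ioo 0 t, ENNReal.ofReal ((t - s) ^ (a - 1)) * g s :=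
        lintegral_const_mul _ (by fun_prop)
    _ ≤ _ := by
        refine mul_le_mul_right ?_ _
        set H : ℝ → ℝ≥0∞ := (Ioi (0 : ℝ)).indicator fun u =>
          ENNReal.ofReal (u ^ (a - 1)) * (Ioi (0 : ℝ)).indicator g (t - u) with hH
        rw [← lintegral_indicator measurableSet_Ioi, ← hH, ← lintegral_sub_left_eq_self H t,
          ← lintegral_indicator measurableSet_Ioo]
        refine lintegral_mono fun s => ?_
        by_cases hs : s ∈ Ioo 0 t
        · rw [indicator_of_mem hs]
          simp only [hH]
          have h1 : t - s ∈ Ioi (0 : ℝ) := by simpa using hs.2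
          have h2 : t - (t - s) ∈ Ioi (0 : ℝ) := by simpa using hs.1
          rw [indicator_of_mem h1, indicator_of_mem h2, sub_sub_cancel]
        · rw [indicator_of_notMem hs]; exact zero_le

/-- With `a = 1/q - 1/q'` and `θ = 1/p - 1/p'`, the scaling relation between the exponents says that
`a + nθ/(2α) = 1`, which links the spatial interpolation to the order of the fractional integral in
time. -/
theorem exists_volume_mul_le_mixedNorm {n : ℕ} (hn : 1 ≤ n) {α p q p' q' : ℝ} (hα0 : 0 < α)
    (hα1 : α < 1) (hp : 1 ≤ p) (hq : 1 < q) (hpp : p < p') (hqq : q < q')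
    (hpq : (1 / q - 1 / q') + n / (2 * α) * (1 / p - 1 / p') = 1) :
    ∃ c : ℝ, 0 < c ∧ ∀ F : ℝ × Space n → ℝ≥0∞, Measurable F → ∀ (A : Set ℝ) (B : Set (Space n)),
      MeasurableSet A → MeasurableSet B → volume A ≠ ∞ → volume B ≠ ∞ →
      (∀ z ∈ A ×ˢ B, 1 ≤ potential α F z) →
      volume A ^ (1 / q') * volume B ^ (1 / p') ≤ ENNReal.ofReal c * mixedNorm p q F := by
  have hp0 : 0 < p := one_pos.trans_le hp
  have hq0 : 0 < q := one_pos.trans hq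
  have hp'0 : 0 < p' := hp0.trans hpp
  have hq'0 : 0 < q' := hq0.trans hqq
  set a := 1 / q - 1 / q' with ha
  set θ := 1 / p - 1 / p' with hθ
  have hθ0 : 0 ≤ θ := sub_nonneg.2 (one_div_le_one_div_of_le hp0 hpp.le)
  have ha0 : 0 < a := sub_pos.2 (one_div_lt_one_div_of_lt hq0 hqq)
  have hq'1 : 0 < 1 / q' := by positivity
  have hp'1 : 0 < 1 / p' := by positivity
  obtain ⟨c, hc, hHLS⟩ := exists_fractional_integral_le ha0 hq (by rw [ha]; linarith)
  have hk0p : 0 < kernel α 1 (0 : Space n) := kernel_zero_pos hn hα0 one_pos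
  refine ⟨kernel α 1 (0 : Space n) ^ θ * c, by positivity,
    fun F hF A B hA hB hAt hBt h1 => ?_⟩
  by_cases hA0 : volume A = 0
  · rw [hA0, ENNReal.zero_rpow_of_pos hq'1, zero_mul]; exact zero_le
  by_cases hB0 : volume B = 0
  · rw [hB0, ENNReal.zero_rpow_of_pos hp'1, mul_zero]; exact zero_le
  set G : ℝ → ℝ≥0∞ := (Ioi (0 : ℝ)).indicator
    (fun s => (∫⁻ y : Space n, F (s, y) ^ p) ^ (1 / p)) with hG
  have hGm : Measurable G := ((measurable_lintegral_rpow hF p).pow_const _).indicator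
    measurableSet_Ioi
  have hGN : (∫⁻ s, G s ^ q) ^ (1 / q) = mixedNorm p q F := by
    unfold mixedNorm
    rw [← lintegral_indicator measurableSet_Ioi]
    congr 2; ext s
    by_cases hs : s ∈ Ioi (0 : ℝ)
    · simp only [hG]
      rw [indicator_of_mem hs, indicator_of_mem hs, ← ENNReal.rpow_mul]
      congr 1; field_simp
    · simp only [hG]
      rw [indicator_of_notMem hs, indicator_of_notMem hs, ENNReal.zero_rpow_of_pos hq0]
  set D := ENNReal.ofReal (kernel α 1 (0 : Space n) ^ θ) with hD
  have hBexp : 0 ≤ θ + (1 - 1 / p) := by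
    have : 1 / p ≤ 1 := (div_le_one hp0).2 hp
    linarith
  have hslice : ∀ t ∈ A, volume B ≤ D * volume B ^ (θ + (1 - 1 / p)) *
      ∫⁻ u in Ioi (0 : ℝ), ENNReal.ofReal (u ^ (a - 1)) * G (t - u) := by
    intro t ht
    calc volume B = ∫⁻ x in B, (1 : ℝ≥0∞) := by rw [setLIntegral_const, one_mul]
      _ ≤ ∫⁻ x in B, potential α F (t, x) :=
        setLIntegral_mono' hB fun x hx => h1 (t, x) ⟨ht, hx⟩
      _ ≤ _ := setLIntegral_potential_le hn hα0 hα1 hp hθ0 (by rw [hθ]; linarith)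
        (by linarith) hF B t
  have hm : Measurable (fun t => ∫⁻ u in Ioi (0 : ℝ), ENNReal.ofReal (u ^ (a - 1)) * G (t - u)) := by
    have hm : Measurable (fun z : ℝ × ℝ => ENNReal.ofReal (z.2 ^ (a - 1)) * G (z.1 - z.2)) := by
      fun_prop
    exact hm.lintegral_prod_right'
  have htot : volume B * volume A ≤ D * volume B ^ (θ + (1 - 1 / p)) *
      (ENNReal.ofReal c * volume A ^ (1 + a - 1 / q) * mixedNorm p q F) := by
    calc volume B * volume A = ∫⁻ t in A, volume B := by rw [setLIntegral_const]
      _ ≤ ∫⁻ t in A, D * volume B ^ (θ + (1 - 1 / p)) *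
          ∫⁻ u in Ioi (0 : ℝ), ENNReal.ofReal (u ^ (a - 1)) * G (t - u) :=
        setLIntegral_mono' hA hslice
      _ = D * volume B ^ (θ + (1 - 1 / p)) * ∫⁻ t in A,
          ∫⁻ u in Ioi (0 : ℝ), ENNReal.ofReal (u ^ (a - 1)) * G (t - u) :=
        lintegral_const_mul _ hm
      _ ≤ _ := mul_le_mul_right ((hHLS G hGm A hA0 hAt).trans (le_of_eq (by rw [hGN]))) _
  have eB : volume B = volume B ^ (1 / p') * volume B ^ (θ + (1 - 1 / p)) := by
    rw [← ENNReal.rpow_add _ _ hB0 hBt]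
    rw [show 1 / p' + (θ + (1 - 1 / p)) = 1 by rw [hθ]; ring, ENNReal.rpow_one]
  have eA : volume A = volume A ^ (1 / q') * volume A ^ (1 + a - 1 / q) := by
    rw [← ENNReal.rpow_add _ _ hA0 hAt]
    rw [show 1 / q' + (1 + a - 1 / q) = 1 by rw [ha]; ring, ENNReal.rpow_one]
  -- The surplus powers common to both sides. They can be cancelled because the volumes are finite
  -- and, null sets having been treated first, nonzero.
  set X := volume B ^ (θ + (1 - 1 / p)) * volume A ^ (1 + a - 1 / q) with hX
  have hX0 : X ≠ 0 := mul_ne_zero (ENNReal.rpow_pos (pos_iff_ne_zero.2 hB0) hBt).ne'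
    (ENNReal.rpow_pos (pos_iff_ne_zero.2 hA0) hAt).ne'
  have hXt : X ≠ ∞ := ENNReal.mul_ne_top (ENNReal.rpow_ne_top_of_ne_zero hB0 hBt)
    (ENNReal.rpow_ne_top_of_ne_zero hA0 hAt)
  refine (ENNReal.mul_le_mul_iff_left hX0 hXt).1 ?_
  calc volume A ^ (1 / q') * volume B ^ (1 / p') * X
      = (volume B ^ (1 / p') * volume B ^ (θ + (1 - 1 / p))) *
        (volume A ^ (1 / q') * volume A ^ (1 + a - 1 / q)) := by rw [hX]; ring
    _ = volume B * volume A := by rw [← eB, ← eA]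
    _ ≤ _ := htot
    _ = _ := by
      rw [ENNReal.ofReal_mul (by positivity), hX]; ring

theorem exists_tendsto_volume_isCompact {X : Type*} [TopologicalSpace X] [MeasurableSpace X]
    [OpensMeasurableSpace X] {μ : Measure X} [μ.InnerRegularCompactLTTop] {A : Set X}
    (hA : MeasurableSet A) (hAt : μ A ≠ ∞) :
    ∃ K : ℕ → Set X, (∀ j, K j ⊆ A) ∧ (∀ j, IsCompact (K j)) ∧
      Tendsto (fun j => μ (K j)) atTop (𝓝 (μ A)) := by
  have hex : ∀ j : ℕ, ∃ K ⊆ A, IsCompact K ∧ μ A < μ K + ((j : ℝ≥0∞) + 1)⁻¹ := fun j =>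
    hA.exists_isCompact_lt_add hAt (by simp [ENNReal.add_eq_top])
  choose K hKA hKc hK using hex
  refine ⟨K, hKA, hKc, ?_⟩
  have h1 : Tendsto (fun j : ℕ => μ A - ((j : ℝ≥0∞) + 1)⁻¹) atTop (𝓝 (μ A)) := by
    have h2 : Tendsto (fun j : ℕ => ((j : ℝ≥0∞) + 1)⁻¹) atTop (𝓝 0) := by
      have := (tendsto_add_atTop_iff_nat 1).2 ENNReal.tendsto_inv_nat_nhds_zero
      simpa using this
    simpa using ENNReal.Tendsto.sub tendsto_const_nhds h2 (Or.inl hAt)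
  exact tendsto_of_tendsto_of_tendsto_of_le_of_le h1 tendsto_const_nhds
    (fun j => tsub_le_iff_right.2 (hK j).le) (fun j => measure_mono (hKA j))

/-- Every open set containing `A × B` contains products of compact subsets of `A` and `B`. The bound
for these passes to `A × B` by inner regularity of Lebesgue measure. -/
theorem exists_volume_mul_le_capacity {n : ℕ} (hn : 1 ≤ n) {α p q p' q' : ℝ} (hα0 : 0 < α)
    (hα1 : α < 1) (hp : 1 ≤ p) (hq : 1 < q) (hpp : p < p') (hqq : q < q')
    (hpq : (1 / q - 1 / q') + n / (2 * α) * (1 / p - 1 / p') = 1) :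
    ∃ c : ℝ≥0, ∀ (A : Set ℝ) (B : Set (Space n)),
      MeasurableSet A → MeasurableSet B → volume A ≠ ∞ → volume B ≠ ∞ →
      volume A ^ (min p q / q') * volume B ^ (min p q / p') ≤ c * capacity α p q (A ×ˢ B) := by
  have hp0 : 0 < p := one_pos.trans_le hp
  have hq0 : 0 < q := one_pos.trans hq
  have hm : 0 < min p q := lt_min hp0 hq0
  have hp'0 : 0 < p' := hp0.trans hpp
  have hq'0 : 0 < q' := hq0.trans hqq
  obtain ⟨c, hc, hcap⟩ := exists_volume_mul_le_mixedNorm hn hα0 hα1 hp hq hpp hqq hpq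
  set C : ℝ≥0∞ := ENNReal.ofReal (c ^ min p q) with hC
  have hC0 : C ≠ 0 := (ENNReal.ofReal_pos.2 (by positivity)).ne'
  have hCt : C ≠ ∞ := ENNReal.ofReal_ne_top
  have hcomp : ∀ (A : Set ℝ) (B : Set (Space n)), MeasurableSet A → MeasurableSet B →
      volume A ≠ ∞ → volume B ≠ ∞ →
      volume A ^ (min p q / q') * volume B ^ (min p q / p')
        ≤ C * compactCapacity α p q (A ×ˢ B) := by
    intro A B hA hB hAt hBt
    rw [← ENNReal.div_le_iff' hC0 hCt]
    refine le_iInf fun F => le_iInf fun hF => le_iInf fun h1 => ?_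
    rw [ENNReal.div_le_iff' hC0 hCt]
    have h := ENNReal.rpow_le_rpow (hcap F hF A B hA hB hAt hBt h1) hm.le
    rw [ENNReal.mul_rpow_of_nonneg _ _ hm.le, ENNReal.mul_rpow_of_nonneg _ _ hm.le,
      ← ENNReal.rpow_mul, ← ENNReal.rpow_mul, ENNReal.ofReal_rpow_of_pos hc] at h
    convert h using 3 <;> ring
  refine ⟨(c ^ min p q).toNNReal, fun A B hA hB hAt hBt => ?_⟩
  change _ ≤ C * _
  obtain ⟨K, hKA, hKc, hK⟩ := exists_tendsto_volume_isCompact hA hAt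
  obtain ⟨L, hLB, hLc, hL⟩ := exists_tendsto_volume_isCompact hB hBt
  rw [← ENNReal.div_le_iff' hC0 hCt]
  refine le_iInf fun U => le_iInf fun hU => le_iInf fun hUh => le_iInf fun hUE => ?_
  rw [ENNReal.div_le_iff' hC0 hCt]
  have hlim : Tendsto (fun j => volume (K j) ^ (min p q / q') * volume (L j) ^ (min p q / p')) atTop
      (𝓝 (volume A ^ (min p q / q') * volume B ^ (min p q / p'))) := by
    refine ENNReal.Tendsto.mul (((ENNReal.continuous_rpow_const).tendsto _).comp hK)
      (Or.inr ?_) (((ENNReal.continuous_rpow_const).tendsto _).comp hL) (Or.inr ?_)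
    · exact ENNReal.rpow_ne_top_of_nonneg (by positivity) hBt
    · exact ENNReal.rpow_ne_top_of_nonneg (by positivity) hAt
  refine le_of_tendsto' hlim fun j => ?_
  refine (hcomp (K j) (L j) (hKc j).measurableSet (hLc j).measurableSet
    (hKc j).measure_lt_top.ne (hLc j).measure_lt_top.ne).trans (mul_le_mul_right ?_ _)
  exact le_iSup_of_le (K j ×ˢ L j) (le_iSup_of_le ((hKc j).prod (hLc j))
    (le_iSup_of_le ((prod_mono (hKA j) (hLB j)).trans hUE) le_rfl))

/-! ### Covers and null sets for the Hausdorff measures -/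

/-- Covers indexed by any countable type may be used, provided that `φ` takes arbitrarily small
values at small radii. -/
theorem hausdorffCapacity_le_tsum {n : ℕ} {α : ℝ} {φ : ℝ → ℝ≥0∞} {ε : ℝ}
    (hφ : ∀ η : ℝ≥0∞, η ≠ 0 → ∃ r : ℝ, 0 < r ∧ r < ε ∧ φ r ≤ η)
    {ι : Type*} [Countable ι] (z : ι → ℝ × Space n) (r : ι → ℝ) (hz : ∀ i, 0 < (z i).1)
    (hr : ∀ i, 0 < r i ∧ r i < ε) {E : Set (ℝ × Space n)}
    (hE : E ⊆ ⋃ i, parabolicBall α (z i) (r i)) :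
    hausdorffCapacity α φ ε E ≤ ∑' i, φ (r i) := by
  obtain ⟨f, hf⟩ := exists_injective_nat ι
  refine ENNReal.le_of_forall_pos_le_add fun η hη _ => ?_
  obtain ⟨η', hη', hsum⟩ := ENNReal.exists_pos_sum_of_countable
    (ENNReal.coe_ne_zero.2 hη.ne') ℕ
  -- Covers must use every natural number with a positive radius, so unused indices are padded with
  -- balls of summably small gauge.
  choose ρ hρ0 hρε hρ using fun j => hφ (η' j) (ENNReal.coe_ne_zero.2 (hη' j).ne')
  set z' : ℕ → ℝ × Space n := Function.extend f z (fun _ => (1, 0)) with hz'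
  set r' : ℕ → ℝ := Function.extend f r ρ with hr'
  have hz'0 : ∀ j, 0 < (z' j).1 := by
    intro j
    by_cases h : ∃ i, f i = j
    · obtain ⟨i, rfl⟩ := h
      rw [hz', hf.extend_apply]; exact hz i
    · rw [hz', Function.extend_apply' _ _ _ h]; exact one_pos
  have hr'0 : ∀ j, 0 < r' j ∧ r' j < ε := by
    intro j
    by_cases h : ∃ i, f i = j
    · obtain ⟨i, rfl⟩ := h
      rw [hr', hf.extend_apply]; exact hr i
    · rw [hr', Function.extend_apply' _ _ _ h]; exact ⟨hρ0 j, hρε j⟩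
  have hcov : E ⊆ ⋃ j, parabolicBall α (z' j) (r' j) := by
    refine hE.trans (iUnion_subset fun i => ?_)
    refine subset_iUnion_of_subset (f i) ?_
    rw [hz', hr', hf.extend_apply, hf.extend_apply]
  have hle : ∀ j, φ (r' j) ≤ Function.extend f (fun i => φ (r i)) 0 j + η' j := by
    intro j
    by_cases h : ∃ i, f i = j
    · obtain ⟨i, rfl⟩ := h
      rw [hr', hf.extend_apply, hf.extend_apply]; exact le_self_add
    · rw [hr', Function.extend_apply' _ _ _ h, Function.extend_apply' _ _ _ h]
      simpa using hρ j
  calc hausdorffCapacity α φ ε E ≤ ∑' j, φ (r' j) :=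
        iInf_le_of_le z' (iInf_le_of_le r' (iInf_le_of_le hz'0 (iInf_le_of_le hr'0
          (iInf_le _ hcov))))
    _ ≤ ∑' j, (Function.extend f (fun i => φ (r i)) 0 j + η' j) := ENNReal.tsum_le_tsum hle
    _ = ∑' i, φ (r i) + ∑' j, (η' j : ℝ≥0∞) := by
        rw [ENNReal.tsum_add, tsum_extend_zero hf]
    _ ≤ _ := by gcongr

theorem hausdorffMeasure_iUnion_eq_zero {n : ℕ} {α : ℝ} {φ : ℝ → ℝ≥0∞}
    (hφ : ∀ ε : ℝ, 0 < ε → ∀ η : ℝ≥0∞, η ≠ 0 → ∃ r : ℝ, 0 < r ∧ r < ε ∧ φ r ≤ η)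
    {E : ℕ → Set (ℝ × Space n)} (hE : ∀ T, hausdorffMeasure α φ (E T) = 0) :
    hausdorffMeasure α φ (⋃ T, E T) = 0 := by
  refine le_antisymm (iSup_le fun ε => iSup_le fun hε => ?_) (by simp)
  refine ENNReal.le_of_forall_pos_le_add fun η hη _ => ?_
  obtain ⟨η', hη', hsum⟩ := ENNReal.exists_pos_sum_of_countable
    (ENNReal.coe_ne_zero.2 hη.ne') ℕ
  have hex : ∀ T, ∃ (z : ℕ → ℝ × Space n) (r : ℕ → ℝ), (∀ j, 0 < (z j).1) ∧
      (∀ j, 0 < r j ∧ r j < ε) ∧ E T ⊆ ⋃ j, parabolicBall α (z j) (r j) ∧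
      ∑' j, φ (r j) < η' T := by
    intro T
    have h0 : hausdorffCapacity α φ ε (E T) < η' T := by
      have h1 : hausdorffCapacity α φ ε (E T) ≤ hausdorffMeasure α φ (E T) :=
        le_iSup_of_le ε (le_iSup_of_le hε le_rfl)
      rw [hE T] at h1
      exact h1.trans_lt (by simpa using hη' T)
    unfold hausdorffCapacity at h0
    simp only [iInf_lt_iff] at h0
    obtain ⟨z, r, h1, h2, h3, h4⟩ := h0
    exact ⟨z, r, h1, h2, h3, h4⟩
  choose z r hz hr hcov hlt using hex
  have h := hausdorffCapacity_le_tsum (hφ ε hε) (fun i : ℕ × ℕ => z i.1 i.2)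
    (fun i : ℕ × ℕ => r i.1 i.2) (fun i => hz i.1 i.2) (fun i => hr i.1 i.2)
    (E := ⋃ T, E T) (α := α) (by
      refine iUnion_subset fun T => (hcov T).trans (iUnion_subset fun j => ?_)
      exact subset_iUnion_of_subset (T, j) le_rfl)
  refine h.trans ?_
  rw [ENNReal.tsum_prod (f := fun a b => φ (r a b)), zero_add]
  exact (ENNReal.tsum_le_tsum fun T => (hlt T).le).trans hsum.le

/-! ### Dyadic criterion for a finite potential -/

theorem lintegral_prod_rect {n : ℕ} {f : ℝ × Space n → ℝ≥0∞} (hf : Measurable f)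
    (A : Set ℝ) (B : Set (Space n)) :
    ∫⁻ w in A ×ˢ B, f w = ∫⁻ s in A, ∫⁻ y in B, f (s, y) := by
  rw [Measure.volume_eq_prod, ← Measure.prod_restrict, lintegral_prod _ hf.aemeasurable]

/-- On a bounded set the larger exponent can be lowered by Hölder's inequality, in time when `p ≤ q`
and in space when `q < p`. This makes `F^{p∧q}` the density of a locally finite measure, used in the
covering argument. -/
theorem setLIntegral_rpow_lt_top {n : ℕ} {p q : ℝ} (hp : 1 ≤ p) (hq : 1 < q)
    {F : ℝ × Space n → ℝ≥0∞} (hF : Measurable F) (hN : mixedNorm p q F < ∞) (T : ℝ) :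
    ∫⁻ w in Ioo 0 T ×ˢ Metric.ball (0 : Space n) T, F w ^ min p q < ∞ := by
  have hp0 : 0 < p := one_pos.trans_le hp
  have hq0 : 0 < q := one_pos.trans hq
  rw [lintegral_prod_rect (hF.pow_const _)]
  set G : ℝ → ℝ≥0∞ := fun t => ∫⁻ x : Space n, F (t, x) ^ p with hG
  have hGm : Measurable G := measurable_lintegral_rpow hF p
  have hGi : ∫⁻ t in Ioi (0 : ℝ), G t ^ (q / p) < ∞ := by
    unfold mixedNorm at hN
    by_contra h
    rw [not_lt, top_le_iff] at h
    simp only [hG] at h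
    rw [h, ENNReal.top_rpow_of_pos (by positivity)] at hN
    exact lt_irrefl _ hN
  have hGT : ∫⁻ t in Ioo 0 T, G t ^ (q / p) < ∞ :=
    (lintegral_mono_set Ioo_subset_Ioi_self).trans_lt hGi
  have hT : volume (Ioo 0 T) ≠ ∞ := by simp
  have hB : volume (Metric.ball (0 : Space n) T) ≠ ∞ := measure_ball_lt_top.ne
  rcases le_or_gt p q with hpq | hpq
  · rw [min_eq_left hpq]
    have hr : 1 ≤ q / p := (one_le_div hp0).2 hpq
    calc _ ≤ ∫⁻ t in Ioo 0 T, G t := lintegral_mono fun t => setLIntegral_le_lintegral _ _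
      _ ≤ _ := lintegral_le_rpow_mul_measure _ hr hGm.aemeasurable
      _ < ∞ := by
        rw [Measure.restrict_apply_univ]
        refine ENNReal.mul_lt_top (ENNReal.rpow_lt_top_of_nonneg (by positivity) hGT.ne)
          (ENNReal.rpow_lt_top_of_nonneg ?_ hT)
        rw [sub_nonneg]; exact (div_le_one (by positivity)).2 hr
  · rw [min_eq_right hpq.le]
    have hr : 1 ≤ p / q := (one_le_div hq0).2 hpq.le
    calc _ ≤ ∫⁻ t in Ioo 0 T, G t ^ (q / p) *
          volume (Metric.ball (0 : Space n) T) ^ (1 - 1 / (p / q)) := by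
          refine lintegral_mono fun t => ?_
          refine (lintegral_le_rpow_mul_measure _ hr
            ((hF.comp measurable_prodMk_left).pow_const q).aemeasurable).trans ?_
          rw [Measure.restrict_apply_univ]
          refine mul_le_mul_left ?_ _
          rw [show 1 / (p / q) = q / p by field_simp]
          refine ENNReal.rpow_le_rpow ((setLIntegral_le_lintegral _ _).trans (le_of_eq ?_))
            (by positivity)
          refine lintegral_congr fun x => ?_
          rw [← ENNReal.rpow_mul, mul_div_cancel₀ _ hq0.ne']
          rfl
      _ < ∞ := by
        rw [lintegral_mul_const _ (hGm.pow_const _)]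
        refine ENNReal.mul_lt_top hGT (ENNReal.rpow_lt_top_of_nonneg ?_ hB)
        rw [sub_nonneg]; exact (div_le_one (by positivity)).2 hr

theorem measurable_kernel_mul {n : ℕ} (α : ℝ) (z₀ : ℝ × Space n) {F : ℝ × Space n → ℝ≥0∞}
    (hF : Measurable F) :
    Measurable (fun w : ℝ × Space n =>
      ENNReal.ofReal (kernel α (z₀.1 - w.1) (z₀.2 - w.2)) * F w) := by
  have h1 : Measurable (fun w : ℝ × Space n => kernel α (z₀.1 - w.1) (z₀.2 - w.2)) :=
    measurable_kernel_comp α (by fun_prop) (by fun_prop)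
  exact h1.ennreal_ofReal.mul hF

theorem potential_eq_setLIntegral {n : ℕ} {α : ℝ} {F : ℝ × Space n → ℝ≥0∞} (hF : Measurable F)
    (z₀ : ℝ × Space n) :
    potential α F z₀ = ∫⁻ w in Ioo 0 z₀.1 ×ˢ univ,
      ENNReal.ofReal (kernel α (z₀.1 - w.1) (z₀.2 - w.2)) * F w := by
  rw [lintegral_prod_rect (measurable_kernel_mul α z₀ hF)]
  simp only [Measure.restrict_univ]
  rfl

theorem exists_volume_parabolicBall_le {n : ℕ} (hn : 1 ≤ n) (α : ℝ) :
    ∃ c : ℝ, 0 < c ∧ ∀ (z₀ : ℝ × Space n) (r : ℝ), 0 < r →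
      volume (parabolicBall α z₀ r) ≤ ENNReal.ofReal (c * r ^ (n + 2 * α)) := by
  obtain ⟨ω, hω, hvol⟩ := exists_volume_ball hn
  refine ⟨2 * ω, by positivity, fun z₀ r hr => ?_⟩
  have hsub : parabolicBall α z₀ r
      ⊆ Ioo (z₀.1 - r ^ (2 * α)) (z₀.1 + r ^ (2 * α)) ×ˢ Metric.ball z₀.2 r := by
    rintro w ⟨_, h1, h2⟩
    rw [abs_lt] at h1
    exact ⟨⟨by linarith [h1.1], by linarith [h1.2]⟩, mem_ball_iff_norm.2 h2⟩
  refine (measure_mono hsub).trans (le_of_eq ?_)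
  rw [Measure.volume_eq_prod, Measure.prod_prod, Real.volume_Ioo, hvol _ _ hr.le,
    ← ENNReal.ofReal_mul (by ring_nf; positivity), Real.rpow_add hr, Real.rpow_natCast]
  congr 1; ring

theorem kernel_le_of_notMem_parabolicBall {n : ℕ} {α C : ℝ}
    (hC : ∀ r t : ℝ, 0 < r → 0 < t → ∀ x : Space n,
      (r ^ (2 * α) ≤ t ∨ r ≤ ‖x‖) → kernel α t x ≤ C * r ^ (-(n : ℝ)))
    {z₀ w : ℝ × Space n} {r : ℝ} (hr : 0 < r) (hw : w.1 ∈ Ioo 0 z₀.1)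
    (h : w ∉ parabolicBall α z₀ r) :
    kernel α (z₀.1 - w.1) (z₀.2 - w.2) ≤ C * r ^ (-(n : ℝ)) := by
  refine hC r _ hr (by linarith [hw.2]) _ ?_
  by_contra hcon
  push Not at hcon
  refine h ⟨hw.1, ?_, ?_⟩
  · rw [abs_sub_comm, abs_of_pos (by linarith [hw.2])]; exact hcon.1
  · rw [norm_sub_rev]; exact hcon.2

/-- On the shell the kernel is at most a multiple of `r^{-n}`. Hölder's inequality on a ball of
volume at most a multiple of `r^{n+2α}` produces the exponent `-n + (n+2α)(1-1/m) = 2α - (n+2α)/m`.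
-/
theorem exists_shell_le {n : ℕ} (hn : 1 ≤ n) {α m : ℝ} (hα0 : 0 < α) (hα1 : α < 1) (hm : 1 ≤ m) :
    ∃ c : ℝ, 0 < c ∧ ∀ F : ℝ × Space n → ℝ≥0∞, Measurable F → ∀ (z₀ : ℝ × Space n) (r : ℝ), 0 < r →
      ∫⁻ w in Ioo 0 z₀.1 ×ˢ univ, (parabolicBall α z₀ r \ parabolicBall α z₀ (r / 2)).indicator
        (fun w => ENNReal.ofReal (kernel α (z₀.1 - w.1) (z₀.2 - w.2)) * F w) w
      ≤ ENNReal.ofReal c * (ENNReal.ofReal (r ^ (2 * α - (n + 2 * α) / m)) *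
        (∫⁻ w in parabolicBall α z₀ r, F w ^ m) ^ (1 / m)) := by
  have hm0 : 0 < m := one_pos.trans_le hm
  have hm1 : 0 ≤ 1 - 1 / m := by rw [sub_nonneg, div_le_one hm0]; exact hm
  obtain ⟨C, hC0, hC⟩ := exists_kernel_le (n := n) hn hα0 hα1
  obtain ⟨V, hV0, hV⟩ := exists_volume_parabolicBall_le (n := n) hn α
  refine ⟨C * (1 / 2) ^ (-(n : ℝ)) * V ^ (1 - 1 / m), by positivity, fun F hF z₀ r hr => ?_⟩
  have hQm := (isOpen_parabolicBall α z₀ r).measurableSet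
  have hS : MeasurableSet (Ioo 0 z₀.1 ×ˢ (univ : Set (Space n))) :=
    measurableSet_Ioo.prod MeasurableSet.univ
  calc _ ≤ ∫⁻ w in Ioo 0 z₀.1 ×ˢ univ, (parabolicBall α z₀ r).indicator
        (fun w => ENNReal.ofReal (C * (r / 2) ^ (-(n : ℝ))) * F w) w := by
        refine setLIntegral_mono' hS fun w hw => ?_
        by_cases h : w ∈ parabolicBall α z₀ r \ parabolicBall α z₀ (r / 2)
        · rw [indicator_of_mem h, indicator_of_mem h.1]
          refine mul_le_mul_left (ENNReal.ofReal_le_ofReal ?_) _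
          exact kernel_le_of_notMem_parabolicBall hC (by positivity) hw.1 h.2
        · rw [indicator_of_notMem h]; exact zero_le
    _ ≤ ∫⁻ w, (parabolicBall α z₀ r).indicator
        (fun w => ENNReal.ofReal (C * (r / 2) ^ (-(n : ℝ))) * F w) w := setLIntegral_le_lintegral _ _
    _ = ENNReal.ofReal (C * (r / 2) ^ (-(n : ℝ))) * ∫⁻ w in parabolicBall α z₀ r, F w := by
        rw [lintegral_indicator hQm, lintegral_const_mul _ hF]
    _ ≤ ENNReal.ofReal (C * (r / 2) ^ (-(n : ℝ))) *
        ((∫⁻ w in parabolicBall α z₀ r, F w ^ m) ^ (1 / m) *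
          ENNReal.ofReal (V * r ^ (n + 2 * α)) ^ (1 - 1 / m)) := by
        refine mul_le_mul_right ?_ _
        refine (lintegral_le_rpow_mul_measure _ hm hF.aemeasurable).trans ?_
        rw [Measure.restrict_apply_univ]
        exact mul_le_mul_right (ENNReal.rpow_le_rpow (hV z₀ r hr) hm1) _
    _ = _ := by
        rw [ENNReal.ofReal_rpow_of_pos (by positivity), mul_left_comm, mul_comm, ← mul_assoc,
          ← ENNReal.ofReal_mul (by positivity), ← ENNReal.ofReal_mul (by positivity)]
        congr 2
        rw [div_eq_mul_one_div r 2, Real.mul_rpow hr.le (by norm_num),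
          Real.mul_rpow hV0.le (by positivity), ← Real.rpow_mul hr.le,
          show 2 * α - (n + 2 * α) / m = -(n : ℝ) + (n + 2 * α) * (1 - 1 / m) by field_simp; ring,
          Real.rpow_add hr]
        ring

/-- Away from `z₀` the kernel is bounded and each time slice has mass at most one. Hölder's
inequality with the truncated kernel as weight bounds a slice by its `L^p` norm, and Hölder's
inequality in time over the finite interval `(0, z₀.1)` finishes. -/
theorem far_lt_top {n : ℕ} (hn : 1 ≤ n) {α p q : ℝ} (hα0 : 0 < α) (hα1 : α < 1) (hp : 1 ≤ p)
    (hq : 1 < q) {F : ℝ × Space n → ℝ≥0∞} (hF : Measurable F) (hN : mixedNorm p q F < ∞)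
    (z₀ : ℝ × Space n) {r : ℝ} (hr : 0 < r) :
    ∫⁻ w in Ioo 0 z₀.1 ×ˢ univ, (parabolicBall α z₀ r)ᶜ.indicator
      (fun w => ENNReal.ofReal (kernel α (z₀.1 - w.1) (z₀.2 - w.2)) * F w) w < ∞ := by
  have hp0 : 0 < p := one_pos.trans_le hp
  have hq0 : 0 < q := one_pos.trans hq
  have hp1 : 0 ≤ 1 - 1 / p := by rw [sub_nonneg, div_le_one hp0]; exact hp
  have hq1 : 0 ≤ 1 - 1 / q := by rw [sub_nonneg, div_le_one hq0]; exact hq.le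
  obtain ⟨C, hC0, hC⟩ := exists_kernel_le (n := n) hn hα0 hα1
  set κ := ENNReal.ofReal (C * r ^ (-(n : ℝ))) with hκ
  have hQm := (isOpen_parabolicBall α z₀ r).measurableSet
  rw [lintegral_prod_rect ((measurable_kernel_mul α z₀ hF).indicator hQm.compl)]
  set g : ℝ → ℝ≥0∞ := fun s => (∫⁻ y : Space n, F (s, y) ^ p) ^ (1 / p) with hg
  have hgm : Measurable g := (measurable_lintegral_rpow hF p).pow_const _
  have hslice : ∀ s ∈ Ioo 0 z₀.1, ∫⁻ y in univ, (parabolicBall α z₀ r)ᶜ.indicator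
      (fun w => ENNReal.ofReal (kernel α (z₀.1 - w.1) (z₀.2 - w.2)) * F w) (s, y)
      ≤ κ ^ (1 / p) * g s := by
    intro s hs
    have hts : 0 < z₀.1 - s := by linarith [hs.2]
    rw [Measure.restrict_univ]
    set H : Space n → ℝ≥0∞ := fun y => (parabolicBall α z₀ r)ᶜ.indicator
      (fun w => ENNReal.ofReal (kernel α (z₀.1 - w.1) (z₀.2 - w.2))) (s, y) with hH
    have hHm : Measurable H := by
      have h1 : Measurable (fun w : ℝ × Space n => kernel α (z₀.1 - w.1) (z₀.2 - w.2)) :=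
        measurable_kernel_comp α (by fun_prop) (by fun_prop)
      exact (h1.ennreal_ofReal.indicator hQm.compl).comp measurable_prodMk_left
    have hHκ : ∀ y, H y ≤ κ := fun y => by
      simp only [hH]
      by_cases h : (s, y) ∈ (parabolicBall α z₀ r)ᶜ
      · rw [indicator_of_mem h]
        exact ENNReal.ofReal_le_ofReal
          (kernel_le_of_notMem_parabolicBall (w := (s, y)) hC hr hs h)
      · rw [indicator_of_notMem h]; exact zero_le
    have hH1 : ∫⁻ y, H y ≤ 1 := by
      calc ∫⁻ y, H y ≤ ∫⁻ y : Space n, ENNReal.ofReal (kernel α (z₀.1 - s) (z₀.2 - y)) :=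
            lintegral_mono fun y => indicator_le_self _ _ _
        _ = ∫⁻ y : Space n, ENNReal.ofReal (kernel α (z₀.1 - s) y) :=
            lintegral_sub_left_eq_self (fun y : Space n => ENNReal.ofReal (kernel α (z₀.1 - s) y)) _
        _ ≤ 1 := lintegral_kernel_le_one hn hα0 hα1 hts
    have hFm : Measurable (fun y : Space n => F (s, y)) := hF.comp measurable_prodMk_left
    have e : ∀ y : Space n, (parabolicBall α z₀ r)ᶜ.indicator
      (fun w => ENNReal.ofReal (kernel α (z₀.1 - w.1) (z₀.2 - w.2)) * F w) (s, y)
        = H y * F (s, y) := fun y => by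
      simp only [hH]
      by_cases h : (s, y) ∈ (parabolicBall α z₀ r)ᶜ
      · rw [indicator_of_mem h, indicator_of_mem h]
      · rw [indicator_of_notMem h, indicator_of_notMem h, zero_mul]
    simp only [e]
    have hw := lintegral_le_rpow_mul_measure ((volume : Measure (Space n)).withDensity H) hp
      hFm.aemeasurable
    rw [lintegral_withDensity_eq_lintegral_mul _ hHm hFm,
      lintegral_withDensity_eq_lintegral_mul _ hHm (hFm.pow_const p),
      withDensity_apply _ MeasurableSet.univ, setLIntegral_univ] at hw
    simp only [Pi.mul_apply] at hw
    refine hw.trans ?_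
    calc _ ≤ (∫⁻ y : Space n, κ * F (s, y) ^ p) ^ (1 / p) * 1 ^ (1 - 1 / p) := by
          refine mul_le_mul' (ENNReal.rpow_le_rpow (lintegral_mono fun y =>
            mul_le_mul_left (hHκ y) _) (by positivity)) (ENNReal.rpow_le_rpow hH1 hp1)
      _ = _ := by
          rw [ENNReal.one_rpow, mul_one, lintegral_const_mul _ (hFm.pow_const p),
            ENNReal.mul_rpow_of_nonneg _ _ (by positivity)]
  refine (setLIntegral_mono' measurableSet_Ioo hslice).trans_lt ?_
  rw [lintegral_const_mul _ hgm]
  refine ENNReal.mul_lt_top (ENNReal.rpow_lt_top_of_nonneg (by positivity) ENNReal.ofReal_ne_top) ?_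
  refine (lintegral_le_rpow_mul_measure _ hq.le hgm.aemeasurable).trans_lt ?_
  rw [Measure.restrict_apply_univ]
  refine ENNReal.mul_lt_top ?_ (ENNReal.rpow_lt_top_of_nonneg hq1 (by simp))
  refine lt_of_le_of_lt ?_ hN
  unfold mixedNorm
  refine ENNReal.rpow_le_rpow ((lintegral_mono_set Ioo_subset_Ioi_self).trans (le_of_eq ?_))
    (by positivity)
  refine lintegral_congr fun s => ?_
  simp only [hg]
  rw [← ENNReal.rpow_mul]
  congr 1; field_simp

/-- A point strictly earlier than `z₀` leaves the shrinking balls eventually; the shell sought ends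
at the first ball it leaves. -/
theorem exists_mem_dyadic_shell {n : ℕ} {α : ℝ} (hα0 : 0 < α) {z₀ w : ℝ × Space n}
    (hw : w.1 < z₀.1) (k₀ : ℕ) (h : w ∈ parabolicBall α z₀ ((1 / 2 : ℝ) ^ k₀)) :
    ∃ k, w ∈ parabolicBall α z₀ ((1 / 2 : ℝ) ^ (k + k₀)) \
      parabolicBall α z₀ ((1 / 2 : ℝ) ^ (k + k₀) / 2) := by
  classical
  have hex : ∃ k, w ∉ parabolicBall α z₀ ((1 / 2 : ℝ) ^ (k + k₀)) := by
    by_contra hcon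
    push Not at hcon
    have hlim : Tendsto (fun k : ℕ => ((1 / 2 : ℝ) ^ (k + k₀)) ^ (2 * α)) atTop (𝓝 0) := by
      have h1 : Tendsto (fun k : ℕ => (1 / 2 : ℝ) ^ (k + k₀)) atTop (𝓝 0) :=
        (tendsto_add_atTop_iff_nat k₀).2
          (tendsto_pow_atTop_nhds_zero_of_lt_one (by norm_num) (by norm_num))
      have h2 := ((Real.continuousAt_rpow_const 0 (2 * α) (Or.inr (by positivity))).tendsto).comp h1
      rwa [Real.zero_rpow (by positivity)] at h2
    have h3 : |w.1 - z₀.1| ≤ 0 := ge_of_tendsto' hlim fun k => (hcon k).2.1.le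
    have h4 : w.1 - z₀.1 = 0 := abs_eq_zero.1 (le_antisymm h3 (abs_nonneg _))
    linarith
  obtain ⟨j, hj, hmin⟩ : ∃ j, w ∉ parabolicBall α z₀ ((1 / 2 : ℝ) ^ (j + k₀)) ∧
      ∀ i < j, w ∈ parabolicBall α z₀ ((1 / 2 : ℝ) ^ (i + k₀)) :=
    ⟨Nat.find hex, Nat.find_spec hex, fun i hi => not_not.1 (Nat.find_min hex hi)⟩
  rcases j with _ | j
  · rw [zero_add] at hj; exact absurd h hj
  · refine ⟨j, hmin j (Nat.lt_succ_self j), ?_⟩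
    have : (1 / 2 : ℝ) ^ (j + k₀) / 2 = (1 / 2 : ℝ) ^ (j + 1 + k₀) := by ring
    rw [this]; exact hj

/-- Dyadic criterion for the finiteness of the potential at a point. -/
theorem potential_lt_top {n : ℕ} (hn : 1 ≤ n) {α p q : ℝ} (hα0 : 0 < α) (hα1 : α < 1) (hp : 1 ≤ p)
    (hq : 1 < q) {F : ℝ × Space n → ℝ≥0∞} (hF : Measurable F) (hN : mixedNorm p q F < ∞)
    (z₀ : ℝ × Space n) (k₀ : ℕ)
    (hsum : ∑' k : ℕ, ENNReal.ofReal (((1 / 2 : ℝ) ^ (k + k₀)) ^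
        (2 * α - (n + 2 * α) / min p q)) *
      (∫⁻ w in parabolicBall α z₀ ((1 / 2 : ℝ) ^ (k + k₀)), F w ^ min p q) ^ (1 / min p q) < ∞) :
    potential α F z₀ < ∞ := by
  obtain ⟨c, hc, hshell⟩ := exists_shell_le (n := n) hn hα0 hα1 (le_min hp hq.le)
  set f : ℝ × Space n → ℝ≥0∞ := fun w =>
    ENNReal.ofReal (kernel α (z₀.1 - w.1) (z₀.2 - w.2)) * F w with hf
  have hfm : Measurable f := measurable_kernel_mul α z₀ hF
  set Q : ℝ → Set (ℝ × Space n) := fun r => parabolicBall α z₀ r with hQ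
  have hQm : ∀ r, MeasurableSet (Q r) := fun r => (isOpen_parabolicBall α z₀ r).measurableSet
  rw [potential_eq_setLIntegral hF]
  calc _ ≤ ∫⁻ w in Ioo 0 z₀.1 ×ˢ univ, ((Q ((1 / 2 : ℝ) ^ k₀))ᶜ.indicator f w +
        ∑' k : ℕ, (Q ((1 / 2 : ℝ) ^ (k + k₀)) \ Q ((1 / 2 : ℝ) ^ (k + k₀) / 2)).indicator f w) := by
        refine setLIntegral_mono' (measurableSet_Ioo.prod MeasurableSet.univ) fun w hw => ?_
        by_cases h : w ∈ Q ((1 / 2 : ℝ) ^ k₀)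
        · obtain ⟨k, hk⟩ := exists_mem_dyadic_shell hα0 hw.1.2 k₀ h
          refine le_trans ?_ le_add_self
          refine le_trans (le_of_eq ?_) (ENNReal.le_tsum k)
          rw [indicator_of_mem hk]
        · rw [indicator_of_mem h]; exact le_self_add
    _ = (∫⁻ w in Ioo 0 z₀.1 ×ˢ univ, (Q ((1 / 2 : ℝ) ^ k₀))ᶜ.indicator f w) +
        ∑' k : ℕ, ∫⁻ w in Ioo 0 z₀.1 ×ˢ univ,
          (Q ((1 / 2 : ℝ) ^ (k + k₀)) \ Q ((1 / 2 : ℝ) ^ (k + k₀) / 2)).indicator f w := by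
        rw [lintegral_add_left (hfm.indicator (hQm _).compl), lintegral_tsum fun k =>
          (hfm.indicator ((hQm _).diff (hQm _))).aemeasurable]
    _ ≤ (∫⁻ w in Ioo 0 z₀.1 ×ˢ univ, (Q ((1 / 2 : ℝ) ^ k₀))ᶜ.indicator f w) +
        ∑' k : ℕ, ENNReal.ofReal c * (ENNReal.ofReal (((1 / 2 : ℝ) ^ (k + k₀)) ^
          (2 * α - (n + 2 * α) / min p q)) *
          (∫⁻ w in Q ((1 / 2 : ℝ) ^ (k + k₀)), F w ^ min p q) ^ (1 / min p q)) :=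
        add_le_add_right (ENNReal.tsum_le_tsum fun k => hshell F hF z₀ _ (by positivity)) _
    _ < ∞ := by
        rw [ENNReal.tsum_mul_left]
        exact ENNReal.add_lt_top.2 ⟨far_lt_top hn hα0 hα1 hp hq hF hN z₀ (by positivity),
          ENNReal.mul_lt_top ENNReal.ofReal_lt_top hsum⟩

/-- Otherwise the mass of every sufficiently small dyadic ball is at most `M φ(r)`. The series in
the dyadic criterion is then dominated by `M^{1/(p∧q)}` times a tail of the convergent one, so the
potential is finite. The offset `k₁` serves gauges that are infinite at `r = 1`. -/
theorem exists_dyadic_ball_gt {n : ℕ} (hn : 1 ≤ n) {α p q : ℝ} (hα0 : 0 < α) (hα1 : α < 1)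
    (hp : 1 ≤ p) (hq : 1 < q) {F : ℝ × Space n → ℝ≥0∞} (hF : Measurable F)
    (hN : mixedNorm p q F < ∞) {φ : ℝ → ℝ≥0∞} (k₁ : ℕ)
    (hsum : ∑' k : ℕ, ENNReal.ofReal (((1 / 2 : ℝ) ^ (k + k₁)) ^
      (2 * α - (n + 2 * α) / min p q)) * φ ((1 / 2 : ℝ) ^ (k + k₁)) ^ (1 / min p q) < ∞)
    {z : ℝ × Space n} (hz : z ∈ blowUp α F) (M k' : ℕ) :
    ∃ k, k' ≤ k ∧ M * φ ((1 / 2 : ℝ) ^ k)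
      < ∫⁻ w in parabolicBall α z ((1 / 2 : ℝ) ^ k), F w ^ min p q := by
  have hm : 0 < min p q := lt_min (by linarith) (by linarith)
  by_contra hcon
  push Not at hcon
  refine (potential_lt_top hn hα0 hα1 hp hq hF hN z (max k' k₁) ?_).ne hz.2
  obtain ⟨j, hj⟩ : ∃ j, max k' k₁ = j + k₁ :=
    ⟨max k' k₁ - k₁, (Nat.sub_add_cancel (le_max_right _ _)).symm⟩
  set a : ℕ → ℝ≥0∞ := fun k => ENNReal.ofReal (((1 / 2 : ℝ) ^ (k + k₁)) ^
      (2 * α - (n + 2 * α) / min p q)) * φ ((1 / 2 : ℝ) ^ (k + k₁)) ^ (1 / min p q) with ha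
  calc _ ≤ ∑' k : ℕ, (M : ℝ≥0∞) ^ (1 / min p q) * a (k + j) := by
        refine ENNReal.tsum_le_tsum fun k => ?_
        have h1 := hcon (k + max k' k₁) ((le_max_left _ _).trans (Nat.le_add_left _ _))
        have h2 := ENNReal.rpow_le_rpow h1 (show 0 ≤ 1 / min p q by positivity)
        rw [ENNReal.mul_rpow_of_nonneg _ _ (by positivity)] at h2
        refine (mul_le_mul_right h2 _).trans (le_of_eq ?_)
        simp only [ha]
        rw [hj, add_assoc k j k₁]; ring
    _ = (M : ℝ≥0∞) ^ (1 / min p q) * ∑' k : ℕ, a (k + j) := ENNReal.tsum_mul_left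
    _ ≤ (M : ℝ≥0∞) ^ (1 / min p q) * ∑' k : ℕ, a k := by
        refine mul_le_mul_right ?_ _
        exact ENNReal.tsum_comp_le_tsum_of_injective (add_left_injective j) a
    _ < ∞ := ENNReal.mul_lt_top (ENNReal.rpow_lt_top_of_nonneg (by positivity)
        (ENNReal.natCast_ne_top M)) hsum

/-! ### Vitali covering of the blow-up set -/

/-- Serves as the engulfing property for Vitali's theorem. Only the centre of the intersecting ball
is captured, because the set to be covered consists of centres. The factor 3 comes from space and
`(2^{2α} + 1)^{1/(2α)}` from time. -/
theorem exists_enlargement {α : ℝ} (hα0 : 0 < α) :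
    ∃ Λ : ℝ, 1 ≤ Λ ∧ ∀ {n : ℕ} (z w : ℝ × Space n) (r ρ : ℝ), 0 < r → 0 < ρ → r ≤ 2 * ρ →
      0 < z.1 → (parabolicBall α z r ∩ parabolicBall α w ρ).Nonempty →
      z ∈ parabolicBall α w (Λ * ρ) := by
  set b := (2 : ℝ) ^ (2 * α) + 1 with hb
  have hb0 : 0 < b := by positivity
  refine ⟨max 3 (b ^ (1 / (2 * α))), le_max_of_le_left (by norm_num), ?_⟩
  intro n z w r ρ hr hρ hrρ hz hne
  obtain ⟨v, ⟨_, h1, h2⟩, ⟨_, h3, h4⟩⟩ := hne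
  refine ⟨hz, ?_, ?_⟩
  · calc |z.1 - w.1| = |(v.1 - w.1) - (v.1 - z.1)| := by congr 1; ring
      _ ≤ |v.1 - w.1| + |v.1 - z.1| := abs_sub _ _
      _ < ρ ^ (2 * α) + r ^ (2 * α) := add_lt_add h3 h1
      _ ≤ ρ ^ (2 * α) + (2 * ρ) ^ (2 * α) := by gcongr
      _ = (b ^ (1 / (2 * α)) * ρ) ^ (2 * α) := by
          rw [Real.mul_rpow (by positivity) hρ.le, Real.mul_rpow (by positivity) hρ.le,
            ← Real.rpow_mul hb0.le, one_div_mul_cancel (by positivity), Real.rpow_one, hb]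
          ring
      _ ≤ _ := by gcongr; exact le_max_right _ _
  · calc ‖z.2 - w.2‖ = ‖(v.2 - w.2) - (v.2 - z.2)‖ := by congr 1; abel
      _ ≤ ‖v.2 - w.2‖ + ‖v.2 - z.2‖ := norm_sub_le _ _
      _ < ρ + r := add_lt_add h4 h2
      _ ≤ 3 * ρ := by linarith
      _ ≤ _ := by gcongr; exact le_max_left _ _

theorem parabolicBall_subset_rect {n : ℕ} {α : ℝ} (hα0 : 0 < α) {z : ℝ × Space n} {r T : ℝ}
    (hr : 0 < r) (hr1 : r ≤ 1) (hz1 : z.1 < T) (hz2 : ‖z.2‖ < T) :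
    parabolicBall α z r ⊆ Ioo 0 (T + 1) ×ˢ Metric.ball 0 (T + 1) := by
  rintro w ⟨h0, h1, h2⟩
  have h3 : r ^ (2 * α) ≤ 1 := Real.rpow_le_one hr.le hr1 (by positivity)
  rw [abs_lt] at h1
  refine ⟨⟨h0, by linarith [h1.2]⟩, ?_⟩
  rw [mem_ball_zero_iff]
  calc ‖w.2‖ = ‖(w.2 - z.2) + z.2‖ := by congr 1; abel
    _ ≤ ‖w.2 - z.2‖ + ‖z.2‖ := norm_add_le _ _
    _ < T + 1 := by linarith

/-- The blow-up set is null for every doubling gauge satisfying a dyadic summability condition. -/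
theorem hausdorffMeasure_blowUp_eq_zero {n : ℕ} (hn : 1 ≤ n) {α p q : ℝ} (hα0 : 0 < α)
    (hα1 : α < 1) (hp : 1 ≤ p) (hq : 1 < q) {F : ℝ × Space n → ℝ≥0∞} (hF : Measurable F)
    (hN : mixedNorm p q F < ∞) {φ : ℝ → ℝ≥0∞}
    (hφ : ∀ ε : ℝ, 0 < ε → ∀ η : ℝ≥0∞, η ≠ 0 → ∃ r : ℝ, 0 < r ∧ r < ε ∧ φ r ≤ η)
    (hdoub : ∀ Λ : ℝ, 1 ≤ Λ → ∃ (D : ℝ≥0) (ε₀ : ℝ), 0 < ε₀ ∧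
      ∀ r, 0 < r → r < ε₀ → φ (Λ * r) ≤ D * φ r) (k₁ : ℕ)
    (hsum : ∑' k : ℕ, ENNReal.ofReal (((1 / 2 : ℝ) ^ (k + k₁)) ^
      (2 * α - (n + 2 * α) / min p q)) * φ ((1 / 2 : ℝ) ^ (k + k₁)) ^ (1 / min p q) < ∞) :
    hausdorffMeasure α φ (blowUp α F) = 0 := by
  obtain ⟨Λ, hΛ1, hΛ⟩ := exists_enlargement hα0
  obtain ⟨D, ε₀, hε₀, hD⟩ := hdoub Λ hΛ1
  have hΛ0 : 0 < Λ := one_pos.trans_le hΛ1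
  -- Localisation puts all selected balls into one bounded set, on which `F^{p∧q}` has finite
  -- integral.
  set E : ℕ → Set (ℝ × Space n) := fun T => blowUp α F ∩ {z | z.1 < T ∧ ‖z.2‖ < T} with hE
  have hEU : blowUp α F = ⋃ T, E T := by
    refine Subset.antisymm (fun z hz => ?_) (iUnion_subset fun T => inter_subset_left)
    obtain ⟨T, hT⟩ := exists_nat_gt (max z.1 ‖z.2‖)
    exact mem_iUnion.2 ⟨T, hz, (le_max_left _ _).trans_lt hT, (le_max_right _ _).trans_lt hT⟩
  rw [hEU]
  refine hausdorffMeasure_iUnion_eq_zero hφ fun T => ?_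
  set ν : Measure (ℝ × Space n) := volume.withDensity (fun w => F w ^ min p q) with hν
  set S : Set (ℝ × Space n) := Ioo 0 ((T : ℝ) + 1) ×ˢ Metric.ball 0 ((T : ℝ) + 1) with hS
  have hSm : MeasurableSet S := measurableSet_Ioo.prod Metric.isOpen_ball.measurableSet
  have hνS : ν S < ∞ := by
    rw [hν, withDensity_apply _ hSm]
    exact setLIntegral_rpow_lt_top hp hq hF hN _
  refine le_antisymm (iSup_le fun ε => iSup_le fun hε => ?_) (by simp)
  -- The balls of large mass are thinned to a disjoint family whose enlargements cover `E T`, so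
  -- their masses add up to at most `ν S`. The bound holds for every `M` with a finite right side,
  -- which forces the Hausdorff capacity to vanish.
  have hM : ∀ M : ℕ, M * hausdorffCapacity α φ ε (E T) ≤ D * ν S := by
    intro M
    obtain ⟨k', hk'⟩ := exists_pow_lt_of_lt_one (show 0 < min (ε / Λ) ε₀ by positivity)
      (show (1 / 2 : ℝ) < 1 by norm_num)
    choose! k hk1 hk2 using fun z (hz : z ∈ blowUp α F) =>
      exists_dyadic_ball_gt hn hα0 hα1 hp hq hF hN k₁ hsum hz M k'
    set r : ℝ × Space n → ℝ := fun z => (1 / 2 : ℝ) ^ k z with hr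
    have hr0 : ∀ z, 0 < r z := fun z => by positivity
    have hr1 : ∀ z, r z ≤ 1 := fun z => pow_le_one₀ (by norm_num) (by norm_num)
    have hrlt : ∀ z ∈ E T, r z < min (ε / Λ) ε₀ := fun z hz =>
      (pow_le_pow_of_le_one (by norm_num) (by norm_num) (hk1 z hz.1)).trans_lt hk'
    have hself : ∀ z ∈ E T, z ∈ parabolicBall α z (r z) := fun z hz =>
      ⟨hz.1.1, by simpa using Real.rpow_pos_of_pos (hr0 z) _, by simpa using hr0 z⟩
    obtain ⟨u, huE, hdisj, hcov⟩ := Vitali.exists_disjoint_subfamily_covering_enlargement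
      (fun z => parabolicBall α z (r z)) (E T) r 2 one_lt_two (fun z _ => (hr0 z).le) 1
      (fun z _ => hr1 z) (fun z hz => ⟨z, hself z hz⟩)
    have huc : u.Countable := hdisj.countable_of_isOpen
      (fun z _ => isOpen_parabolicBall α z _) (fun z hz => ⟨z, hself z (huE hz)⟩)
    have : Countable u := huc.to_subtype
    have hH : hausdorffCapacity α φ ε (E T) ≤ ∑' z : u, φ (Λ * r z) := by
      refine hausdorffCapacity_le_tsum (hφ ε hε) (fun z : u => (z : ℝ × Space n))
        (fun z : u => Λ * r z) (fun z => (huE z.2).1.1) (fun z => ⟨mul_pos hΛ0 (hr0 _), ?_⟩)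
        (fun z hz => ?_)
      · have := (hrlt z (huE z.2)).trans_le (min_le_left _ _)
        rw [lt_div_iff₀ hΛ0] at this
        linarith
      · obtain ⟨w, hw, hne, hle⟩ := hcov z hz
        exact mem_iUnion.2 ⟨⟨w, hw⟩, hΛ z w (r z) (r w) (hr0 z) (hr0 w) hle hz.1.1 hne⟩
    calc M * hausdorffCapacity α φ ε (E T) ≤ M * ∑' z : u, φ (Λ * r z) := mul_le_mul_right hH _
      _ ≤ M * ∑' z : u, D * φ (r z) := by
          refine mul_le_mul_right (ENNReal.tsum_le_tsum fun z => ?_) _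
          exact hD _ (hr0 _) ((hrlt z (huE z.2)).trans_le (min_le_right _ _))
      _ = D * ∑' z : u, M * φ (r z) := by
          rw [ENNReal.tsum_mul_left, ENNReal.tsum_mul_left, mul_left_comm]
      _ ≤ D * ∑' z : u, ν (parabolicBall α z (r z)) := by
          refine mul_le_mul_right (ENNReal.tsum_le_tsum fun z => ?_) _
          rw [hν, withDensity_apply _ (isOpen_parabolicBall α _ _).measurableSet]
          exact (hk2 z (huE z.2).1).le
      _ = D * ν (⋃ z ∈ u, parabolicBall α z (r z)) := by
          rw [measure_biUnion huc hdisj fun z _ => (isOpen_parabolicBall α _ _).measurableSet]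
      _ ≤ D * ν S := by
          refine mul_le_mul_right (measure_mono (iUnion₂_subset fun z hz => ?_)) _
          exact parabolicBall_subset_rect hα0 (hr0 z) (hr1 z) (huE hz).2.1 (huE hz).2.2
  have hfin : (D : ℝ≥0∞) * ν S ≠ ∞ := ENNReal.mul_ne_top ENNReal.coe_ne_top hνS.ne
  by_contra hcon
  have hpos : hausdorffCapacity α φ ε (E T) ≠ 0 := fun h => hcon (by rw [h])
  obtain ⟨M, hMlt⟩ := ENNReal.exists_nat_mul_gt hpos hfin
  exact absurd (hM M) (not_le.2 hMlt)

/-! ### Dimension and logarithmic measure of the blow-up set -/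

theorem parabolicDim_le {n : ℕ} {α d₀ : ℝ} (hd₀ : 0 < d₀) {E : Set (ℝ × Space n)}
    (h : ∀ d, d₀ < d → hausdorffMeasure α (powGauge d) E = 0) :
    parabolicDim α E ≤ ENNReal.ofReal d₀ := by
  have hlim : Tendsto (fun k : ℕ => ENNReal.ofReal (d₀ + 1 / ((k : ℝ) + 1))) atTop
      (𝓝 (ENNReal.ofReal d₀)) := by
    have := (tendsto_one_div_add_atTop_nhds_zero_nat (𝕜 := ℝ)).const_add d₀
    rw [add_zero] at this
    exact ENNReal.tendsto_ofReal this
  refine ge_of_tendsto' hlim fun k => ?_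
  have hk : (0 : ℝ) < 1 / ((k : ℝ) + 1) := by positivity
  exact iInf_le_of_le _ (iInf_le_of_le (by linarith) (iInf_le _ (h _ (by linarith))))

theorem hausdorffMeasure_powGauge_blowUp {n : ℕ} (hn : 1 ≤ n) {α p q : ℝ} (hα0 : 0 < α)
    (hα1 : α < 1) (hp : 1 ≤ p) (hq : 1 < q) {F : ℝ × Space n → ℝ≥0∞} (hF : Measurable F)
    (hN : mixedNorm p q F < ∞) {d : ℝ} (hd0 : 0 < d)
    (hd : n - 2 * α * (min p q - 1) < d) :
    hausdorffMeasure α (powGauge d) (blowUp α F) = 0 := by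
  have hm : 0 < min p q := lt_min (by linarith) (by linarith)
  refine hausdorffMeasure_blowUp_eq_zero hn hα0 hα1 hp hq hF hN (fun ε hε η hη => ?_)
    (fun Λ hΛ => ?_) 0 ?_
  · have hlim : Tendsto (fun k : ℕ => powGauge d ((1 / 2 : ℝ) ^ k)) atTop (𝓝 0) := by
      have h1 : Tendsto (fun k : ℕ => (1 / 2 : ℝ) ^ k) atTop (𝓝 0) :=
        tendsto_pow_atTop_nhds_zero_of_lt_one (by norm_num) (by norm_num)
      have h2 := ((ENNReal.continuous_rpow_const (y := d)).tendsto _).comp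
        (ENNReal.tendsto_ofReal h1)
      rwa [ENNReal.ofReal_zero, ENNReal.zero_rpow_of_pos hd0] at h2
    have h1 : Tendsto (fun k : ℕ => (1 / 2 : ℝ) ^ k) atTop (𝓝 0) :=
      tendsto_pow_atTop_nhds_zero_of_lt_one (by norm_num) (by norm_num)
    obtain ⟨k, hk1, hk2⟩ := ((h1.eventually (gt_mem_nhds hε)).and
      (hlim.eventually (ge_mem_nhds (pos_iff_ne_zero.2 hη)))).exists
    exact ⟨_, by positivity, hk1, hk2⟩
  · refine ⟨(Λ ^ d).toNNReal, 1, one_pos, fun r hr _ => le_of_eq ?_⟩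
    have hΛ0 : 0 < Λ := one_pos.trans_le hΛ
    have e : (((Λ ^ d).toNNReal : ℝ≥0) : ℝ≥0∞) = ENNReal.ofReal (Λ ^ d) := rfl
    rw [powGauge, powGauge, e, ENNReal.ofReal_mul hΛ0.le,
      ENNReal.mul_rpow_of_nonneg _ _ hd0.le, ENNReal.ofReal_rpow_of_pos hΛ0]
  -- Here `σ` is `d` minus the critical dimension, divided by `p ∧ q`. It is positive, so the series
  -- is geometric with ratio `2^{-σ} < 1`.
  · set σ := 2 * α - (n + 2 * α) / min p q + d / min p q with hσ
    have hσ0 : 0 < σ := by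
      have : σ = (d - (n - 2 * α * (min p q - 1))) / min p q := by rw [hσ]; field_simp; ring
      rw [this]; exact div_pos (by linarith) hm
    set ρ : ℝ := (1 / 2 : ℝ) ^ σ with hρ
    have hρ0 : 0 < ρ := by positivity
    have hρ1 : ρ < 1 := Real.rpow_lt_one (by norm_num) (by norm_num) hσ0
    have e : ∀ k : ℕ, ENNReal.ofReal (((1 / 2 : ℝ) ^ (k + 0)) ^
        (2 * α - (n + 2 * α) / min p q)) * powGauge d ((1 / 2 : ℝ) ^ (k + 0)) ^ (1 / min p q)
        = ENNReal.ofReal (ρ ^ k) := by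
      intro k
      have hk : (0 : ℝ) < (1 / 2) ^ k := by positivity
      rw [add_zero, powGauge, ← ENNReal.rpow_mul, ENNReal.ofReal_rpow_of_pos hk,
        ← ENNReal.ofReal_mul (by positivity), ← Real.rpow_add hk, mul_one_div, ← hσ, hρ,
        ← Real.rpow_natCast, ← Real.rpow_natCast, ← Real.rpow_mul (by norm_num),
        ← Real.rpow_mul (by norm_num), mul_comm σ]
    simp only [e]
    exact (summable_geometric_of_lt_one hρ0.le hρ1).tsum_ofReal_lt_top

theorem logGauge_eq {γ r : ℝ} (hr : 0 < r) (hr1 : r < 1) :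
    logGauge γ r = ENNReal.ofReal (Real.log (1 / r) ^ (-γ)) := by
  have h : 0 < Real.log (1 / r) := Real.log_pos ((one_lt_div hr).2 hr1)
  rw [logGauge, if_neg (not_le.2 hr), max_eq_right h.le, ENNReal.ofReal_rpow_of_pos h]

theorem log_one_div_half_pow (k : ℕ) : Real.log (1 / (1 / 2 : ℝ) ^ k) = k * Real.log 2 := by
  rw [one_div, ← inv_pow, one_div, inv_inv, Real.log_pow]

theorem hausdorffMeasure_logGauge_blowUp {n : ℕ} (hn : 1 ≤ n) {α p q : ℝ} (hα0 : 0 < α)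
    (hα1 : α < 1) (hp : 1 ≤ p) (hq : 1 < q) {F : ℝ × Space n → ℝ≥0∞} (hF : Measurable F)
    (hN : mixedNorm p q F < ∞) (hd : n - 2 * α * (min p q - 1) = 0) {ε : ℝ} (hε : 0 < ε) :
    hausdorffMeasure α (logGauge (min p q + ε)) (blowUp α F) = 0 := by
  have hm : 0 < min p q := lt_min (by linarith) (by linarith)
  set γ := min p q + ε with hγ
  have hγ0 : 0 < γ := by positivity
  have hlog2 : 0 < Real.log 2 := Real.log_pos one_lt_two
  have hhalf : Tendsto (fun k : ℕ => (1 / 2 : ℝ) ^ (k + 1)) atTop (𝓝 0) :=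
    (tendsto_add_atTop_iff_nat 1).2
      (tendsto_pow_atTop_nhds_zero_of_lt_one (by norm_num) (by norm_num))
  have hhalf1 : ∀ k : ℕ, (1 / 2 : ℝ) ^ (k + 1) < 1 := fun k =>
    pow_lt_one₀ (by norm_num) (by norm_num) (by simp)
  have hval : ∀ k : ℕ, logGauge γ ((1 / 2 : ℝ) ^ (k + 1))
      = ENNReal.ofReal ((((k + 1 : ℕ) : ℝ) * Real.log 2) ^ (-γ)) := fun k => by
    rw [logGauge_eq (by positivity) (hhalf1 k), log_one_div_half_pow]
  -- The dyadic radii start at `1/2`, given by the index 1 on the next line, because the logarithmic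
  -- gauge is infinite at radius one.
  refine hausdorffMeasure_blowUp_eq_zero hn hα0 hα1 hp hq hF hN (fun ε' hε' η hη => ?_)
    (fun Λ hΛ => ?_) 1 ?_
  · have hlim : Tendsto (fun k : ℕ => logGauge γ ((1 / 2 : ℝ) ^ (k + 1))) atTop (𝓝 0) := by
      simp only [hval]
      have h1 : Tendsto (fun k : ℕ => ((k + 1 : ℕ) : ℝ) * Real.log 2) atTop atTop :=
        ((tendsto_add_atTop_iff_nat 1).2 tendsto_natCast_atTop_atTop).atTop_mul_const hlog2
      have h2 := (tendsto_rpow_neg_atTop hγ0).comp h1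
      have h3 := ENNReal.tendsto_ofReal h2
      rwa [ENNReal.ofReal_zero] at h3
    obtain ⟨k, hk1, hk2⟩ := ((hhalf.eventually (gt_mem_nhds hε')).and
      (hlim.eventually (ge_mem_nhds (pos_iff_ne_zero.2 hη)))).exists
    exact ⟨_, by positivity, hk1, hk2⟩
  · have hΛ0 : 0 < Λ := one_pos.trans_le hΛ
    -- For `Λ² r < 1` one has `log(1/(Λr)) ≥ ½ log(1/r)`, so enlarging the radius costs at most the
    -- factor `2^γ`.
    refine ⟨((1 / 2 : ℝ) ^ (-γ)).toNNReal, min (1 / 2) (1 / Λ ^ 2), by positivity,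
      fun r hr hlt => ?_⟩
    have hr1 : r < 1 := (hlt.trans_le (min_le_left _ _)).trans (by norm_num)
    have hr2 : r * Λ ^ 2 < 1 := by
      have := hlt.trans_le (min_le_right _ _)
      rwa [lt_div_iff₀ (by positivity)] at this
    have hΛr1 : Λ * r < 1 := by
      refine lt_of_le_of_lt ?_ hr2
      rw [mul_comm]; exact mul_le_mul_of_nonneg_left (by nlinarith) hr.le
    have hlr : 0 < Real.log (1 / r) := Real.log_pos ((one_lt_div hr).2 hr1)
    have e : ((((1 / 2 : ℝ) ^ (-γ)).toNNReal : ℝ≥0) : ℝ≥0∞) = ENNReal.ofReal ((1 / 2) ^ (-γ)) := rfl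
    rw [logGauge_eq (by positivity) hΛr1, logGauge_eq hr hr1, e, ← ENNReal.ofReal_mul (by positivity),
      ← Real.mul_rpow (by norm_num) hlr.le]
    refine ENNReal.ofReal_le_ofReal (Real.rpow_le_rpow_of_nonpos (by positivity) ?_ (by linarith))
    have h1 : 2 * Real.log (1 / (Λ * r)) = Real.log ((1 / (Λ * r)) ^ 2) := by
      rw [Real.log_pow]; norm_num
    have h2 : Real.log (1 / r) ≤ Real.log ((1 / (Λ * r)) ^ 2) := by
      refine Real.log_le_log (by positivity) ?_
      rw [div_pow, one_pow, one_div_le_one_div hr (by positivity)]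
      calc (Λ * r) ^ 2 = r * (r * Λ ^ 2) := by ring
        _ ≤ r * 1 := by gcongr
        _ = r := mul_one r
    linarith
  -- At the critical dimension the power of `r` disappears, and the terms are a constant times
  -- `(k+1)^{-s}` with `s = γ/(p∧q)`. The added `ε` in the gauge gives `s > 1`.
  · have hexp : 2 * α - (n + 2 * α) / min p q = 0 := by
      have : (n : ℝ) + 2 * α = 2 * α * min p q := by linarith
      rw [this]; field_simp; ring
    have hs : 1 < γ * (1 / min p q) := by
      rw [mul_one_div, lt_div_iff₀ hm]; linarith
    set s := γ * (1 / min p q) with hsd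
    have e : ∀ k : ℕ, ENNReal.ofReal (((1 / 2 : ℝ) ^ (k + 1)) ^
        (2 * α - (n + 2 * α) / min p q)) * logGauge γ ((1 / 2 : ℝ) ^ (k + 1)) ^ (1 / min p q)
        = ENNReal.ofReal (Real.log 2 ^ (-s) * (((k + 1 : ℕ) : ℝ) ^ s)⁻¹) := by
      intro k
      have hk : (0 : ℝ) < ((k + 1 : ℕ) : ℝ) := by positivity
      rw [hexp, Real.rpow_zero, ENNReal.ofReal_one, one_mul, hval,
        ENNReal.ofReal_rpow_of_nonneg (by positivity) (by positivity),
        ← Real.rpow_mul (by positivity), neg_mul, ← hsd, Real.mul_rpow hk.le hlog2.le,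
        Real.rpow_neg hk.le, mul_comm]
    simp only [e]
    have hsum : Summable (fun k : ℕ => Real.log 2 ^ (-s) * (((k + 1 : ℕ) : ℝ) ^ s)⁻¹) :=
      ((summable_nat_add_iff 1).2 (Real.summable_nat_rpow_inv.2 hs)).mul_left _
    exact hsum.tsum_ofReal_lt_top

end FracDiss

/-! ### Assembly of the three statements -/

theorem corollary1p4 (n : ℕ) (hn : 1 ≤ n) (α : ℝ) (hα0 : 0 < α) (hα1 : α < 1)
    (p q : ℝ) (hp : 1 ≤ p) (hq : 1 < q) :
    -- (i)
    (∀ p' q' : ℝ, p < p' → q < q' → 0 < FracDiss.betaExp n α p q →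
      (1 / q - 1 / q') + n / (2 * α) * (1 / p - 1 / p') = 1 →
      ∃ c : ℝ≥0,
        (∀ (A : Set ℝ) (B : Set (FracDiss.Space n)), A ⊆ Set.Ioi 0 →
          MeasurableSet A → Bornology.IsBounded A → MeasurableSet B → Bornology.IsBounded B →
          volume A ^ (min p q / q') * volume B ^ (min p q / p')
            ≤ c * FracDiss.capacity α p q (A ×ˢ B)) ∧
        (∀ τ : ℝ, 0 < τ → ∃ δ : ℝ, 0 < δ ∧ δ < 1 ∧
          ∀ (A : Set ℝ) (B : Set (FracDiss.Space n)), A ⊆ Set.Ici τ →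
            MeasurableSet A → Bornology.IsBounded A → MeasurableSet B → Bornology.IsBounded B →
            FracDiss.capacity α p q (A ×ˢ B)
              ≤ c * FracDiss.hausdorffCapacity α
                  (FracDiss.powGauge (FracDiss.betaExp n α p q)) δ (A ×ˢ B))) ∧
    -- (ii)
    (0 < FracDiss.betaExp n α p q →
      (∃ c : ℝ≥0, ∀ τ : ℝ, 0 < τ → ∃ δ : ℝ, 0 < δ ∧ δ < 1 ∧
        ∀ K : Set (ℝ × FracDiss.Space n), IsCompact K → (∀ z ∈ K, τ ≤ z.1) →
          FracDiss.compactCapacity α p q K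
            ≤ c * FracDiss.hausdorffCapacity α
                (FracDiss.powGauge (FracDiss.betaExp n α p q)) δ K) ∧
      (0 < n - 2 * α * (min p q - 1) →
        ∀ F : ℝ × FracDiss.Space n → ℝ≥0∞, Measurable F → FracDiss.mixedNorm p q F < ∞ →
          FracDiss.parabolicDim α (FracDiss.blowUp α F)
            ≤ ENNReal.ofReal (n - 2 * α * (min p q - 1)))) ∧
    -- (iii)
    (n / p + 2 * α / q - 2 * α = 0 →
      (∃ c : ℝ≥0, ∀ τ : ℝ, 0 < τ → ∃ δ : ℝ, 0 < δ ∧ δ < 1 ∧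
        ∀ K : Set (ℝ × FracDiss.Space n), IsCompact K → (∀ z ∈ K, τ ≤ z.1) →
          FracDiss.compactCapacity α p q K
            ≤ c * FracDiss.hausdorffCapacity α
                (FracDiss.logGauge (min p q * (1 - 1 / q))) δ K) ∧
      (n - 2 * α * (min p q - 1) = 0 →
        ∀ ε : ℝ, 0 < ε →
        ∀ F : ℝ × FracDiss.Space n → ℝ≥0∞, Measurable F → FracDiss.mixedNorm p q F < ∞ →
          FracDiss.hausdorffMeasure α (FracDiss.logGauge (min p q + ε))
            (FracDiss.blowUp α F) = 0)) := by
  refine ⟨fun p' q' hpp hqq hβ hpq => ?_, fun hβ => ⟨?_, fun hd F hF hN => ?_⟩,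
    fun hβ => ⟨?_, fun hd ε hε F hF hN => ?_⟩⟩
  · obtain ⟨c₁, hc₁⟩ :=
      FracDiss.exists_volume_mul_le_capacity hn hα0 hα1 hp hq hpp hqq hpq
    obtain ⟨c₂, -, hc₂⟩ := FracDiss.exists_capacity_le_powGauge hn hα0 hp hq hβ
    refine ⟨max c₁ c₂, fun A B _ hA hAb hB hBb => ?_, fun τ hτ => ?_⟩
    · refine (hc₁ A B hA hB hAb.measure_lt_top.ne hBb.measure_lt_top.ne).trans ?_
      gcongr
      exact le_max_left _ _
    · obtain ⟨δ, hδ0, hδ1, hδ⟩ := hc₂ τ hτ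
      refine ⟨δ, hδ0, hδ1, fun A B hA _ _ _ _ => (hδ _ fun z hz => hA hz.1).2.trans ?_⟩
      gcongr
      exact le_max_right _ _
  · obtain ⟨c, -, hc⟩ := FracDiss.exists_capacity_le_powGauge hn hα0 hp hq hβ
    refine ⟨c, fun τ hτ => ?_⟩
    obtain ⟨δ, hδ0, hδ1, hδ⟩ := hc τ hτ
    exact ⟨δ, hδ0, hδ1, fun K _ hK => (hδ K hK).1⟩
  · exact FracDiss.parabolicDim_le hd fun d hdd =>
      FracDiss.hausdorffMeasure_powGauge_blowUp hn hα0 hα1 hp hq hF hN (hd.trans hdd) hdd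
  · obtain ⟨c, hc⟩ := FracDiss.exists_capacity_le_logGauge hn hα0 hp hq hβ
    refine ⟨c, fun τ hτ => ?_⟩
    obtain ⟨δ, hδ0, hδ1, hδ⟩ := hc τ hτ
    exact ⟨δ, hδ0, hδ1, fun K _ hK => hδ K hK⟩
  · exact FracDiss.hausdorffMeasure_logGauge_blowUp hn hα0 hα1 hp hq hF hN hd hε
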